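/- **Model.** An MR algorithm proceeds in rounds. In a round, the current multiset of key-value pairs is transformed by applying a (randomized) reducer function independently to each group of pairs having the same key; a reducer produces pairs for the next round and final output pairs, and the computation ends when no pairs are left to process. Keys and values are finite sequences of words of $O(\log n)$ bits. In $\mathrm{MR}(M_G,M_L)$, the pairs received and produced by one reducer in a round occupy at most $M_L$ words (local memory), and all pairs received and produced in a round, together with all output produced so far, occupy at most $M_G$ words (global memory). The complexity is the number of rounds; local computation is not charged. **Algorithms.** Let $G=(V,E)$ be an undirected connected graph with $n\ge 2$ nodes and $m$ edges and let $\tau>0$ be an integer; logarithms without a base are to base $2$. Clusters are disjoint sets of nodes, each grown from a center; in one cluster-growing step every uncovered node adjacent to a covered node joins the cluster of one of its covered neighbors, arbitrarily chosen. $\mathtt{CLUSTER}(\tau)$: start with no clusters. While the set $U$ of uncovered nodes satisfies $|U|\ge 8\tau\log n$: select each node of $U$ as the center of a new singleton cluster independently with probability $4\tau\log n/|U|$; then grow all clusters, one step at a time, until at least $|U|/2$ of the nodes of $U$ are covered. At the end every uncovered node becomes a singleton cluster. $\mathtt{CLUSTER2}(\tau)$: run $\mathtt{CLUSTER}(\tau)$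 and let $R_{\rm ALG}$ be the maximum distance in $G$ of a node from the center of its cluster. Start again with no clusters. For $i=1,\dots,\lceil\log n\rceil$: select each uncovered node as the center of a new singleton cluster independently with probability $\min\{1,2^i/n\}$; then perform $2R_{\rm ALG}$ cluster-growing steps. Let $R$ be the total number of cluster-growing steps performed by the algorithm (for $\mathtt{CLUSTER2}$, including those of its call of $\mathtt{CLUSTER}$), where an iteration of the while loop in which the new centers alone already cover $|U|/2$ nodes, so that nothing is grown, is counted as one step. **Lemma.** There are absolute constants $c$ and $C$ such that, for all $M_L\ge c$ and $M_G\ge c\,m$, $\mathtt{CLUSTER}(\tau)$ (resp. $\mathtt{CLUSTER2}(\tau)$), for some way of making the arbitrary choices, can be implemented in $\mathrm{MR}(M_G,M_L)$, by an MR algorithm that may depend on $n,m,\tau,M_G,M_L$ but not on $G$, given the nodes and edges of $G$ as input pairs and producing as output, for every node, the center of its cluster. The implementation terminates exactly for those outcomes of the random choices for which $\mathtt{CLUSTER}(\tau)$ (resp. $\mathtt{CLUSTER2}(\tau)$) terminates, and then uses at most $$C\cdot\max\{1,R\}\cdot\max\{1,\log_{M_L} m\}$$ rounds. In particular, for all constants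 $a,\epsilon>0$ there is a constant $C'$ depending only on $a,\epsilon$ such that, if moreover $M_L\ge a\,n^{\epsilon}$, the number of rounds of the same implementation is at most $C'\max\{1,R\}$. -/

import Mathlib

open MeasureTheory

/-! ### Clusterings grown from centers -/

namespace GraphClustering

/-- A partial clustering of the node set `V`: `c v = some z` means that `v` belongs to the cluster
centered at `z`, and `c v = none` means that `v` is not covered. -/
abbrev PartialClustering (V : Type) := V → Option V

/-- The partial clustering with no clusters. -/
def noClusters (V : Type) : PartialClustering V := fun _ => none

open Classical in
/-- The set of the nodes that are not covered by any cluster. -/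
noncomputable def uncovered {V : Type} [Fintype V] (c : PartialClustering V) : Finset V :=
  Finset.univ.filter fun v => c v = none

open Classical in
/-- Independent selection of new centers: with coins `x v` uniform on `[0, 1]`, every uncovered
node `v` with `x v ≤ p` (an event of probability `min 1 p`, for `p ≥ 0`) becomes the center of a
new singleton cluster. -/
noncomputable def selectCenters {V : Type} (c : PartialClustering V) (x : V → unitInterval)
    (p : ℝ) : PartialClustering V :=
  fun v => if c v = none ∧ (x v : ℝ) ≤ p then some v else c v

/-- One cluster-growing step from `c` to `c'`, in which all the clusters grow in parallel and stay
disjoint. Covered nodes stay in their cluster. An uncovered node with covered neighbors joins the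
cluster of one of them, arbitrarily chosen; an uncovered node without covered neighbors stays
uncovered. -/
def GrowStep {V : Type} (G : SimpleGraph V) (c c' : PartialClustering V) : Prop :=
  ∀ v, (∀ z, c v = some z → c' v = some z) ∧
    (c v = none →
      ((∃ u z, G.Adj u v ∧ c u = some z ∧ c' v = some z) ∨
        ((∀ u, G.Adj u v → c u = none) ∧ c' v = none)))

/-- `GrowFor G s c c'`: the partial clustering `c'` results from `c` by `s` growing steps. -/
inductive GrowFor {V : Type} (G : SimpleGraph V) :
    ℕ → PartialClustering V → PartialClustering V → Prop
  | zero (c : PartialClustering V) : GrowFor G 0 c c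
  | step {s : ℕ} {c c₁ c' : PartialClustering V} :
      GrowStep G c c₁ → GrowFor G s c₁ c' → GrowFor G (s + 1) c c'

/-- `GrowUntil G Done s c c'`: growing the clusters of `c` until `Done` holds takes exactly `s`
growing steps and yields `c'`. -/
inductive GrowUntil {V : Type} (G : SimpleGraph V) (Done : PartialClustering V → Prop) :
    ℕ → PartialClustering V → PartialClustering V → Prop
  | done {c : PartialClustering V} : Done c → GrowUntil G Done 0 c c
  | step {s : ℕ} {c c₁ c' : PartialClustering V} :
      ¬ Done c → GrowStep G c c₁ → GrowUntil G Done s c₁ c' → GrowUntil G Done (s + 1) c c'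

open Classical in
/-- At least half of the nodes that were uncovered in `c₀` are covered in `c`. -/
def HalfCovered {V : Type} [Fintype V] (c₀ c : PartialClustering V) : Prop :=
  ((uncovered c₀).card : ℝ) / 2 ≤ ((uncovered c₀ \ uncovered c).card : ℝ)

/-- The while loop of `CLUSTER(τ)`. `ClusterLoop G τ x i c R c'` says: started with the partial
clustering `c`, the loop, whose first iteration has number `i` and whose iteration `j` uses the
coins `x (j, ·)`, terminates with the partial clustering `c'` and performs `R` growing steps in
total, where an iteration whose new centers alone already reach the threshold (so that nothing has
to be grown) is counted as one step. -/
inductive ClusterLoop {V : Type} [Fintype V] (G : SimpleGraph V) (τ : ℕ)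
    (x : ℕ × V → unitInterval) :
    ℕ → PartialClustering V → ℕ → PartialClustering V → Prop
  | finish {i : ℕ} {c : PartialClustering V} :
      ((uncovered c).card : ℝ) < 8 * τ * Real.logb 2 (Fintype.card V) →
      ClusterLoop G τ x i c 0 c
  | iterate {i s R : ℕ} {c c₁ c' : PartialClustering V} :
      8 * τ * Real.logb 2 (Fintype.card V) ≤ ((uncovered c).card : ℝ) →
      GrowUntil G (HalfCovered c) s
        (selectCenters c (fun v => x (i, v))
          (4 * τ * Real.logb 2 (Fintype.card V) / (uncovered c).card)) c₁ →
      ClusterLoop G τ x (i + 1) c₁ R c' →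
      ClusterLoop G τ x i c (max 1 s + R) c'

/-- `ClusterRun G τ x f R`: with the coins `x`, algorithm `CLUSTER(τ)` on `G` can terminate with the
clustering in which `f v` is the center of the cluster of `v`, after `R` growing steps. -/
def ClusterRun {V : Type} [Fintype V] (G : SimpleGraph V) (τ : ℕ) (x : ℕ × V → unitInterval)
    (f : V → V) (R : ℕ) : Prop :=
  ∃ c, ClusterLoop G τ x 1 (noClusters V) R c ∧ ∀ v, f v = (c v).getD v

/-- The maximum radius of a clustering: the maximum distance of a node from its center. -/
noncomputable def maxRadius {V : Type} [Fintype V] (G : SimpleGraph V) (f : V → V) : ℕ :=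
  Finset.univ.sup fun v => G.dist (f v) v

/-- The for loop of `CLUSTER2`, where `r` is the maximum radius found by `CLUSTER`:
`Cluster2Loop G r y i c` says that `c` is a possible partial clustering after the iterations
`1, …, i`. -/
inductive Cluster2Loop {V : Type} [Fintype V] (G : SimpleGraph V) (r : ℕ)
    (y : ℕ × V → unitInterval) : ℕ → PartialClustering V → Prop
  | init : Cluster2Loop G r y 0 (noClusters V)
  | iterate {i : ℕ} {c c' : PartialClustering V} :
      Cluster2Loop G r y i c →
      GrowFor G (2 * r)
        (selectCenters c (fun v => y (i + 1, v)) (2 ^ (i + 1) / (Fintype.card V : ℝ))) c' →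
      Cluster2Loop G r y (i + 1) c'

/-- `Cluster2Run G τ x f R`: with the coins `x` (those at `false` for the call of `CLUSTER(τ)` and
those at `true` for the for loop), algorithm `CLUSTER2(τ)` on `G` can terminate with the clustering
in which `f v` is the center of the cluster of `v`, after `R` growing steps, those of the call of
`CLUSTER(τ)` included. The for loop has `⌈log₂ n⌉` iterations. -/
def Cluster2Run {V : Type} [Fintype V] (G : SimpleGraph V) (τ : ℕ)
    (x : Bool × ℕ × V → unitInterval) (f : V → V) (R : ℕ) : Prop :=
  ∃ g R₁ c, ClusterRun G τ (fun p => x (false, p)) g R₁ ∧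
    Cluster2Loop G (maxRadius G g) (fun p => x (true, p)) (Nat.clog 2 (Fintype.card V)) c ∧
    (∀ v, c v = some (f v)) ∧
    R = R₁ + Nat.clog 2 (Fintype.card V) * (2 * maxRadius G g)

end GraphClustering

/-! ### The MapReduce model -/

namespace MapReduce

/-- A key-value pair; keys and values are finite sequences of machine words. -/
abbrev KV := List ℕ × List ℕ

/-- The memory, in words, taken by a multiset of pairs (one word per pair for bookkeeping). -/
def size (X : Multiset KV) : ℕ := (X.map fun p => p.1.length + p.2.length + 1).sum

/-- All the words in a multiset of pairs are smaller than `B`. -/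
def WordsBelow (B : ℕ) (X : Multiset KV) : Prop :=
  ∀ p ∈ X, (∀ w ∈ p.1, w < B) ∧ ∀ w ∈ p.2, w < B

/-- A randomized MR algorithm. In round `r`, the reducer is applied independently to every key `k`
that occurs, with the multiset of the values that occur with the key `k`, and with a fresh random
seed; it produces the pairs for the next round and a multiset of final output pairs. -/
structure Algorithm where
  reduce : ℕ → List ℕ → Multiset (List ℕ) → unitInterval → Multiset KV × Multiset KV
  measurable_reduce : ∀ r k vals out, MeasurableSet {s | reduce r k vals s = out}

/-- A configuration: the current pairs and the output pairs produced so far. -/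
structure Config where
  live : Multiset KV
  out : Multiset KV

/-- The pairs of `X` with key `k`. -/
def group (X : Multiset KV) (k : List ℕ) : Multiset KV := X.filter fun p => p.1 = k

/-- The keys that occur in `X`, each one once. -/
def keys (X : Multiset KV) : Multiset (List ℕ) := (X.map Prod.fst).dedup

/-- The result of the reducer at key `k` in round `r`; `ω (r, k)` is the seed of this invocation. -/
def Algorithm.reducerResult (A : Algorithm) (ω : ℕ × List ℕ → unitInterval) (r : ℕ)
    (X : Multiset KV) (k : List ℕ) : Multiset KV × Multiset KV :=
  A.reduce r k ((group X k).map Prod.snd) (ω (r, k))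

/-- Round `r`. -/
def Algorithm.round (A : Algorithm) (ω : ℕ × List ℕ → unitInterval) (r : ℕ) (s : Config) :
    Config where
  live := (keys s.live).bind fun k => (A.reducerResult ω r s.live k).1
  out := s.out + (keys s.live).bind fun k => (A.reducerResult ω r s.live k).2

/-- The configuration after `t` rounds on a given input. -/
def Algorithm.config (A : Algorithm) (ω : ℕ × List ℕ → unitInterval) (input : Multiset KV) :
    ℕ → Config
  | 0 => ⟨input, 0⟩
  | t + 1 => A.round ω t (A.config ω input t)

/-- The computation ends after exactly `T` rounds, that is, when no pair is left to process. -/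
def Algorithm.HaltsAfter (A : Algorithm) (ω : ℕ × List ℕ → unitInterval) (input : Multiset KV)
    (T : ℕ) : Prop :=
  (A.config ω input T).live = 0 ∧ ∀ t < T, (A.config ω input t).live ≠ 0

/-- The computation respects the limits of `MR(M_G, M_L)` on words smaller than `B`. In every round,
the local memory of a reducer holds the pairs that it receives and the pairs that it produces, and
has at most `ML` words; the global memory holds the contents of all the local memories and the
whole output produced so far, and has at most `MG` words. -/
def Algorithm.FitsMemory (A : Algorithm) (B MG ML : ℕ) (ω : ℕ × List ℕ → unitInterval)
    (input : Multiset KV) : Prop :=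
  ∀ t, WordsBelow B (A.config ω input t).live ∧ WordsBelow B (A.config ω input t).out ∧
    (∀ k ∈ keys (A.config ω input t).live,
      size (group (A.config ω input t).live k) +
        size (A.reducerResult ω t (A.config ω input t).live k).1 +
        size (A.reducerResult ω t (A.config ω input t).live k).2 ≤ ML) ∧
    size (A.config ω input t).live + size (A.config ω input (t + 1)).live +
      size (A.config ω input (t + 1)).out ≤ MG

open Classical in
/-- The input pairs for a graph: one pair for every node and one pair for every edge, each of them
with its own key. -/
noncomputable def graphInput {n : ℕ} (G : SimpleGraph (Fin n)) : Multiset KV :=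
  (Finset.univ : Finset (Fin n)).val.map (fun v => ([v.val], [])) +
    (Finset.univ.filter fun e : Fin n × Fin n => e.1 < e.2 ∧ G.Adj e.1 e.2).val.map
      (fun e => ([e.1.val, e.2.val], []))

/-- The output pairs for a clustering: every node, with the center of its cluster. -/
def clusteringOutput {n : ℕ} (f : Fin n → Fin n) : Multiset KV :=
  (Finset.univ : Finset (Fin n)).val.map fun v => ([v.val], [(f v).val])

/-- The law of a family of independent random variables, uniform on `[0, 1]`. -/
noncomputable def uniformLaw (ι : Type) : Measure (ι → unitInterval) :=
  Measure.infinitePi fun _ => (volume : Measure unitInterval)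

/-- Let `Run x f R` say that a randomized clustering algorithm on the nodes of `G` can terminate,
for the outcome `x` of its coins (independent and uniform on `[0, 1]`), with the clustering `f` and
after `R` growing steps. Then `A.Implements B MG ML G Run bound` says that `A` implements this
algorithm in `MR(M_G, M_L)` with words smaller than `B`, in at most `bound R` rounds: the coins of
the clustering algorithm can be read off the seeds of `A` by a measure-preserving map `ξ` in such a
way that `A` terminates if and only if the clustering algorithm does, and then the output of `A` is
a clustering that the clustering algorithm can return for these coins, after some number `R` of
growing steps such that `A` has used at most `bound R` rounds. -/
def Algorithm.Implements (A : Algorithm) (B MG ML : ℕ) {n : ℕ} (G : SimpleGraph (Fin n))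
    {ι : Type} (Run : (ι → unitInterval) → (Fin n → Fin n) → ℕ → Prop) (bound : ℕ → ℝ) : Prop :=
  ∃ ξ : (ℕ × List ℕ → unitInterval) → (ι → unitInterval),
    MeasurePreserving ξ (uniformLaw (ℕ × List ℕ)) (uniformLaw ι) ∧
    ∀ ω, A.FitsMemory B MG ML ω (graphInput G) ∧
      ((∃ T, A.HaltsAfter ω (graphInput G) T) ↔ ∃ f R, Run (ξ ω) f R) ∧
      ∀ T, A.HaltsAfter ω (graphInput G) T →
        ∃ f R, Run (ξ ω) f R ∧
          (A.config ω (graphInput G) T).out = clusteringOutput f ∧ (T : ℝ) ≤ bound R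

/-- The data that the lemma is about: `n ≥ 2` nodes, `m` edges, an integer `τ > 0`, a local memory
of at least `c` words and a global memory of at least `c * m` words, and a connected graph with `n`
nodes and `m` edges. -/
def Admissible (c m τ MG ML : ℕ) {n : ℕ} (G : SimpleGraph (Fin n)) : Prop :=
  2 ≤ n ∧ 0 < τ ∧ c ≤ ML ∧ c * m ≤ MG ∧ G.Connected ∧ G.edgeSet.ncard = m

/-- Let `Run G τ x f R` describe a clustering algorithm with parameter `τ`. There are absolute
constants `c`, `C` and MR algorithms (which may depend on `n`, `m`, `τ`, `M_G`, `M_L`, but not on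
the graph) that implement it in `MR(M_G, M_L)`, with words of at most `c log₂ n` bits, whenever
`M_L ≥ c` and `M_G ≥ c m`, in at most `C R log_{M_L} m` rounds, where `R` and the logarithm are
replaced by `1` if they are smaller. Moreover, if `M_L ≥ a n ^ ε`, then the same MR algorithms
use at most `C' R` rounds, where `C'` depends only on `a` and `ε`. -/
def ImplementableInMR (ι : ℕ → Type)
    (Run : ∀ {n : ℕ}, SimpleGraph (Fin n) → ℕ → (ι n → unitInterval) → (Fin n → Fin n) → ℕ →
      Prop) : Prop :=
  ∃ (c : ℕ) (A : (n m τ MG ML : ℕ) → Algorithm), 2 ≤ c ∧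
    (∃ C : ℝ, ∀ (n m τ MG ML : ℕ) (G : SimpleGraph (Fin n)), Admissible c m τ MG ML G →
      (A n m τ MG ML).Implements (n ^ c) MG ML G (Run G τ)
        fun R => C * max 1 (R : ℝ) * max 1 (Real.logb ML m)) ∧
    (∀ a ε : ℝ, 0 < a → 0 < ε → ∃ C' : ℝ,
      ∀ (n m τ MG ML : ℕ) (G : SimpleGraph (Fin n)), Admissible c m τ MG ML G →
        a * (n : ℝ) ^ ε ≤ ML →
        (A n m τ MG ML).Implements (n ^ c) MG ML G (Run G τ)
          fun R => C' * max 1 (R : ℝ))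

end MapReduce

/-! The algorithm simulates one clustering step by one epoch of `O(L)` rounds, where `L` is about
`log (n ^ 2) / log ML`. It keeps one item for each node and two for each edge. By connectivity `n ≤
m + 1`, so there are `O(m)` items of constant size. All items `(u, ·)` hold a copy of the state of
`u` and of a small control state.

In an epoch, the two items of an edge exchange the states of its ends. The items of each node then
agree on its new state, the largest one proposed (this settles the arbitrary choices). Finally all
items learn how many nodes are uncovered and how deep the clusters are, and each of them computes
the next control state. The last two tasks are all-reduces along tries of arity `ML / 64`: only
leaders of blocks climb, so at most `ML / 64` items meet at a key (`Trie.card_mates_le`), and the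
result travels back down (`itemStep_redItem`).

The stored depths yield the radius because in `CLUSTER` they are the distances to the centers
(`ExactDepths.grow`). An iteration with `s` growing steps takes `1 + s ≤ 2 * max 1 s` epochs, and an
iteration of the for loop with radius `r ≥ 1` takes `2 * r + 1 ≤ 2 * (2 * r)`. For `r = 0` the for
loop is skipped, as it would return singletons anyway. So there are at most `2 * R` epochs. The only
obstacle to termination is a first selection without any center; then neither the algorithm nor its
simulation ever stops (`cluster_of_run`).

The coins of the clustering algorithm are indexed by iterations, whereas the simulation tosses them
in epochs whose dates depend on earlier coins. `extractCoins` moves them by swaps of coordinates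
that depend only on coins left in place, hence preserve the product measure
(`measurePreserving_conditional_perm`); iterations that never happen get unused seeds. -/

namespace MapReduce

/-! ### Reading independent uniform coins off independent uniform seeds -/

/-- Distinct coordinates of independent uniform variables are independent and uniform. -/
theorem measurePreserving_reindex {ι κ : Type} (f : ι → κ) (hf : Function.Injective f) :
    MeasurePreserving (fun ω : κ → unitInterval => fun i => ω (f i))
      (uniformLaw κ) (uniformLaw ι) := by
  classical
  have hm : Measurable (fun ω : κ → unitInterval => fun i => ω (f i)) :=
    measurable_pi_lambda _ fun i => measurable_pi_apply (f i)
  refine ⟨hm, Measure.eq_infinitePi _ fun s t ht => ?_⟩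
  rw [Measure.map_apply hm (MeasurableSet.pi s.countable_toSet fun i _ => ht i)]
  -- The preimage of a box is a box: by injectivity at most one `i` constrains the coordinate `k`,
  -- so the intersection has at most one member.
  have hpre : (fun ω : κ → unitInterval => fun i => ω (f i)) ⁻¹' (Set.pi s t) =
      Set.pi (s.map ⟨f, hf⟩ : Finset κ) (fun k => ⋂ i ∈ {i | f i = k}, t i) := by
    ext ω
    simp only [Set.mem_preimage, Set.mem_pi, Finset.mem_coe, Finset.mem_map,
      Function.Embedding.coeFn_mk, Set.mem_ofPred_eq, Set.mem_iInter]
    constructor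
    · rintro h k ⟨i, hi, rfl⟩ j hj
      rw [hf hj] at *
      exact h i hi
    · intro h i hi
      exact h (f i) ⟨i, hi, rfl⟩ i rfl
  have hset : ∀ i, (⋂ j ∈ {j | f j = f i}, t j) = t i := by
    intro i
    have : {j | f j = f i} = {i} := by ext j; simp [hf.eq_iff]
    rw [this]; simp
  have hmeas : ∀ k, MeasurableSet (⋂ i ∈ {i | f i = k}, t i) := by
    intro k
    by_cases hk : ∃ i, f i = k
    · obtain ⟨i, rfl⟩ := hk
      rw [hset]; exact ht i
    · have : {i | f i = k} = ∅ := by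
        ext i; simp only [Set.mem_ofPred_eq, Set.mem_empty_iff_false, iff_false]
        exact fun h => hk ⟨i, h⟩
      rw [this]; simp
  rw [hpre, uniformLaw, Measure.infinitePi_pi _ fun k _ => hmeas k, Finset.prod_map]
  refine Finset.prod_congr rfl fun i _ => ?_
  simp only [Function.Embedding.coeFn_mk]
  rw [hset]

/-- Permuting independent uniform variables preserves their law, even if the permutation depends
on the outcome, as long as permuting does not change the choice of the permutation. -/
theorem measurePreserving_conditional_perm {κ Λ : Type} [Countable Λ] (π : Λ → Equiv.Perm κ)
    (sel : (κ → unitInterval) → Λ) (hsel : ∀ l, MeasurableSet {ω | sel ω = l})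
    (hinv : ∀ ω l, sel (fun k => ω (π l k)) = l ↔ sel ω = l) :
    MeasurePreserving (fun ω : κ → unitInterval => fun k => ω (π (sel ω) k))
      (uniformLaw κ) (uniformLaw κ) := by
  have hp := fun l => measurePreserving_reindex (π l) (π l).injective
  -- On the piece where `sel` takes the value `l`, the map is the fixed permutation `π l`, which
  -- maps the piece to itself by `hinv`. Each piece is then treated by `measurePreserving_reindex`.
  have hdec : ∀ A : Set (κ → unitInterval),
      (fun ω : κ → unitInterval => fun k => ω (π (sel ω) k)) ⁻¹' A =
        ⋃ l, (fun ω : κ → unitInterval => fun k => ω (π l k)) ⁻¹' ({ω | sel ω = l} ∩ A) := by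
    intro A
    ext ω
    simp only [Set.mem_preimage, Set.mem_iUnion, Set.mem_inter_iff, Set.mem_ofPred_eq, hinv]
    constructor
    · intro h
      exact ⟨_, rfl, h⟩
    · rintro ⟨l, rfl, h⟩
      exact h
  have hm : Measurable (fun ω : κ → unitInterval => fun k => ω (π (sel ω) k)) := by
    intro A hA
    rw [hdec]
    exact MeasurableSet.iUnion fun l => (hp l).measurable ((hsel l).inter hA)
  refine ⟨hm, Measure.ext fun A hA => ?_⟩
  rw [Measure.map_apply hm hA, hdec, measure_iUnion]
  · have : ∀ l, uniformLaw κ ((fun ω : κ → unitInterval => fun k => ω (π l k)) ⁻¹'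
        ({ω | sel ω = l} ∩ A)) = uniformLaw κ ({ω | sel ω = l} ∩ A) := fun l =>
      (hp l).measure_preimage ((hsel l).inter hA).nullMeasurableSet
    simp_rw [this]
    rw [← measure_iUnion]
    · congr 1
      ext ω; simp
    · intro l l' hl
      refine Set.disjoint_left.2 fun ω h h' => hl (h.1.symm.trans h'.1)
    · exact fun l => (hsel l).inter hA
  · intro l l' hl
    refine Set.disjoint_left.2 fun ω h h' => hl ?_
    have h1 := (hinv ω l).1 h.1
    have h2 := (hinv ω l').1 h'.1
    exact h1.symm.trans h2
  · exact fun l => (hp l).measurable ((hsel l).inter hA)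

open Classical in
/-- The permutation of coordinates that exchanges the coins of time `e` with the spare coins of
the label `l`. -/
noncomputable def swapCoins {V Λ : Type} (e : ℕ) : Option Λ → Equiv.Perm ((ℕ × V) ⊕ (Λ × V))
  | none => Equiv.refl _
  | some l => Function.Involutive.toPerm
      (Sum.elim (fun p => if p.1 = e then Sum.inr (l, p.2) else Sum.inl p)
        (fun p => if p.1 = l then Sum.inl (e, p.2) else Sum.inr p))
      (by
        rintro (⟨a, v⟩ | ⟨a, v⟩)
        · by_cases h : a = e <;> simp [h]
        · by_cases h : a = l <;> simp [h])

theorem swapCoins_none {V Λ : Type} (e : ℕ) (k : (ℕ × V) ⊕ (Λ × V)) :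
    swapCoins e none k = k := rfl

open Classical in
theorem swapCoins_inl {V Λ : Type} (e : ℕ) (l : Λ) (p : ℕ × V) :
    swapCoins e (some l) (Sum.inl p) = if p.1 = e then Sum.inr (l, p.2) else Sum.inl p := rfl

open Classical in
theorem swapCoins_inr {V Λ : Type} (e : ℕ) (l : Λ) (p : Λ × V) :
    swapCoins e (some l) (Sum.inr p) = if p.1 = l then Sum.inl (e, p.2) else Sum.inr p := rfl

/-- Labelled coins, extracted up to time `N`: the coins of a time that carries the label `l` become
the coins of the label `l`. -/
noncomputable def extractCoins {V Λ : Type} (lab : ℕ → (ℕ × V → unitInterval) → Option Λ) :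
    ℕ → ((ℕ × V) ⊕ (Λ × V) → unitInterval) → ((ℕ × V) ⊕ (Λ × V) → unitInterval)
  | 0, ω => ω
  -- The latest time is swapped first. Labels depend on earlier coins only, so the labels of the
  -- remaining times are still those of the original outcome.
  | N + 1, ω => extractCoins lab N fun k => ω (swapCoins N (lab N fun p => ω (Sum.inl p)) k)

section extract

variable {V Λ : Type} {lab : ℕ → (ℕ × V → unitInterval) → Option Λ}

/-- Among the coins indexed by times, the swap touches only those of time `N`, and no label up to
time `N` looks at these. -/
theorem label_swap
    (hdep : ∀ e y y', (∀ e' < e, ∀ v, y (e', v) = y' (e', v)) → lab e y = lab e y')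
    (N e : ℕ) (he : e ≤ N) (o : Option Λ) (ω : (ℕ × V) ⊕ (Λ × V) → unitInterval) :
    lab e (fun p => ω (swapCoins N o (Sum.inl p))) = lab e fun p => ω (Sum.inl p) := by
  apply hdep
  intro e' he' v
  cases o with
  | none => simp [swapCoins_none]
  | some l =>
    have : e' ≠ N := by omega
    simp [swapCoins_inl, this]

theorem measurePreserving_extractCoins [Countable Λ]
    (hdep : ∀ e y y', (∀ e' < e, ∀ v, y (e', v) = y' (e', v)) → lab e y = lab e y')
    (hmeas : ∀ e l, MeasurableSet {y | lab e y = l}) (N : ℕ) :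
    MeasurePreserving (extractCoins lab N) (uniformLaw _) (uniformLaw _) := by
  induction N with
  | zero => exact MeasurePreserving.id _
  | succ N ih =>
    refine ih.comp (measurePreserving_conditional_perm (swapCoins N)
      (fun ω => lab N fun p => ω (Sum.inl p)) (fun l => ?_) fun ω l => ?_)
    · have : Measurable (fun ω : (ℕ × V) ⊕ (Λ × V) → unitInterval => fun p => ω (Sum.inl p)) :=
        measurable_pi_lambda _ fun i => measurable_pi_apply _
      exact this (hmeas N l)
    · rw [label_swap hdep N N le_rfl]

theorem extractCoins_of_no_label
    (hdep : ∀ e y y', (∀ e' < e, ∀ v, y (e', v) = y' (e', v)) → lab e y = lab e y')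
    (l : Λ) (v : V) (N : ℕ) (ω : (ℕ × V) ⊕ (Λ × V) → unitInterval)
    (h : ∀ e < N, lab e (fun p => ω (Sum.inl p)) ≠ some l) :
    extractCoins lab N ω (Sum.inr (l, v)) = ω (Sum.inr (l, v)) := by
  induction N generalizing ω with
  | zero => rfl
  | succ N ih =>
    rw [extractCoins, ih]
    · have hN := h N (by omega)
      cases hl : lab N (fun p => ω (Sum.inl p)) with
      | none => simp [swapCoins_none]
      | some l' =>
        have : l ≠ l' := by rintro rfl; exact hN hl
        simp [swapCoins_inr, this]
    · intro e he
      rw [label_swap hdep N e he.le]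
      exact h e (by omega)

/-- The swaps of times after `e` leave the coins of time `e` alone, the swap of time `e` carries
them to the place of `l`, and the swaps of earlier times do not touch that place, since by `huniq`
no other time carries the label `l`. -/
theorem extractCoins_of_label
    (hdep : ∀ e y y', (∀ e' < e, ∀ v, y (e', v) = y' (e', v)) → lab e y = lab e y')
    (huniq : ∀ y e e' l, e < e' → lab e y = some l → lab e' y ≠ some l)
    (l : Λ) (v : V) (N : ℕ) (ω : (ℕ × V) ⊕ (Λ × V) → unitInterval) (e : ℕ) (he : e < N)
    (h : lab e (fun p => ω (Sum.inl p)) = some l) :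
    extractCoins lab N ω (Sum.inr (l, v)) = ω (Sum.inl (e, v)) := by
  induction N generalizing ω with
  | zero => omega
  | succ N ih =>
    rw [extractCoins]
    rcases Nat.lt_succ_iff_lt_or_eq.1 he with he' | rfl
    · rw [ih _ he' (by rw [label_swap hdep N e he'.le, h])]
      cases hl : lab N (fun p => ω (Sum.inl p)) with
      | none => simp [swapCoins_none]
      | some l' => simp [swapCoins_inl, he'.ne]
    · rw [extractCoins_of_no_label hdep, h]
      · simp [swapCoins_inr]
      · intro e' he'
        rw [label_swap hdep e e' he'.le]
        exact fun h' => huniq _ e' e l he' h' h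

end extract

end MapReduce

namespace MapReduce

/-! ### Multisets of pairs, grouped by key -/

/-- Every pair lies in the group of exactly one key. Hence a reducer that treats its values one at a
time acts like a map over all the live pairs. -/
theorem bind_keys_group {β : Type} (X : Multiset KV) (h : List ℕ → List ℕ → Multiset β) :
    ((keys X).bind fun k => ((group X k).map Prod.snd).bind (h k)) =
      X.bind fun p => h p.1 p.2 := by
  classical
  have hX : (keys X).bind (fun k => group X k) = X := by
    ext p
    rw [Multiset.count_bind]
    have : ∀ k, (group X k).count p = if k = p.1 then X.count p else 0 := by
      intro k
      unfold group
      split_ifs with h1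
      · exact Multiset.count_filter_of_pos h1.symm
      · exact Multiset.count_filter_of_neg fun h2 => h1 h2.symm
    simp_rw [this]
    have hs : (Multiset.map (fun k => if k = p.1 then X.count p else 0) (keys X)).sum =
        ∑ k ∈ (X.map Prod.fst).toFinset, if k = p.1 then X.count p else 0 := rfl
    rw [hs, Finset.sum_ite_eq']
    split_ifs with h1
    · rfl
    · refine (Multiset.count_eq_zero.2 fun hp => h1 ?_).symm
      exact Multiset.mem_toFinset.2 (Multiset.mem_map_of_mem _ hp)
  conv_rhs => rw [← hX, Multiset.bind_assoc]
  refine Multiset.bind_congr fun k _ => ?_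
  rw [Multiset.bind_map]
  refine Multiset.bind_congr fun p hp => ?_
  rw [(Multiset.mem_filter.1 hp).2]

theorem mem_keys {X : Multiset KV} {k : List ℕ} : k ∈ keys X ↔ ∃ p ∈ X, p.1 = k := by
  simp [keys]

theorem size_add (X Y : Multiset KV) : size (X + Y) = size X + size Y := by
  simp [size]

theorem size_le_of_forall {X : Multiset KV} {b : ℕ}
    (h : ∀ p ∈ X, p.1.length + p.2.length + 1 ≤ b) : size X ≤ Multiset.card X * b := by
  have := Multiset.sum_le_card_nsmul (X.map fun p => p.1.length + p.2.length + 1) b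
    (by simpa only [Multiset.mem_map, forall_exists_index, and_imp,
      forall_apply_eq_imp_iff₂] using h)
  simpa [size] using this

theorem size_bind_le {β : Type} {X : Multiset β} {f : β → Multiset KV} {b : ℕ}
    (h : ∀ p ∈ X, size (f p) ≤ b) : size (X.bind f) ≤ Multiset.card X * b := by
  induction X using Multiset.induction_on with
  | empty => simp [size]
  | cons a X ih =>
    rw [Multiset.cons_bind, size_add, Multiset.card_cons, add_mul, one_mul, add_comm]
    exact add_le_add (ih fun p hp => h p (Multiset.mem_cons_of_mem hp))
      (h a (Multiset.mem_cons_self a X))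

theorem group_map {α : Type} (X : Multiset α) (f : α → KV) (k : List ℕ) :
    group (X.map f) k = (X.filter fun a => (f a).1 = k).map f := by
  simp [group, Multiset.filter_map]

/-- If the live pairs are indexed by a finite set and every reducer treats its values one by one,
then the pairs produced in a round are indexed accordingly. -/
theorem Algorithm.round_eq (A : Algorithm) (ω : ℕ × List ℕ → unitInterval) (r : ℕ) (s : Config)
    (F G : List ℕ → Multiset (List ℕ) → List ℕ → Multiset KV)
    (hA : ∀ k vals, A.reduce r k vals (ω (r, k)) = (vals.bind (F k vals), vals.bind (G k vals))) :
    A.round ω r s =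
      ⟨s.live.bind fun p => F p.1 ((group s.live p.1).map Prod.snd) p.2,
        s.out + s.live.bind fun p => G p.1 ((group s.live p.1).map Prod.snd) p.2⟩ := by
  simp only [Algorithm.round, Algorithm.reducerResult, hA]
  rw [bind_keys_group s.live fun k => F k ((group s.live k).map Prod.snd),
    bind_keys_group s.live fun k => G k ((group s.live k).map Prod.snd)]

/-- Whoever halts does so only once. -/
theorem Algorithm.HaltsAfter.unique {A : Algorithm} {ω : ℕ × List ℕ → unitInterval}
    {input : Multiset KV} {T T' : ℕ} (h : A.HaltsAfter ω input T) (h' : A.HaltsAfter ω input T') :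
    T = T' := by
  rcases lt_trichotomy T T' with hl | hl | hl
  · exact absurd h.1 (h'.2 T hl)
  · exact hl
  · exact absurd h'.1 (h.2 T' hl)

theorem Algorithm.config_of_live_eq_zero {A : Algorithm} {ω : ℕ × List ℕ → unitInterval}
    {input : Multiset KV} {T : ℕ} (h : (A.config ω input T).live = 0) {t : ℕ} (ht : T ≤ t) :
    A.config ω input t = A.config ω input T := by
  induction t, ht using Nat.le_induction with
  | base => rfl
  | succ t ht ih =>
    rw [Algorithm.config, ih]
    have : keys (0 : Multiset KV) = 0 := rfl
    simp only [Algorithm.round, h, this, Multiset.zero_bind, add_zero]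
    rw [← h]

/-- A larger bound on the number of rounds is a weaker requirement. -/
theorem Algorithm.Implements.mono {A : Algorithm} {B MG ML n : ℕ} {G : SimpleGraph (Fin n)}
    {ι : Type} {Run : (ι → unitInterval) → (Fin n → Fin n) → ℕ → Prop} {bound bound' : ℕ → ℝ}
    (h : A.Implements B MG ML G Run bound) (hb : ∀ R, bound R ≤ bound' R) :
    A.Implements B MG ML G Run bound' := by
  obtain ⟨ξ, hξ, h⟩ := h
  refine ⟨ξ, hξ, fun ω => ⟨(h ω).1, (h ω).2.1, fun T hT => ?_⟩⟩
  obtain ⟨f, R, hf, ho, hR⟩ := (h ω).2.2 T hT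
  exact ⟨f, R, hf, ho, hR.trans (hb R)⟩

end MapReduce

/-! ### All-reduce along a trie

The items `a`, which come in groups `g a`, have distinct identifiers `ident a`. On level `t`, those of
a group whose identifiers agree up to the last `t` digits in base `B` form a block, which is led by
its smallest member. -/

namespace Trie

open Classical

section

variable {α : Type} (g ident : α → ℕ) (B : ℕ)

/-- `a` has the smallest identifier in its block of level `t`. -/
def Leads (t : ℕ) (a : α) : Prop :=
  ∀ b, g b = g a → ident b / B ^ t = ident a / B ^ t → ident a ≤ ident b

/-- The level of item `a` after it has been lifted up to level `t` as long as it was a leader. -/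
noncomputable def pos (t : ℕ) (a : α) : ℕ := Nat.findGreatest (fun l => Leads g ident B l a) t

variable {g ident B}

theorem leads_zero (a : α) : Leads g ident B 0 a := by
  intro b _ h
  simp only [pow_zero, Nat.div_one] at h
  exact h.ge

theorem div_pow_succ {x y t : ℕ} (h : x / B ^ t = y / B ^ t) : x / B ^ (t + 1) = y / B ^ (t + 1) := by
  rw [pow_succ, ← Nat.div_div_eq_div_mul, ← Nat.div_div_eq_div_mul, h]

/-- Blocks grow with the level. So the levels at which an item leads form an initial segment, and
`pos` records where it ends. -/
theorem Leads.of_succ {t : ℕ} {a : α} (h : Leads g ident B (t + 1) a) : Leads g ident B t a :=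
  fun b hb hd => h b hb (div_pow_succ hd)

theorem Leads.unique (hid : Function.Injective ident) {t : ℕ} {a b : α} (ha : Leads g ident B t a)
    (hb : Leads g ident B t b) (hg : g b = g a) (hd : ident b / B ^ t = ident a / B ^ t) : b = a :=
  hid (le_antisymm (hb a hg.symm hd.symm) (ha b hg hd))

theorem pos_le (t : ℕ) (a : α) : pos g ident B t a ≤ t := Nat.findGreatest_le t

theorem leads_pos (t : ℕ) (a : α) : Leads g ident B (pos g ident B t a) a :=
  Nat.findGreatest_spec (P := fun l => Leads g ident B l a) (Nat.zero_le t) (leads_zero a)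

theorem pos_eq_iff {t : ℕ} {a : α} : pos g ident B t a = t ↔ Leads g ident B t a := by
  constructor
  · intro h
    have := leads_pos (g := g) (ident := ident) (B := B) t a
    rwa [h] at this
  · exact fun h => le_antisymm (pos_le t a) (Nat.le_findGreatest le_rfl h)

theorem pos_succ (t : ℕ) (a : α) :
    pos g ident B (t + 1) a = if Leads g ident B (t + 1) a then t + 1 else pos g ident B t a := by
  unfold pos
  rw [Nat.findGreatest_succ]

theorem pos_zero (a : α) : pos g ident B 0 a = 0 := Nat.le_zero.1 (pos_le 0 a)

end

section

variable {α : Type} [Fintype α] (g ident : α → ℕ) (B : ℕ)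

/-- The items at the same place as `a`, after lifting to level `t`. -/
noncomputable def mates (t : ℕ) (a : α) : Finset α :=
  Finset.univ.filter fun b => g b = g a ∧ pos g ident B t b = pos g ident B t a ∧
    ident b / B ^ (pos g ident B t b + 1) = ident a / B ^ (pos g ident B t a + 1)

/-- The block of `a` of level `t`. -/
noncomputable def block (t : ℕ) (a : α) : Finset α :=
  Finset.univ.filter fun b => g b = g a ∧ ident b / B ^ t = ident a / B ^ t

variable {g ident B}

/-- Mates lead different blocks of one level inside the same block of the next level, and the latter
consists of at most `B` blocks of the former. -/
theorem card_mates_le (hB : 0 < B) (hid : Function.Injective ident) (t : ℕ) (a : α) :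
    (mates g ident B t a).card ≤ B := by
  set l := pos g ident B t a with hl
  set q := ident a / B ^ (l + 1) with hq
  have hmaps : ∀ b ∈ mates g ident B t a, ident b / B ^ l ∈ Finset.Ico (q * B) (q * B + B) := by
    intro b hb
    obtain ⟨-, h2, h3⟩ := (Finset.mem_filter.1 hb).2
    rw [h2, ← hl, ← hq, pow_succ, ← Nat.div_div_eq_div_mul] at h3
    rw [Finset.mem_Ico, ← h3]
    exact ⟨Nat.div_mul_le_self _ _, Nat.lt_div_mul_add hB⟩
  have hinj : Set.InjOn (fun b => ident b / B ^ l) (mates g ident B t a : Set α) := by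
    intro b hb c hc hbc
    obtain ⟨hb1, hb2, -⟩ := (Finset.mem_filter.1 (Finset.mem_coe.1 hb)).2
    obtain ⟨hc1, hc2, -⟩ := (Finset.mem_filter.1 (Finset.mem_coe.1 hc)).2
    have h1 := leads_pos (g := g) (ident := ident) (B := B) t b
    have h2 := leads_pos (g := g) (ident := ident) (B := B) t c
    rw [hb2, ← hl] at h1
    rw [hc2, ← hl] at h2
    exact h2.unique hid h1 (hb1.trans hc1.symm) hbc
  have := Finset.card_le_card_of_injOn _ hmaps hinj
  simpa using this

theorem exists_leader (t : ℕ) (a : α) : ∃ b ∈ block g ident B t a, Leads g ident B t b := by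
  obtain ⟨b, hb, hmin⟩ := Finset.exists_min_image (block g ident B t a) ident
    ⟨a, by simp [block]⟩
  refine ⟨b, hb, fun c hc hd => hmin c ?_⟩
  have := (Finset.mem_filter.1 hb).2
  exact Finset.mem_filter.2 ⟨Finset.mem_univ _, hc.trans this.1, hd.trans this.2⟩

theorem mem_mates_of_pos_eq {t : ℕ} {a b : α} (h : pos g ident B t a = t) :
    b ∈ mates g ident B t a ↔ b ∈ block g ident B (t + 1) a ∧ Leads g ident B t b := by
  simp only [mates, block, Finset.mem_filter, Finset.mem_univ, true_and, h, ← pos_eq_iff]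
  constructor
  · rintro ⟨h1, h2, h3⟩
    rw [h2] at h3
    exact ⟨⟨h1, h3⟩, h2⟩
  · rintro ⟨⟨h1, h3⟩, h2⟩
    rw [h2]
    exact ⟨h1, rfl, h3⟩

/-- An item sees only its mates. They lead the subblocks of the next larger block, so the smallest
of them is the smallest member of that block, and leadership one level up can be decided locally. -/
theorem forall_mates_iff {t : ℕ} {a : α} (h : pos g ident B t a = t) :
    (∀ b ∈ mates g ident B t a, ident a ≤ ident b) ↔ Leads g ident B (t + 1) a := by
  constructor
  · intro hm b hb hd
    obtain ⟨c, hc, hcl⟩ := exists_leader (g := g) (ident := ident) (B := B) t b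
    have hc' := (Finset.mem_filter.1 hc).2
    refine (hm c ?_).trans (hcl b hc'.1.symm hc'.2.symm)
    rw [mem_mates_of_pos_eq h]
    exact ⟨Finset.mem_filter.2 ⟨Finset.mem_univ _, hc'.1.trans hb, (div_pow_succ hc'.2).trans hd⟩,
      hcl⟩
  · intro hl b hb
    rw [mem_mates_of_pos_eq h] at hb
    have := (Finset.mem_filter.1 hb.1).2
    exact hl b this.1 this.2

/-! ### Sums carried up and down the trie -/

variable {M : Type} [AddCommMonoid M] (w : α → M)

variable (g ident B) in
/-- The sum over the block of `a`, if `a` leads it. -/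
noncomputable def upVal (t : ℕ) (a : α) : M :=
  if Leads g ident B t a then ∑ b ∈ block g ident B t a, w b else 0

variable (g) in
/-- The sum over the group of `a`. -/
noncomputable def total (a : α) : M := ∑ b ∈ Finset.univ.filter fun b => g b = g a, w b

variable (g ident B) in
/-- The sum over the group of `a`, if `a` leads its block. -/
noncomputable def downVal (t : ℕ) (a : α) : M :=
  if Leads g ident B t a then total g w a else 0

theorem upVal_zero (hid : Function.Injective ident) (a : α) : upVal g ident B w 0 a = w a := by
  rw [upVal, if_pos (leads_zero a)]
  have : block g ident B 0 a = {a} := by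
    ext b
    simp only [block, pow_zero, Nat.div_one, Finset.mem_filter, Finset.mem_univ, true_and,
      Finset.mem_singleton]
    exact ⟨fun h => hid h.2, fun h => by simp [h]⟩
  rw [this, Finset.sum_singleton]

/-- The block of level `t + 1` is the disjoint union of the blocks of level `t` led by the mates;
the fibers of the map that sends an item to its leader are these blocks. -/
theorem sum_mates_upVal (hid : Function.Injective ident) {t : ℕ} {a : α}
    (h : pos g ident B t a = t) :
    ∑ b ∈ mates g ident B t a, upVal g ident B w t b =
      ∑ b ∈ block g ident B (t + 1) a, w b := by
  choose ldr hldr hlead using fun b => exists_leader (g := g) (ident := ident) (B := B) t b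
  have hmaps : ∀ b ∈ block g ident B (t + 1) a, ldr b ∈ mates g ident B t a := by
    intro b hb
    rw [mem_mates_of_pos_eq h]
    have h1 := (Finset.mem_filter.1 hb).2
    have h2 := (Finset.mem_filter.1 (hldr b)).2
    exact ⟨Finset.mem_filter.2 ⟨Finset.mem_univ _, h2.1.trans h1.1,
      (div_pow_succ h2.2).trans h1.2⟩, hlead b⟩
  rw [← Finset.sum_fiberwise_of_maps_to hmaps]
  refine Finset.sum_congr rfl fun b hb => ?_
  rw [mem_mates_of_pos_eq h] at hb
  rw [upVal, if_pos hb.2]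
  refine Finset.sum_congr ?_ fun _ _ => rfl
  have hb1 := (Finset.mem_filter.1 hb.1).2
  ext c
  have h2 := (Finset.mem_filter.1 (hldr c)).2
  simp only [block, Finset.mem_filter, Finset.mem_univ, true_and]
  constructor
  · rintro ⟨h3, h4⟩
    exact ⟨⟨h3.trans hb1.1, (div_pow_succ h4).trans hb1.2⟩,
      hb.2.unique hid (hlead c) (h2.1.trans h3) (h2.2.trans h4)⟩
  · rintro ⟨-, rfl⟩
    exact ⟨h2.1.symm, h2.2.symm⟩

/-- Exactly one of the mates leads the block of level `t + 1` and carries the total, while the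
others carry `0`. Adding up therefore broadcasts the total, by the same operation as on the way up.
-/
theorem sum_mates_downVal (hid : Function.Injective ident) {t : ℕ} {a : α}
    (h : pos g ident B t a = t) :
    ∑ b ∈ mates g ident B t a, downVal g ident B w (t + 1) b = total g w a := by
  obtain ⟨c, hc, hcl⟩ := exists_leader (g := g) (ident := ident) (B := B) (t + 1) a
  have hc1 := (Finset.mem_filter.1 hc).2
  have htot : total g w c = total g w a := by unfold total; rw [hc1.1]
  rw [Finset.sum_eq_single_of_mem c]
  · rw [downVal, if_pos hcl, htot]
  · rw [mem_mates_of_pos_eq h]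
    exact ⟨hc, hcl.of_succ⟩
  · intro b hb hbc
    rw [mem_mates_of_pos_eq h] at hb
    have hb1 := (Finset.mem_filter.1 hb.1).2
    rw [downVal, if_neg]
    exact fun hbl => hbc (hcl.unique hid hbl (hb1.1.trans hc1.1.symm) (hb1.2.trans hc1.2.symm))

/-- At level `L` all quotients vanish, so the blocks are whole groups. The sums gathered on the way
up are already the totals that go down. -/
theorem upVal_top {L : ℕ} (hL : ∀ a, ident a < B ^ L) (a : α) :
    upVal g ident B w L a = downVal g ident B w (L + 1) a := by
  have hdiv : ∀ b, ident b / B ^ L = 0 := fun b => Nat.div_eq_of_lt (hL b)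
  have hdiv' : ∀ b, ident b / B ^ (L + 1) = 0 := fun b => by
    rw [pow_succ, ← Nat.div_div_eq_div_mul, hdiv, Nat.zero_div]
  have hl : Leads g ident B (L + 1) a ↔ Leads g ident B L a := by
    simp only [Leads, hdiv, hdiv']
  simp only [upVal, downVal, total, block, hl, hdiv, and_true]

/-- The level of item `a` in round `s` of an all-reduce of height `L`. -/
noncomputable def levAt (g ident : α → ℕ) (B L s : ℕ) (a : α) : ℕ :=
  if s ≤ L then pos g ident B s a else pos g ident B (2 * L - s) a

/-- The value of item `a` in round `s` of an all-reduce of height `L`. -/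
noncomputable def valAt (g ident : α → ℕ) (B : ℕ) (w : α → M) (L s : ℕ) (a : α) : M :=
  if s ≤ L then upVal g ident B w s a else downVal g ident B w (2 * L + 1 - s) a

end

end Trie

/-! ### The MR algorithm

There is one item for every node and two for every edge `{u, v}`: the items `(u, u)`, `(u, v)` and
`(v, u)`. The items `(u, ·)` all know the state of the node `u`. One step of the clustering
algorithm takes an epoch of rounds, in which the items `(u, v)` and `(v, u)` exchange the states of
`u` and `v`, the items `(u, ·)` compute the new state of `u`, and all the items gather statistics on
the whole clustering, from which they infer what to do next. -/

namespace ClusterMR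

open MapReduce

/-- Statistics: a number of uncovered nodes, which adds up, and a number of which the maximum is
taken. -/
@[ext] structure Agg where
  cnt : ℕ
  top : ℕ

instance : Zero Agg := ⟨⟨0, 0⟩⟩

instance : Add Agg := ⟨fun a b => ⟨a.cnt + b.cnt, max a.top b.top⟩⟩

/-- This is all that an all-reduce needs. Addition in the first coordinate counts uncovered nodes;
the maximum in the second chooses among proposed states and finds the radius. -/
instance : AddCommMonoid Agg where
  add_assoc a b c := Agg.ext (Nat.add_assoc _ _ _) (max_assoc _ _ _)
  zero_add a := Agg.ext (Nat.zero_add _) (Nat.zero_max _)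
  add_zero a := Agg.ext (Nat.add_zero _) (Nat.max_zero _)
  add_comm a b := Agg.ext (Nat.add_comm _ _) (max_comm _ _)
  nsmul := nsmulRec

theorem Agg.zero_cnt : (0 : Agg).cnt = 0 := rfl

theorem Agg.zero_top : (0 : Agg).top = 0 := rfl

theorem Agg.sum_cnt {α : Type} (F : Finset α) (w : α → Agg) :
    (∑ b ∈ F, w b).cnt = ∑ b ∈ F, (w b).cnt := by
  classical
  induction F using Finset.induction_on with
  | empty => rfl
  | insert a F ha ih => rw [Finset.sum_insert ha, Finset.sum_insert ha, ← ih]; rfl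

theorem Agg.sum_top {α : Type} (F : Finset α) (w : α → Agg) :
    (∑ b ∈ F, w b).top = F.sup fun b => (w b).top := by
  classical
  induction F using Finset.induction_on with
  | empty => rfl
  | insert a F ha ih => rw [Finset.sum_insert ha, Finset.sup_insert, ← ih]; rfl

/-- The control state: `act` is what to do next, namely `0` to finish, `1` and `2` to select centers
and to grow clusters in `CLUSTER`, and `3` and `4` to do so in the for loop of `CLUSTER2`; `unc` is
the number of uncovered nodes when the current iteration of `CLUSTER` began, `rad` is the radius
found by `CLUSTER`, `iter` is the number of the current iteration and `left` is the number of
growing steps that it still has to do. -/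
@[ext] structure Glob where
  act : ℕ
  unc : ℕ
  rad : ℕ
  iter : ℕ
  left : ℕ

/-- What an item `(u, v)` knows: the state `own` of the node `u`, the statistics that are being
gathered, the level in the trie and the control state. -/
structure Item where
  u : ℕ
  v : ℕ
  own : ℕ
  agg : Agg
  lev : ℕ
  glob : Glob

/-- An item as a sequence of words. -/
def Item.enc (x : Item) : List ℕ :=
  [x.u, x.v, x.own, x.agg.cnt, x.agg.top, x.lev, x.glob.act, x.glob.unc, x.glob.rad, x.glob.iter,
    x.glob.left]

/-- The item with the given sequence of words. -/
def Item.dec : List ℕ → Item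
  | [u, v, own, cnt, top, lev, act, unc, rad, iter, left] =>
    ⟨u, v, own, ⟨cnt, top⟩, lev, ⟨act, unc, rad, iter, left⟩⟩
  | _ => ⟨0, 0, 0, ⟨0, 0⟩, 0, ⟨0, 0, 0, 0, 0⟩⟩

theorem Item.dec_enc (x : Item) : Item.dec x.enc = x := rfl

/-- The parameters of the algorithm: the number `n` of nodes, the parameter `τ`, the arity `B` and
the height `L` of the tries and whether to run `CLUSTER2`. -/
structure Params where
  n : ℕ
  τ : ℕ
  B : ℕ
  L : ℕ
  two : Bool

/-- The kinds of rounds. -/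
inductive Phase
  | exch
  | red (all : Bool) (s : ℕ)
  | mid
  | fin

/-- The number of rounds of an epoch. -/
def Params.period (p : Params) : ℕ := 4 * p.L + 5

/-- The kind of round `j` of an epoch. -/
def Params.phase (p : Params) (j : ℕ) : Phase :=
  if j = 0 then .exch
  else if j ≤ 2 * p.L + 1 then .red false (j - 1)
  else if j = 2 * p.L + 2 then .mid
  else if j ≤ 4 * p.L + 3 then .red true (j - (2 * p.L + 3))
  else .fin

/-- Where an item is sent to. -/
def Params.key (p : Params) : Phase → Item → List ℕ
  | .red all _, x =>
    [if all then 0 else x.u + 1, x.lev, (x.u * p.n + x.v) / p.B ^ (x.lev + 1)]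
  | _, x => [min x.u x.v, max x.u x.v]

/-! The state of a node is a number: `0` if the node is uncovered, and `1 + z + n * d` if it is in
the cluster of `z`, at depth `d`. -/

/-- The depth of a node in its cluster. -/
def depth (n c : ℕ) : ℕ := (c - 1) / n

/-- The state of a node that joins the cluster of a node with state `c`. -/
def bump (n c : ℕ) : ℕ := if c = 0 then 0 else if depth n c < n then c + n else c

/-- Nothing is covered when the for loop of `CLUSTER2` begins. -/
def base (gl : Glob) (c : ℕ) : ℕ := if gl.act = 3 ∧ gl.iter = 1 then 0 else c

/-- The probability of becoming a center. -/
noncomputable def Params.thr (p : Params) (gl : Glob) : ℝ :=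
  if gl.act = 1 then 4 * p.τ * Real.logb 2 p.n / gl.unc else 2 ^ gl.iter / (p.n : ℝ)

/-- What to do next. -/
noncomputable def Params.next (p : Params) (gl : Glob) (a : Agg) : Glob :=
  if gl.act = 1 ∨ gl.act = 2 then
    if 2 * a.cnt ≤ gl.unc then
      if (a.cnt : ℝ) < 8 * p.τ * Real.logb 2 p.n then
        -- With radius `0` the for loop grows nothing and ends with singletons, like the clustering
        -- at hand. It is skipped because its selections would not be paid for by growing steps.
        if p.two = true ∧ a.top ≠ 0 then ⟨3, gl.unc, a.top, 1, 0⟩ else ⟨0, gl.unc, 0, gl.iter, 0⟩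
      else ⟨1, a.cnt, 0, gl.iter + 1, 0⟩
    else ⟨2, gl.unc, 0, gl.iter, 0⟩
  else if gl.act = 3 then ⟨4, gl.unc, gl.rad, gl.iter, 2 * gl.rad⟩
  else if gl.act = 4 then
    -- The growing step of the current epoch has already been done here, so `left = 1` means that it
    -- was the last one.
    if gl.left ≤ 1 then
      if gl.iter = Nat.clog 2 p.n then ⟨0, gl.unc, gl.rad, gl.iter, 0⟩
      else ⟨3, gl.unc, gl.rad, gl.iter + 1, 0⟩
    else ⟨4, gl.unc, gl.rad, gl.iter, gl.left - 1⟩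
  else gl

/-- What to do first. -/
noncomputable def Params.first (p : Params) : Glob :=
  if (p.n : ℝ) < 8 * p.τ * Real.logb 2 p.n then ⟨0, p.n, 0, 1, 0⟩ else ⟨1, p.n, 0, 1, 0⟩

open Classical in
/-- The state that item `x = (u, v)` proposes for the node `u`, when it meets the items `X`. -/
noncomputable def Params.proposal (p : Params) (coin : Prop) (X : Multiset Item) (x : Item) : ℕ :=
  if x.glob.act = 1 ∨ x.glob.act = 3 then
    if x.u = x.v ∧ base x.glob x.own = 0 ∧ coin then x.u + 1 else 0
  -- For an edge this picks the opposite item. An item `(u, u)` finds itself: its proposal is `0` if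
  -- `u` is uncovered and ignored if `u` is covered.
  else ((X.filter fun y => y.u = x.v ∧ y.v = x.u).map fun y => bump p.n y.own).sup

open Classical in
/-- How item `x` changes in a round in which it meets the items `X`. -/
noncomputable def Params.step (p : Params) (coin : Prop) (X : Multiset Item) (x : Item) :
    Phase → Item
  | .exch => ⟨x.u, x.v, base x.glob x.own, ⟨0, p.proposal coin X x⟩, 0, x.glob⟩
  | .red _ s =>
    if s < p.L then
      if x.lev = s then
        if ∀ y ∈ X, x.u * p.n + x.v ≤ y.u * p.n + y.v then
          ⟨x.u, x.v, x.own, (X.map Item.agg).sum, x.lev + 1, x.glob⟩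
        else ⟨x.u, x.v, x.own, 0, x.lev, x.glob⟩
      else x
    else if x.lev = 2 * p.L - s then
      ⟨x.u, x.v, x.own, (X.map Item.agg).sum, x.lev - 1, x.glob⟩
    else x
  | .mid =>
    let o := if x.own = 0 then x.agg.top else x.own
    ⟨x.u, x.v, o, if x.u = x.v then ⟨if o = 0 then 1 else 0, depth p.n o⟩ else 0, 0, x.glob⟩
  | .fin => ⟨x.u, x.v, x.own, 0, 0, p.next x.glob x.agg⟩

/-- The coin of a reducer that receives the items `X`. -/
def Params.coin (p : Params) (X : Multiset Item) (s : unitInterval) : Prop :=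
  -- The coin matters only at the key of an item `(u, u)`, which arrives alone, so that the sum is
  -- its own threshold.
  (s : ℝ) ≤ (X.map fun x => p.thr x.glob).sum

/-- The item that has just been created. -/
noncomputable def Params.newItem (p : Params) (u v : ℕ) : Item := ⟨u, v, 0, 0, 0, p.first⟩

/-- An item as a pair to be processed in round `j` of an epoch. -/
def Params.pair (p : Params) (j : ℕ) (x : Item) : KV := (p.key (p.phase j) x, x.enc)

/-- The pairs that replace an input pair. -/
noncomputable def Params.create (p : Params) : List ℕ → Multiset KV
  | [v] => {p.pair 0 (p.newItem v v)}
  | [u, v] => {p.pair 0 (p.newItem u v), p.pair 0 (p.newItem v u)}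
  | _ => 0

/-- The pairs that replace the item `x` in round `j` of an epoch. -/
noncomputable def Params.live (p : Params) (j : ℕ) (coin : Prop) (X : Multiset Item) (x : Item) :
    Multiset KV :=
  if j = 0 ∧ x.glob.act = 0 then 0
  else {p.pair ((j + 1) % p.period) (p.step coin X x (p.phase j))}

/-- The output of the item `x` in round `j` of an epoch. -/
def Params.out (p : Params) (j : ℕ) (x : Item) : Multiset KV :=
  if j = 0 ∧ x.glob.act = 0 ∧ x.u = x.v then
    {([x.u], [if x.own = 0 then x.u else (x.own - 1) % p.n])}
  else 0

/-- The reducer. -/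
noncomputable def Params.reduce (p : Params) (r : ℕ) (k : List ℕ) (vals : Multiset (List ℕ))
    (coin : Prop) : Multiset KV × Multiset KV :=
  if r = 0 then (vals.bind fun _ => p.create k, vals.bind fun _ => 0)
  else (vals.bind fun l => p.live ((r - 1) % p.period) coin (vals.map Item.dec) (Item.dec l),
    vals.bind fun l => p.out ((r - 1) % p.period) (Item.dec l))

/-- The MR algorithm. -/
noncomputable def Params.algorithm (p : Params) : Algorithm where
  reduce r k vals s := p.reduce r k vals (p.coin (vals.map Item.dec) s)
  measurable_reduce r k vals out := by
    have hs : MeasurableSet {s : unitInterval | p.coin (vals.map Item.dec) s} :=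
      measurableSet_le measurable_subtype_coe measurable_const
    have : {s : unitInterval | p.reduce r k vals (p.coin (vals.map Item.dec) s) = out} =
        ({s | p.coin (vals.map Item.dec) s} ∩ {_s | p.reduce r k vals True = out}) ∪
          ({s | p.coin (vals.map Item.dec) s}ᶜ ∩ {_s | p.reduce r k vals False = out}) := by
      ext s
      by_cases h : p.coin (vals.map Item.dec) s <;> simp [h]
    rw [this]
    exact (hs.inter (MeasurableSet.const _)).union (hs.compl.inter (MeasurableSet.const _))

/-! ### The computation on the level of nodes -/

/-- The states of the nodes and the control state. -/
@[ext] structure NState (n : ℕ) where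
  own : Fin n → ℕ
  glob : Glob

section node

variable {n : ℕ} (G : SimpleGraph (Fin n)) (p : Params)

/-- The states of the nodes at the beginning of a step. -/
def NState.start (S : NState n) (u : Fin n) : ℕ := base S.glob (S.own u)

open Classical in
/-- The state proposed for `u` by the item `(u, v)`. -/
noncomputable def NState.prop (S : NState n) (y : Fin n → unitInterval) (u v : Fin n) : ℕ :=
  if S.glob.act = 1 ∨ S.glob.act = 3 then
    if u = v ∧ S.start u = 0 ∧ (y u : ℝ) ≤ p.thr S.glob then (u : ℕ) + 1 else 0
  else bump p.n (S.own v)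

open Classical in
/-- The new states of the nodes. -/
noncomputable def NState.after (S : NState n) (y : Fin n → unitInterval) (u : Fin n) : ℕ :=
  if S.start u = 0 then (Finset.univ.filter fun v => u = v ∨ G.Adj u v).sup (S.prop p y u)
  else S.start u

/-- The statistics of the states `own`. -/
def stats (p : Params) (own : Fin n → ℕ) : Agg :=
  ⟨(Finset.univ.filter fun u => own u = 0).card, Finset.univ.sup fun u => depth p.n (own u)⟩

/-- The effect of an epoch with the coins `y`. -/
noncomputable def NState.step (S : NState n) (y : Fin n → unitInterval) : NState n :=
  ⟨S.after G p y, p.next S.glob (stats p (S.after G p y))⟩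

/-- The state after `e` epochs, the coins of epoch `e` being `y (e, ·)`. -/
noncomputable def run (y : ℕ × Fin n → unitInterval) : ℕ → NState n
  | 0 => ⟨fun _ => 0, p.first⟩
  | e + 1 => (run y e).step G p fun v => y (e, v)

end node

/-! ### The computation on the level of items -/

section item

variable {n : ℕ} (G : SimpleGraph (Fin n)) (p : Params)

/-- The items. -/
abbrev Arc : Type := {a : Fin n × Fin n // a.1 = a.2 ∨ G.Adj a.1 a.2}

noncomputable instance : Fintype (Arc G) := by
  classical
  exact Subtype.fintype _

variable {G}

/-- The number of an item. -/
def ident (a : Arc G) : ℕ := a.1.1 * n + a.1.2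

/-- The group of an item in an all-reduce over all the items or over the items of a node. -/
def grp (all : Bool) (a : Arc G) : ℕ := if all then 0 else a.1.1 + 1

theorem ident_injective : Function.Injective (ident (G := G)) := by
  intro a b h
  have hn : 0 < n := a.1.1.pos
  simp only [ident] at h
  have h1 : (a.1.1 : ℕ) = b.1.1 := by
    have := congrArg (· / n) h
    simp only [mul_comm _ n, Nat.mul_add_div hn, Nat.div_eq_of_lt (Fin.is_lt _)] at this
    simpa using this
  have h2 : (a.1.2 : ℕ) = b.1.2 := by
    rw [h1] at h; omega
  exact Subtype.ext (Prod.ext (Fin.ext h1) (Fin.ext h2))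

theorem ident_lt (a : Arc G) : ident a < n ^ 2 := by
  have h1 := a.1.1.is_lt
  have h2 := a.1.2.is_lt
  have : (a.1.1 : ℕ) * n + n ≤ n * n := by
    rw [← Nat.succ_mul]; exact Nat.mul_le_mul_right _ h1
  rw [ident, sq]; omega

open Classical in
/-- The items met by an item in a round of kind `ph`. -/
noncomputable def meets (ph : Phase) (T : Arc G → Item) (a : Arc G) : Finset (Arc G) :=
  Finset.univ.filter fun b => p.key ph (T b) = p.key ph (T a)

/-- The effect on the items of a round of kind `ph` with the seeds `s`. -/
noncomputable def itemStep (ph : Phase) (s : List ℕ → unitInterval) (T : Arc G → Item)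
    (a : Arc G) : Item :=
  p.step (p.coin ((meets p ph T a).val.map T) (s (p.key ph (T a)))) ((meets p ph T a).val.map T)
    (T a) ph

/-- The items between two epochs. -/
def restItem (S : NState n) (a : Arc G) : Item :=
  ⟨a.1.1, a.1.2, S.own a.1.1, 0, 0, S.glob⟩

/-- The items in the course of an all-reduce. -/
noncomputable def redItem (all : Bool) (own : Fin n → ℕ) (gl : Glob) (w : Arc G → Agg) (s : ℕ)
    (a : Arc G) : Item :=
  ⟨a.1.1, a.1.2, own a.1.1, Trie.valAt (grp all) ident p.B w p.L s a,
    Trie.levAt (grp all) ident p.B p.L s a, gl⟩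

/-- The level of the tries in round `s` of an all-reduce. -/
def height (L s : ℕ) : ℕ := if s ≤ L then s else 2 * L - s

theorem levAt_eq {α : Type} [Fintype α] (g ident : α → ℕ) (B L s : ℕ) (a : α) :
    Trie.levAt g ident B L s a = Trie.pos g ident B (height L s) a := by
  unfold Trie.levAt height
  split_ifs <;> rfl

/-- The key spells out the group, the level and the number of the parent block, which is what mates
have in common. -/
theorem meets_redItem (all : Bool) (own : Fin n → ℕ) (gl : Glob) (w : Arc G → Agg) (s s' : ℕ)
    (hpn : p.n = n) (a : Arc G) :
    meets p (.red all s') (redItem p all own gl w s) a =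
      Trie.mates (grp all) ident p.B (height p.L s) a := by
  ext b
  rw [meets, Trie.mates, Finset.mem_filter, Finset.mem_filter]
  simp only [Finset.mem_univ, true_and, Params.key, redItem,
    levAt_eq, hpn, List.cons.injEq, and_true, grp, ident]

/-- In the rounds before `L`, an item that still leads its block adds up the values of its mates,
and then climbs or stays behind with `0`. In later rounds, the items on the current level get the
total from the single mate that has it. All others wait. -/
theorem itemStep_redItem (all : Bool) (own : Fin n → ℕ) (gl : Glob) (w : Arc G → Agg) (s : ℕ)
    (hpn : p.n = n) (hL : n ^ 2 ≤ p.B ^ p.L) (hs : s ≤ 2 * p.L) (σ : List ℕ → unitInterval) :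
    itemStep p (.red all s) σ (redItem p all own gl w s) = redItem p all own gl w (s + 1) := by
  funext a
  have hinj := ident_injective (G := G)
  unfold itemStep
  rw [meets_redItem p all own gl w s s hpn]
  have hsum : ((((Trie.mates (grp all) ident p.B (height p.L s) a).val.map
      (redItem p all own gl w s)).map Item.agg).sum : Agg) =
      ∑ b ∈ Trie.mates (grp all) ident p.B (height p.L s) a,
        Trie.valAt (grp all) ident p.B w p.L s b := by
    rw [Multiset.map_map]; rfl
  have hlev : (redItem p all own gl w s a).lev = Trie.pos (grp all) ident p.B (height p.L s) a :=
    levAt_eq _ _ _ _ _ _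
  by_cases hsL : s < p.L
  · have hh : height p.L s = s := by simp [height, hsL.le]
    have hval : ∀ b, Trie.valAt (grp all) ident p.B w p.L s b =
        Trie.upVal (grp all) ident p.B w s b := fun b => by simp [Trie.valAt, hsL.le]
    rw [hh] at hsum hlev ⊢
    simp only [hval] at hsum
    simp only [Params.step, if_pos hsL, hlev, hsum]
    have hv1 : Trie.valAt (grp all) ident p.B w p.L (s + 1) a =
        Trie.upVal (grp all) ident p.B w (s + 1) a := by
      rw [Trie.valAt, if_pos (show s + 1 ≤ p.L by omega)]
    have hl1 : Trie.levAt (grp all) ident p.B p.L (s + 1) a =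
        Trie.pos (grp all) ident p.B (s + 1) a := by
      rw [Trie.levAt, if_pos (show s + 1 ≤ p.L by omega)]
    have hmin : (∀ y ∈ (Trie.mates (grp all) ident p.B s a).val.map (redItem p all own gl w s),
        (redItem p all own gl w s a).u * p.n + (redItem p all own gl w s a).v ≤
          y.u * p.n + y.v) ↔ ∀ b ∈ Trie.mates (grp all) ident p.B s a, ident a ≤ ident b := by
      simp only [Multiset.mem_map, forall_exists_index, and_imp, forall_apply_eq_imp_iff₂,
        Finset.mem_val, redItem, hpn, ident]
    by_cases hp : Trie.pos (grp all) ident p.B s a = s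
    · rw [if_pos hp]
      rw [Trie.forall_mates_iff hp] at hmin
      simp only [Trie.sum_mates_upVal w hinj hp]
      by_cases hl : Trie.Leads (grp all) ident p.B (s + 1) a
      · rw [if_pos (hmin.2 hl)]
        simp only [redItem, hv1, hl1, Trie.upVal, if_pos hl, hp, Trie.pos_eq_iff.2 hl]
      · rw [if_neg (mt hmin.1 hl)]
        simp only [redItem, hv1, hl1, Trie.upVal, if_neg hl, Trie.pos_succ]
    · rw [if_neg hp]
      rw [Trie.pos_eq_iff] at hp
      have hl : ¬ Trie.Leads (grp all) ident p.B (s + 1) a := fun h => hp h.of_succ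
      simp only [redItem, hv1, hl1, hval, Trie.upVal, if_neg hl, if_neg hp, Trie.pos_succ,
        levAt_eq, hh]
  · set t := 2 * p.L - s with ht
    have hh : height p.L s = t := by
      unfold height; split_ifs <;> omega
    have hval : ∀ b, Trie.valAt (grp all) ident p.B w p.L s b =
        Trie.downVal (grp all) ident p.B w (t + 1) b := by
      intro b
      unfold Trie.valAt
      split_ifs with h
      -- This is the turning point: round `L` already descends, but the values are still those of
      -- the way up.
      · have h1 : s = p.L := by omega
        have h2 : t = p.L := by omega
        rw [h1, h2]
        exact Trie.upVal_top w (fun c => (ident_lt c).trans_le hL) b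
      · congr 1; omega
    rw [hh] at hsum hlev ⊢
    simp only [hval] at hsum
    simp only [Params.step, if_neg hsL, hlev, hsum]
    have hv1 : Trie.valAt (grp all) ident p.B w p.L (s + 1) a =
        Trie.downVal (grp all) ident p.B w t a := by
      rw [Trie.valAt, if_neg (by omega)]; congr 1; omega
    have hl1 : Trie.levAt (grp all) ident p.B p.L (s + 1) a =
        Trie.pos (grp all) ident p.B (t - 1) a := by
      rw [Trie.levAt, if_neg (by omega)]; congr 1
    by_cases hp : Trie.pos (grp all) ident p.B t a = t
    · rw [if_pos hp, Trie.sum_mates_downVal w hinj hp]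
      have hl := Trie.pos_eq_iff.1 hp
      have hp' : Trie.pos (grp all) ident p.B (t - 1) a = t - 1 := by
        rcases Nat.eq_zero_or_pos t with h0 | h0
        · rw [h0]; exact Trie.pos_zero a
        · refine Trie.pos_eq_iff.2 (Trie.Leads.of_succ ?_)
          rwa [Nat.sub_add_cancel h0]
      simp only [redItem, hv1, hl1, Trie.downVal, if_pos hl, hp, hp']
    · rw [if_neg hp]
      have hl : ¬ Trie.Leads (grp all) ident p.B t a := fun h => hp (Trie.pos_eq_iff.2 h)
      have hl' : ¬ Trie.Leads (grp all) ident p.B (t + 1) a := fun h => hl h.of_succ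
      have ht0 : t ≠ 0 := by
        rintro h0
        rw [h0] at hp
        exact hp (Trie.pos_zero a)
      have hp' : Trie.pos (grp all) ident p.B t a = Trie.pos (grp all) ident p.B (t - 1) a := by
        obtain ⟨t', ht'⟩ := Nat.exists_eq_succ_of_ne_zero ht0
        rw [ht'] at hl ⊢
        rw [Nat.succ_eq_add_one, Trie.pos_succ, if_neg hl, Nat.add_sub_cancel]
      simp only [redItem, hv1, hl1, hval, Trie.downVal, if_neg hl, if_neg hl', levAt_eq, hh, hp']

theorem redItem_zero (all : Bool) (own : Fin n → ℕ) (gl : Glob) (w : Arc G → Agg) (a : Arc G) :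
    redItem p all own gl w 0 a = ⟨a.1.1, a.1.2, own a.1.1, w a, 0, gl⟩ := by
  simp [redItem, Trie.valAt, Trie.levAt, Trie.pos_zero, Trie.upVal_zero w ident_injective]

theorem redItem_last (all : Bool) (own : Fin n → ℕ) (gl : Glob) (w : Arc G → Agg) (a : Arc G) :
    redItem p all own gl w (2 * p.L + 1) a =
      ⟨a.1.1, a.1.2, own a.1.1, Trie.total (grp all) w a, 0, gl⟩ := by
  have h : ¬ 2 * p.L + 1 ≤ p.L := by omega
  have h' : 2 * p.L - (2 * p.L + 1) = 0 := by omega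
  simp [redItem, Trie.valAt, Trie.levAt, Trie.pos_zero, h, h', Trie.downVal, Trie.leads_zero]

end item

end ClusterMR

/-! ### One epoch, round by round -/

namespace ClusterMR

open MapReduce

section epoch

variable {n : ℕ} {G : SimpleGraph (Fin n)} (p : Params)

/-- What the items contribute to the new states of the nodes. -/
noncomputable def NState.offer (S : NState n) (y : Fin n → unitInterval) (a : Arc G) : Agg :=
  ⟨0, S.prop p y a.1.1 a.1.2⟩

/-- What the items contribute to the statistics. -/
def share (own : Fin n → ℕ) (a : Arc G) : Agg :=
  if a.1.1 = a.1.2 then ⟨if own a.1.1 = 0 then 1 else 0, depth p.n (own a.1.1)⟩ else 0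

/-- The items in round `j` of an epoch that starts in state `S` and uses the coins `y`. -/
noncomputable def epochItem (S : NState n) (y : Fin n → unitInterval) (j : ℕ) : Arc G → Item :=
  if j = 0 then restItem S
  else if j ≤ 2 * p.L + 2 then redItem p false S.start S.glob (S.offer p y) (j - 1)
  else if j ≤ 4 * p.L + 4 then
    redItem p true (S.after G p y) S.glob (share p (S.after G p y)) (j - (2 * p.L + 3))
  else restItem (S.step G p y)

/-- The item of a node. -/
def nodeArc (u : Fin n) : Arc G := ⟨(u, u), Or.inl rfl⟩

/-- The other item of the same edge. -/
def flip (a : Arc G) : Arc G := ⟨(a.1.2, a.1.1), a.2.imp Eq.symm fun h => h.symm⟩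

theorem minmax_inj {a b c d : ℕ} (h1 : min a b = min c d) (h2 : max a b = max c d) :
    (a = c ∧ b = d) ∨ (a = d ∧ b = c) := by
  omega

/-- The key that the two items of an edge share. -/
def edgeKey (a : Arc G) : List ℕ :=
  [min (a.1.1 : ℕ) a.1.2, max (a.1.1 : ℕ) a.1.2]

theorem edgeKey_eq {a b : Arc G} (h : edgeKey b = edgeKey a) : b = a ∨ b = flip a := by
  simp only [edgeKey, List.cons.injEq, and_true] at h
  rcases minmax_inj h.1 h.2 with ⟨h1, h2⟩ | ⟨h1, h2⟩
  · exact Or.inl (Subtype.ext (Prod.ext (Fin.ext h1) (Fin.ext h2)))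
  · exact Or.inr (Subtype.ext (Prod.ext (Fin.ext h1) (Fin.ext h2)))

theorem edgeKey_flip (a : Arc G) : edgeKey (flip a) = edgeKey a := by
  simp only [edgeKey, flip, min_comm, max_comm]

open Classical in
theorem filter_edgeKey_subset (a : Arc G) :
    (Finset.univ.filter fun b => edgeKey b = edgeKey a) ⊆ {a, flip a} := by
  intro b hb
  have := edgeKey_eq (Finset.mem_filter.1 hb).2
  simpa using this

open Classical in
theorem meets_exch_restItem (S : NState n) (a : Arc G) :
    meets p .exch (restItem S) a = Finset.univ.filter fun b => edgeKey b = edgeKey a := by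
  ext b
  rw [meets, Finset.mem_filter, Finset.mem_filter]
  rfl

/-- An item `(u, u)` is alone at its key, so the seed of that reducer is the coin of `u` and the
threshold is its own. For an edge, the reducer holds precisely the two opposite items, and the
filter retains the state of the other end. -/
theorem proposal_eq (S : NState n) (y : Fin n → unitInterval) (σ : List ℕ → unitInterval)
    (hy : ∀ u : Fin n, y u = σ [(u : ℕ), (u : ℕ)]) (a : Arc G) :
    p.proposal (p.coin ((meets p .exch (restItem S) a).val.map (restItem S))
        (σ (p.key .exch (restItem S a))))
      ((meets p .exch (restItem S) a).val.map (restItem S)) (restItem S a) =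
      S.prop p y a.1.1 a.1.2 := by
  classical
  rw [meets_exch_restItem]
  unfold Params.proposal NState.prop
  have hgl : (restItem S a).glob = S.glob := rfl
  rw [hgl]
  by_cases hact : S.glob.act = 1 ∨ S.glob.act = 3
  · rw [if_pos hact, if_pos hact]
    by_cases huv : a.1.1 = a.1.2
    · have hset : (Finset.univ.filter fun b => edgeKey b = edgeKey a) = {a} := by
        have hflip : flip a = a := Subtype.ext (Prod.ext huv.symm huv)
        refine Finset.Subset.antisymm ((filter_edgeKey_subset a).trans ?_) ?_
        · rw [hflip]; simp
        · simp
      have hkey : p.key .exch (restItem S a) = [(a.1.1 : ℕ), (a.1.1 : ℕ)] := by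
        simp [Params.key, restItem, ← huv]
      have hcoin : p.coin (({a} : Finset (Arc G)).val.map (restItem S)) (σ (p.key .exch (restItem S a)))
          ↔ (y a.1.1 : ℝ) ≤ p.thr S.glob := by
        rw [hkey, ← hy, Params.coin]
        simp [hgl]
      rw [hset]
      simp only [hcoin]
      simp only [restItem, NState.start, huv]
    · have : ¬ (restItem S a).u = (restItem S a).v := fun h => huv (Fin.ext h)
      rw [if_neg fun h => this h.1, if_neg fun h => huv h.1]
  · rw [if_neg hact, if_neg hact, Multiset.filter_map, Multiset.map_map]
    have hset : Multiset.filter ((fun x : Item => x.u = (restItem S a).v ∧ x.v = (restItem S a).u) ∘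
        restItem S) (Finset.univ.filter fun b => edgeKey b = edgeKey a).val = {flip a} := by
      have : (Finset.univ.filter fun b => edgeKey b = edgeKey a).filter
          ((fun x : Item => x.u = (restItem S a).v ∧ x.v = (restItem S a).u) ∘ restItem S) =
          {flip a} := by
        ext b
        simp only [Finset.mem_filter, Finset.mem_univ, true_and, Finset.mem_singleton,
          Function.comp_apply]
        constructor
        · rintro ⟨-, h1, h2⟩
          exact Subtype.ext (Prod.ext (Fin.ext h1) (Fin.ext h2))
        · rintro rfl
          exact ⟨edgeKey_flip a, rfl, rfl⟩
      rw [← Finset.filter_val, this]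
      rfl
    rw [hset]
    simp [restItem, flip]

theorem itemStep_exch (S : NState n) (y : Fin n → unitInterval) (σ : List ℕ → unitInterval)
    (hy : ∀ u : Fin n, y u = σ [(u : ℕ), (u : ℕ)]) :
    itemStep p .exch σ (restItem (G := G) S) =
      redItem p false S.start S.glob (S.offer p y) 0 := by
  funext a
  rw [redItem_zero]
  unfold itemStep
  have := proposal_eq p S y σ hy a
  simp only [Params.step]
  rw [this]
  rfl

open Classical in
theorem total_offer (S : NState n) (y : Fin n → unitInterval) (a : Arc G) :
    (Trie.total (grp false) (S.offer p y) a).top =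
      (Finset.univ.filter fun v => a.1.1 = v ∨ G.Adj a.1.1 v).sup (S.prop p y a.1.1) := by
  unfold Trie.total
  rw [Agg.sum_top]
  apply le_antisymm
  · refine Finset.sup_le fun b hb => ?_
    have hb' : b.1.1 = a.1.1 := by
      have := (Finset.mem_filter.1 hb).2
      simp only [grp] at this
      exact Fin.ext (by simpa using this)
    refine le_trans (le_of_eq ?_) (Finset.le_sup (b := b.1.2) ?_)
    · simp [NState.offer, hb']
    · have := b.2
      rw [hb'] at this
      simpa using this
  · refine Finset.sup_le fun v hv => ?_
    have hv' := (Finset.mem_filter.1 hv).2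
    exact Finset.le_sup (f := fun b : Arc G => (S.offer p y b).top) (b := (⟨(a.1.1, v), hv'⟩ : Arc G))
      (Finset.mem_filter.2 ⟨Finset.mem_univ _, rfl⟩)

theorem itemStep_mid (S : NState n) (y : Fin n → unitInterval) (σ : List ℕ → unitInterval) :
    itemStep p .mid σ (redItem (G := G) p false S.start S.glob (S.offer p y) (2 * p.L + 1)) =
      redItem p true (S.after G p y) S.glob (share p (S.after G p y)) 0 := by
  classical
  funext a
  rw [redItem_zero]
  unfold itemStep
  rw [redItem_last]
  have h1 : (if S.start a.1.1 = 0 then (Trie.total (grp false) (S.offer p y) a).top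
      else S.start a.1.1) = S.after G p y a.1.1 := by
    rw [total_offer, NState.after]
  simp only [Params.step, h1, share, Fin.ext_iff]

/-- Only the item `(u, u)` speaks for `u`, so each node is counted once. -/
theorem total_share (own : Fin n → ℕ) (a : Arc G) :
    Trie.total (grp true) (share p own) a = stats p own := by
  classical
  have huniv : (Finset.univ.filter fun b : Arc G => grp true b = grp true a) = Finset.univ := by
    ext b; simp [grp]
  unfold Trie.total
  have huniv' : ∑ b ∈ Finset.univ.filter (fun b : Arc G => grp true b = grp true a), share p own b =
      ∑ b : Arc G, share p own b := by
    rw [huniv]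
  refine Agg.ext ?_ ?_
  · trans (∑ b : Arc G, share p own b).cnt
    · rw [← huniv']
    rw [Agg.sum_cnt]
    change _ = (Finset.univ.filter fun u => own u = 0).card
    rw [Finset.card_filter]
    symm
    refine Finset.sum_of_injOn (nodeArc (G := G)) ?_ (fun _ _ => Finset.mem_coe.2 (Finset.mem_univ _)) ?_ ?_
    · intro u _ v _ h
      exact congrArg (fun b : Arc G => b.1.1) h
    · intro b _ hb
      have : b.1.1 ≠ b.1.2 := by
        intro h
        refine hb ⟨b.1.1, by simp, Subtype.ext (Prod.ext rfl h)⟩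
      simp [share, this, Agg.zero_cnt]
    · intro u _
      by_cases hu : own u = 0 <;> simp [share, nodeArc, hu]
  · trans (∑ b : Arc G, share p own b).top
    · rw [← huniv']
    rw [Agg.sum_top]
    change _ = Finset.univ.sup fun u => depth p.n (own u)
    apply le_antisymm
    · refine Finset.sup_le fun b _ => ?_
      unfold share
      by_cases h : b.1.1 = b.1.2
      · rw [if_pos h]
        exact Finset.le_sup (f := fun u => depth p.n (own u)) (Finset.mem_univ b.1.1)
      · rw [if_neg h]
        exact Nat.zero_le _
    · refine Finset.sup_le fun u _ => ?_
      refine le_trans (le_of_eq ?_) (Finset.le_sup (b := nodeArc (G := G) u) (Finset.mem_univ _))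
      simp [share, nodeArc]

theorem itemStep_fin (S : NState n) (y : Fin n → unitInterval) (σ : List ℕ → unitInterval) :
    itemStep p .fin σ
      (redItem (G := G) p true (S.after G p y) S.glob (share p (S.after G p y)) (2 * p.L + 1)) =
      restItem (S.step G p y) := by
  funext a
  unfold itemStep
  rw [redItem_last, total_share]
  rfl

/-- The items change in a round of an epoch as they should. -/
theorem itemStep_epochItem (S : NState n) (y : Fin n → unitInterval) (σ : List ℕ → unitInterval)
    (hpn : p.n = n) (hL : n ^ 2 ≤ p.B ^ p.L) {j : ℕ} (hj : j < p.period)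
    (hy : j = 0 → ∀ u : Fin n, y u = σ [(u : ℕ), (u : ℕ)]) :
    itemStep p (p.phase j) σ (epochItem (G := G) p S y j) = epochItem p S y (j + 1) := by
  unfold Params.period at hj
  unfold Params.phase
  by_cases h0 : j = 0
  · subst h0
    simpa [epochItem] using itemStep_exch p S y σ (hy rfl)
  by_cases h1 : j ≤ 2 * p.L + 1
  · have e1 : epochItem (G := G) p S y j =
        redItem p false S.start S.glob (S.offer p y) (j - 1) := by
      simp [epochItem, h0, show j ≤ 2 * p.L + 2 by omega]
    have e2 : epochItem (G := G) p S y (j + 1) =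
        redItem p false S.start S.glob (S.offer p y) (j - 1 + 1) := by
      have : j - 1 + 1 = j := by omega
      simp [epochItem, this, h1]
    rw [if_neg h0, if_pos h1, e1, e2]
    exact itemStep_redItem p _ _ _ _ _ hpn hL (by omega) σ
  by_cases h2 : j = 2 * p.L + 2
  · have e1 : epochItem (G := G) p S y j =
        redItem p false S.start S.glob (S.offer p y) (2 * p.L + 1) := by
      simp [epochItem, h2]
    have e2 : epochItem (G := G) p S y (j + 1) =
        redItem p true (S.after G p y) S.glob (share p (S.after G p y)) 0 := by
      simp [epochItem, h2, show 2 * p.L ≤ 4 * p.L + 1 by omega]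
    rw [if_neg h0, if_neg h1, if_pos h2, e1, e2]
    exact itemStep_mid p S y σ
  by_cases h3 : j ≤ 4 * p.L + 3
  · have e1 : epochItem (G := G) p S y j =
        redItem p true (S.after G p y) S.glob (share p (S.after G p y)) (j - (2 * p.L + 3)) := by
      simp [epochItem, h0, show ¬ j ≤ 2 * p.L + 2 by omega, show j ≤ 4 * p.L + 4 by omega]
    have e2 : epochItem (G := G) p S y (j + 1) =
        redItem p true (S.after G p y) S.glob (share p (S.after G p y))
          (j - (2 * p.L + 3) + 1) := by
      have : j + 1 - (2 * p.L + 3) = j - (2 * p.L + 3) + 1 := by omega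
      simp [epochItem, show ¬ j ≤ 2 * p.L + 1 by omega, h3, this]
    rw [if_neg h0, if_neg h1, if_neg h2, if_pos h3, e1, e2]
    exact itemStep_redItem p _ _ _ _ _ hpn hL (by omega) σ
  · have hj' : j = 4 * p.L + 4 := by omega
    have e1 : epochItem (G := G) p S y j =
        redItem p true (S.after G p y) S.glob (share p (S.after G p y)) (2 * p.L + 1) := by
      have : 4 * p.L + 4 - (2 * p.L + 3) = 2 * p.L + 1 := by omega
      simp [epochItem, hj', this, show ¬ 4 * p.L + 4 ≤ 2 * p.L + 2 by omega]
    have e2 : epochItem (G := G) p S y (j + 1) = restItem (S.step G p y) := by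
      simp [epochItem, hj', show ¬ 4 * p.L + 4 ≤ 2 * p.L + 1 by omega]
    rw [if_neg h0, if_neg h1, if_neg h2, if_neg h3, e1, e2]
    exact itemStep_fin p S y σ

theorem epochItem_zero (S : NState n) (y : Fin n → unitInterval) :
    epochItem (G := G) p S y 0 = restItem S := by
  simp [epochItem]

theorem epochItem_period (S : NState n) (y : Fin n → unitInterval) :
    epochItem (G := G) p S y p.period = restItem (S.step G p y) := by
  simp [epochItem, Params.period, show ¬ 4 * p.L + 5 ≤ 2 * p.L + 2 by omega]

end epoch

end ClusterMR

/-! ### Bounds on the words and on the number of items at a key -/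

namespace Trie

-- The bounds on words use nothing else about the intermediate values of an all-reduce.
open Classical in
theorem valAt_eq_sum {α : Type} [Fintype α] (g ident : α → ℕ) (B : ℕ) {M : Type} [AddCommMonoid M]
    (w : α → M) (L s : ℕ) (a : α) : ∃ F : Finset α, valAt g ident B w L s a = ∑ b ∈ F, w b := by
  unfold valAt upVal downVal total
  split_ifs
  exacts [⟨_, rfl⟩, ⟨∅, rfl⟩, ⟨_, rfl⟩, ⟨∅, rfl⟩]

end Trie

namespace ClusterMR

open MapReduce

section bounds

variable {n : ℕ} {G : SimpleGraph (Fin n)} (p : Params)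

/-- The numbers in a control state are small. -/
structure Glob.Small (gl : Glob) (n : ℕ) : Prop where
  act : gl.act ≤ 4
  unc : gl.unc ≤ n
  rad : gl.rad ≤ n
  iter : gl.iter ≤ n + 1
  left : gl.left ≤ 2 * n
  -- An iteration of `CLUSTER` lowers `unc` by at least one, so the sum does not increase; it bounds
  -- `iter`, hence the word length.
  cluster : gl.act = 1 ∨ gl.act = 2 → gl.iter + gl.unc ≤ n + 1
  loop : gl.act = 3 ∨ gl.act = 4 → gl.iter ≤ Nat.clog 2 n

/-- The numbers in a state are small. -/
structure NState.Small (S : NState n) : Prop where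
  own : ∀ u, S.own u ≤ n ^ 2 + n
  glob : S.glob.Small n

theorem depth_le {c : ℕ} (hn : 0 < n) (h : c ≤ n ^ 2 + n) : depth n c ≤ n := by
  unfold depth
  refine Nat.lt_succ_iff.1 ((Nat.div_lt_iff_lt_mul hn).2 ?_)
  have : (n + 1) * n = n ^ 2 + n := by ring
  rw [Nat.succ_eq_add_one, this]
  have : 0 < n ^ 2 + n := by positivity
  omega

/-- The cap on the depth in `bump` serves this bound, which needs no assumption on the graph. On a
connected graph it is never active in `CLUSTER`, where depths are distances. -/
theorem bump_le {c : ℕ} (hn : 0 < n) (h : c ≤ n ^ 2 + n) : bump n c ≤ n ^ 2 + n := by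
  unfold bump
  split_ifs with h0 h1
  · exact Nat.zero_le _
  · unfold depth at h1
    have := (Nat.div_lt_iff_lt_mul hn).1 h1
    rw [sq]
    omega
  · exact h

theorem NState.Small.start_le {S : NState n} (h : S.Small) (u : Fin n) :
    S.start u ≤ n ^ 2 + n := by
  unfold NState.start base
  split_ifs
  · exact Nat.zero_le _
  · exact h.own u

theorem NState.Small.prop_le {S : NState n} (h : S.Small) (hpn : p.n = n)
    (y : Fin n → unitInterval) (u v : Fin n) : S.prop p y u v ≤ n ^ 2 + n := by
  have hu := u.is_lt
  have h2 : u < n ^ 2 + n := by nlinarith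
  unfold NState.prop
  split_ifs
  · omega
  · exact Nat.zero_le _
  · rw [hpn]; exact bump_le u.pos (h.own v)

theorem NState.Small.after_le {S : NState n} (h : S.Small) (hpn : p.n = n)
    (y : Fin n → unitInterval) (u : Fin n) : S.after G p y u ≤ n ^ 2 + n := by
  unfold NState.after
  split_ifs
  · exact Finset.sup_le fun v _ => h.prop_le p hpn y u v
  · exact h.start_le u

theorem stats_cnt_le (own : Fin n → ℕ) : (stats p own).cnt ≤ n :=
  (Finset.card_filter_le _ _).trans (Finset.card_fin n).le

theorem stats_top_le (hpn : p.n = n) (own : Fin n → ℕ) (h : ∀ u, own u ≤ n ^ 2 + n) :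
    (stats p own).top ≤ n := by
  change (Finset.univ.sup fun u => depth p.n (own u)) ≤ n
  rw [hpn]
  exact Finset.sup_le fun u _ => depth_le u.pos (h u)

theorem threshold_pos (hn : 2 ≤ p.n) (hτ : 0 < p.τ) : 0 < 8 * (p.τ : ℝ) * Real.logb 2 p.n := by
  have : 0 < Real.logb 2 (p.n : ℝ) := Real.logb_pos one_lt_two (by exact_mod_cast hn)
  positivity

theorem clog_two_pos (hn : 2 ≤ n) : 1 ≤ Nat.clog 2 n := Nat.clog_pos one_lt_two hn

theorem clog_two_le (n : ℕ) : Nat.clog 2 n ≤ n :=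
  Nat.clog_le_of_le_pow (Nat.lt_two_pow_self).le

theorem Glob.Small.next {gl : Glob} (h : gl.Small n) (hpn : p.n = n) (hn : 2 ≤ n) (hτ : 0 < p.τ)
    {a : Agg} (hc : a.cnt ≤ n) (ht : a.top ≤ n) : (p.next gl a).Small n := by
  have hthr := threshold_pos p (hpn ▸ hn) hτ
  have hK := clog_two_pos hn
  have hKn := clog_two_le n
  -- If the while loop continues, some node is uncovered, as the threshold is positive. Halving then
  -- strictly lowers the count, which makes room for the increase of `iter`.
  have hpos : ¬ ((a.cnt : ℝ) < 8 * (p.τ : ℝ) * Real.logb 2 p.n) → 1 ≤ a.cnt := by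
    intro h'
    by_contra h0
    have h0' : a.cnt = 0 := by omega
    rw [h0'] at h'
    exact h' (by exact_mod_cast hthr)
  obtain ⟨act, unc, rad, iter, left⟩ := gl
  obtain ⟨h1, h2, h3, h4, h5, h6, h7⟩ := h
  unfold Params.next
  rw [hpn] at *
  simp only at h1 h2 h3 h4 h5 h6 h7 ⊢
  split_ifs with c1 c2 c3 c4 c5 c6 c7 c8
  · exact ⟨by simp, h2, ht, by simp, by simp, by simp, fun _ => hK⟩
  · exact ⟨by simp, h2, by simp, h4, by simp, by simp, by simp⟩
  · have := hpos c3
    have := h6 c1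
    exact ⟨by simp, hc, by simp, by simp only; omega, by simp, fun _ => by simp only; omega,
      by simp⟩
  · exact ⟨by simp, h2, by simp, h4, by simp, fun _ => h6 c1, by simp⟩
  · exact ⟨by simp, h2, h3, h4, by simp only; omega, by simp, fun _ => h7 (Or.inl c5)⟩
  · exact ⟨by simp, h2, h3, h4, by simp, by simp, by simp⟩
  · have := h7 (Or.inr c6)
    exact ⟨by simp, h2, h3, by simp only; omega, by simp, by simp, fun _ => by simp only; omega⟩
  · exact ⟨by simp, h2, h3, h4, by simp only; omega, by simp, fun _ => h7 (Or.inr c6)⟩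
  · exact ⟨h1, h2, h3, h4, h5, h6, h7⟩

theorem NState.Small.step {S : NState n} (h : S.Small) (hpn : p.n = n) (hn : 2 ≤ n) (hτ : 0 < p.τ)
    (y : Fin n → unitInterval) : (S.step G p y).Small :=
  ⟨fun u => h.after_le (G := G) p hpn y u,
    h.glob.next p hpn hn hτ (stats_cnt_le p _)
      (stats_top_le p hpn _ fun u => h.after_le (G := G) p hpn y u)⟩

theorem small_first (hpn : p.n = n) : p.first.Small n := by
  unfold Params.first
  rw [hpn]
  split_ifs
  · exact ⟨by simp, le_rfl, by simp, by simp, by simp, by simp, by simp⟩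
  · exact ⟨by simp, le_rfl, by simp, by simp, by simp, fun _ => by simp only; omega, by simp⟩

theorem small_run (hpn : p.n = n) (hn : 2 ≤ n) (hτ : 0 < p.τ) (y : ℕ × Fin n → unitInterval)
    (e : ℕ) : (run G p y e).Small := by
  induction e with
  | zero => exact ⟨fun u => Nat.zero_le _, small_first p hpn⟩
  | succ e ih => exact ih.step p hpn hn hτ _

/-- Items made of small words. -/
def FewBits (x : Item) (n : ℕ) : Prop := ∀ w ∈ x.enc, w ≤ 4 * n ^ 2

theorem NState.Small.fewBits_restItem {S : NState n} (h : S.Small) (a : Arc G) :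
    FewBits (restItem S a) n := by
  have h1 := a.1.1.is_lt
  have h2 := a.1.2.is_lt
  have h3 := h.own a.1.1
  have := h.glob.act
  have := h.glob.unc
  have := h.glob.rad
  have := h.glob.iter
  have := h.glob.left
  have h4 : n ≤ n ^ 2 := Nat.le_self_pow two_ne_zero n
  intro w hw
  simp only [Item.enc, restItem, Agg.zero_cnt, Agg.zero_top, List.mem_cons, List.not_mem_nil, or_false] at hw
  omega

theorem NState.Small.fewBits_redItem {S : NState n} (h : S.Small) (hL : p.L ≤ n ^ 2) (all : Bool)
    (own : Fin n → ℕ) (hown : ∀ u, own u ≤ n ^ 2 + n) (w : Arc G → Agg)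
    (hw : ∀ F : Finset (Arc G), (∑ b ∈ F, w b).cnt ≤ n ∧ (∑ b ∈ F, w b).top ≤ n ^ 2 + n)
    (s : ℕ) (a : Arc G) : FewBits (redItem p all own S.glob w s a) n := by
  have h1 := a.1.1.is_lt
  have h2 := a.1.2.is_lt
  have h3 := hown a.1.1
  have := h.glob.act
  have := h.glob.unc
  have := h.glob.rad
  have := h.glob.iter
  have := h.glob.left
  have h4 : n ≤ n ^ 2 := Nat.le_self_pow two_ne_zero n
  obtain ⟨F, hF⟩ := Trie.valAt_eq_sum (grp all) ident p.B w p.L s a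
  have h5 := hw F
  rw [← hF] at h5
  have h6 : Trie.levAt (grp all) ident p.B p.L s a ≤ p.L := by
    rw [levAt_eq]
    refine (Trie.pos_le _ _).trans ?_
    unfold height
    split_ifs <;> omega
  intro w hw
  simp only [Item.enc, redItem, List.mem_cons, List.not_mem_nil, or_false] at hw
  omega

theorem sum_offer_le {S : NState n} (h : S.Small) (hpn : p.n = n) (y : Fin n → unitInterval)
    (F : Finset (Arc G)) :
    (∑ b ∈ F, S.offer p y b).cnt ≤ n ∧ (∑ b ∈ F, S.offer p y b).top ≤ n ^ 2 + n := by
  rw [Agg.sum_cnt, Agg.sum_top]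
  constructor
  · simp [NState.offer]
  · exact Finset.sup_le fun b _ => h.prop_le p hpn y _ _

theorem sum_share_le (hpn : p.n = n) (own : Fin n → ℕ) (hown : ∀ u, own u ≤ n ^ 2 + n)
    (F : Finset (Arc G)) :
    (∑ b ∈ F, share p own b).cnt ≤ n ∧ (∑ b ∈ F, share p own b).top ≤ n ^ 2 + n := by
  by_cases hF : F.Nonempty
  · obtain ⟨a, -⟩ := hF
    have htot := total_share p own a
    have h1 := stats_cnt_le p own
    have h2 := stats_top_le p hpn own hown
    rw [← htot, Trie.total] at h1 h2
    rw [Agg.sum_cnt] at h1 ⊢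
    rw [Agg.sum_top] at h2 ⊢
    refine ⟨le_trans ?_ h1, le_trans ?_ (h2.trans (Nat.le_add_left _ _))⟩
    · refine Finset.sum_le_sum_of_subset fun b hb => ?_
      simp [grp]
    · refine Finset.sup_mono fun b hb => ?_
      simp [grp]
  · rw [Finset.not_nonempty_iff_eq_empty.1 hF]
    exact ⟨Nat.zero_le _, Nat.zero_le _⟩

theorem NState.Small.fewBits_epochItem {S : NState n} (h : S.Small) (hpn : p.n = n) (hn : 2 ≤ n)
    (hτ : 0 < p.τ) (hL : p.L ≤ n ^ 2) (y : Fin n → unitInterval) (j : ℕ) (a : Arc G) :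
    FewBits (epochItem p S y j a) n := by
  unfold epochItem
  split_ifs
  · exact h.fewBits_restItem a
  · exact h.fewBits_redItem p hL _ _ h.start_le _ (sum_offer_le p h hpn y) _ a
  · have hfin := fun u => h.after_le (G := G) p hpn y u
    exact h.fewBits_redItem p hL _ _ hfin _ (sum_share_le p hpn _ hfin) _ a
  · exact (h.step p hpn hn hτ y).fewBits_restItem a

theorem key_le (ph : Phase) (hpn : p.n = n) {x : Item} {a : Arc G} (hu : x.u = a.1.1)
    (hv : x.v = a.1.2) (hx : FewBits x n) : ∀ w ∈ p.key ph x, w ≤ 4 * n ^ 2 := by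
  have h1 := a.1.1.is_lt
  have h2 := a.1.2.is_lt
  have h3 : x.lev ≤ 4 * n ^ 2 := hx _ (by simp [Item.enc])
  have h4 : n ≤ n ^ 2 := Nat.le_self_pow two_ne_zero n
  have h5 : (x.u * p.n + x.v) / p.B ^ (x.lev + 1) ≤ n ^ 2 := by
    refine (Nat.div_le_self _ _).trans ?_
    rw [hu, hv, hpn]
    exact (ident_lt a).le
  intro w hw
  unfold Params.key at hw
  split at hw
  · simp only [List.mem_cons, List.not_mem_nil, or_false] at hw
    split_ifs at hw <;> omega
  · simp only [List.mem_cons, List.not_mem_nil, or_false] at hw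
    omega

theorem epochItem_u (S : NState n) (y : Fin n → unitInterval) (j : ℕ) (a : Arc G) :
    (epochItem p S y j a).u = a.1.1 := by
  unfold epochItem; split_ifs <;> rfl

theorem epochItem_v (S : NState n) (y : Fin n → unitInterval) (j : ℕ) (a : Arc G) :
    (epochItem p S y j a).v = a.1.2 := by
  unfold epochItem; split_ifs <;> rfl

theorem card_meets_le_of_edgeKey {T : Arc G → Item} {ph : Phase} (a : Arc G)
    (h : ∀ b, p.key ph (T b) = edgeKey b) : (meets p ph T a).card ≤ 2 := by
  classical
  refine (Finset.card_le_card (t := {a, flip a}) fun b hb => ?_).trans Finset.card_le_two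
  have hb' := (Finset.mem_filter.1 hb).2
  rw [h, h] at hb'
  simpa using edgeKey_eq hb'

/-- In the exchange and in the two local rounds the key is that of an edge, shared by at most two
items; in an all-reduce those who meet are mates. -/
theorem card_meets_le (hpn : p.n = n) (hB : 2 ≤ p.B) (S : NState n) (y : Fin n → unitInterval)
    (j : ℕ) (a : Arc G) :
    (meets p (p.phase j) (epochItem p S y j) a).card ≤ p.B := by
  have hkey : ∀ ph, (∀ x, p.key ph x = [min x.u x.v, max x.u x.v]) →
      (meets p ph (epochItem p S y j) a).card ≤ p.B := fun ph hph =>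
    (card_meets_le_of_edgeKey p a fun b => by
      rw [hph, epochItem_u, epochItem_v]; rfl).trans hB
  unfold Params.phase
  split_ifs with h0 h1 h2 h3
  · exact hkey _ fun x => rfl
  · rw [epochItem, if_neg h0, if_pos (by omega), meets_redItem p _ _ _ _ _ _ hpn]
    exact Trie.card_mates_le (by omega) ident_injective _ _
  · exact hkey _ fun x => rfl
  · rw [epochItem, if_neg h0, if_neg (by omega), if_pos (by omega),
      meets_redItem p _ _ _ _ _ _ hpn]
    exact Trie.card_mates_le (by omega) ident_injective _ _
  · exact hkey _ fun x => rfl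

end bounds

end ClusterMR

/-! ### The configurations of the MR algorithm -/

namespace ClusterMR

open MapReduce

section config

variable {n : ℕ} (G : SimpleGraph (Fin n)) (p : Params)

open Classical in
/-- The edges, directed upwards. -/
noncomputable def upArcs : Finset (Fin n × Fin n) :=
  Finset.univ.filter fun e => e.1 < e.2 ∧ G.Adj e.1 e.2

theorem mem_upArcs {e : Fin n × Fin n} : e ∈ upArcs G ↔ e.1 < e.2 ∧ G.Adj e.1 e.2 := by
  simp [upArcs]

/-- This matches items with input pairs: the pair of a node gives one item, and that of an edge,
listed with the smaller end first, gives two. -/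
theorem arcs_eq : ((Finset.univ : Finset (Arc G)).val.map Subtype.val) =
    (Finset.univ : Finset (Fin n)).val.map (fun v => (v, v)) +
      ((upArcs G).val + (upArcs G).val.map Prod.swap) := by
  classical
  have hup : ∀ a, a ∈ (upArcs G).val ↔ a.1 < a.2 ∧ G.Adj a.1 a.2 := fun a => mem_upArcs G
  have hdown : ∀ a, a ∈ (upArcs G).val.map Prod.swap ↔ a.2 < a.1 ∧ G.Adj a.1 a.2 := by
    rintro ⟨u, v⟩
    simp only [Multiset.mem_map, hup, Prod.exists, Prod.swap_prod_mk, Prod.mk.injEq]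
    constructor
    · rintro ⟨a, b, ⟨h1, h2⟩, rfl, rfl⟩
      exact ⟨h1, h2.symm⟩
    · rintro ⟨h1, h2⟩
      exact ⟨v, u, ⟨h1, h2.symm⟩, rfl, rfl⟩
  refine (Multiset.Nodup.ext ?_ ?_).2 fun a => ?_
  · exact Finset.univ.nodup.map Subtype.val_injective
  · refine Multiset.nodup_add.2 ⟨?_, Multiset.nodup_add.2 ⟨(upArcs G).nodup,
      (upArcs G).nodup.map Prod.swap_injective, ?_⟩, ?_⟩
    · exact Finset.univ.nodup.map fun u v h => (Prod.mk.inj h).1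
    · refine Multiset.disjoint_left.2 fun h1 h2 => ?_
      exact absurd ((hup _).1 h1).1 (not_lt.2 ((hdown _).1 h2).1.le)
    · refine Multiset.disjoint_left.2 fun h1 h2 => ?_
      obtain ⟨v, -, rfl⟩ := Multiset.mem_map.1 h1
      rcases Multiset.mem_add.1 h2 with h | h
      · exact lt_irrefl _ ((hup _).1 h).1
      · exact lt_irrefl _ ((hdown _).1 h).1
  · rw [Multiset.mem_add, Multiset.mem_add, hup, hdown]
    simp only [Multiset.mem_map, Finset.mem_val, Finset.mem_univ, true_and, Subtype.exists,
      exists_prop, exists_eq_right]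
    obtain ⟨u, v⟩ := a
    simp only [Prod.mk.injEq]
    constructor
    · rintro (h | h)
      · exact Or.inl ⟨u, rfl, h⟩
      · rcases lt_trichotomy u v with h' | h' | h'
        · exact Or.inr (Or.inl ⟨h', h⟩)
        · exact Or.inl ⟨u, rfl, h'⟩
        · exact Or.inr (Or.inr ⟨h', h⟩)
    · rintro (⟨w, rfl, rfl⟩ | ⟨-, h⟩ | ⟨-, h⟩)
      exacts [Or.inl rfl, Or.inr h, Or.inr h]

theorem card_upArcs_le : (upArcs G).card ≤ G.edgeSet.ncard := by
  classical
  rw [← Set.ncard_coe_finset]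
  refine Set.ncard_le_ncard_of_injOn (fun e => s(e.1, e.2)) ?_ ?_ (Set.toFinite _)
  · intro e he
    exact ((mem_upArcs G).1 he).2
  · intro e he e' he' h
    have h1 := ((mem_upArcs G).1 he).1
    have h2 := ((mem_upArcs G).1 he').1
    rcases Sym2.eq_iff.1 h with ⟨h3, h4⟩ | ⟨h3, h4⟩
    · exact Prod.ext h3 h4
    · rw [h3, h4] at h1
      exact absurd h1 (not_lt.2 h2.le)

theorem card_arc_le : Fintype.card (Arc G) ≤ n + 2 * G.edgeSet.ncard := by
  have h := congrArg Multiset.card (arcs_eq G)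
  have h' := card_upArcs_le G
  rw [Multiset.card_map, Multiset.card_add, Multiset.card_add, Multiset.card_map,
    Multiset.card_map, Finset.card_val, Finset.card_val, Finset.card_val, Finset.card_univ,
    Finset.card_univ, Fintype.card_fin] at h
  change Fintype.card (Arc G) = _ at h
  omega

theorem graphInput_eq : graphInput G =
    (Finset.univ : Finset (Fin n)).val.map (fun v => ([v.val], [])) +
      (upArcs G).val.map (fun e => ([e.1.val, e.2.val], [])) := rfl

theorem card_graphInput_le : Multiset.card (graphInput G) ≤ n + G.edgeSet.ncard := by
  have h' := card_upArcs_le G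
  rw [graphInput_eq]
  simp only [Multiset.card_map, Multiset.card_add, Finset.card_val, Finset.card_univ,
    Fintype.card_fin]
  omega

theorem graphInput_words {q : KV} (hq : q ∈ graphInput G) :
    (∀ w ∈ q.1, w < n) ∧ q.2 = [] ∧ q.1.length ≤ 2 := by
  rw [graphInput_eq, Multiset.mem_add, Multiset.mem_map, Multiset.mem_map] at hq
  rcases hq with ⟨v, -, rfl⟩ | ⟨e, -, rfl⟩ <;> simp

theorem card_group_graphInput_le (k : List ℕ) : Multiset.card (group (graphInput G) k) ≤ 1 := by
  have hnd : ((graphInput G).map Prod.fst).Nodup := by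
    rw [graphInput_eq, Multiset.map_add, Multiset.map_map, Multiset.map_map]
    refine Multiset.nodup_add.2 ⟨?_, ?_, ?_⟩
    · refine Finset.univ.nodup.map fun u v h => ?_
      simpa [Fin.ext_iff] using h
    · refine (upArcs G).nodup.map fun u v h => ?_
      simpa [Fin.ext_iff, Prod.ext_iff] using h
    · refine Multiset.disjoint_left.2 fun h1 h2 => ?_
      obtain ⟨v, -, rfl⟩ := Multiset.mem_map.1 h1
      obtain ⟨e, -, h⟩ := Multiset.mem_map.1 h2
      simp at h
  have := Multiset.nodup_iff_count_le_one.1 hnd k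
  rw [Multiset.count_map] at this
  simpa only [group, eq_comm] using this

theorem size_pair_le (j : ℕ) (x : Item) :
    (p.pair j x).1.length + (p.pair j x).2.length + 1 ≤ 15 := by
  have : (p.key (p.phase j) x).length ≤ 3 := by
    unfold Params.key
    split <;> simp
  simp only [Params.pair, Item.enc, List.length_cons, List.length_nil]
  omega

theorem size_live_le (j : ℕ) (coin : Prop) (X : Multiset Item) (x : Item) :
    size (p.live j coin X x) ≤ 15 := by
  unfold Params.live
  split_ifs
  · simp [size]
  · have := size_pair_le p ((j + 1) % p.period) (p.step coin X x (p.phase j))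
    simpa [size] using this

theorem size_out_le (j : ℕ) (x : Item) : size (p.out j x) ≤ 3 := by
  unfold Params.out
  split_ifs <;> simp [size]

theorem size_create_le (k : List ℕ) : size (p.create k) ≤ 30 := by
  unfold Params.create
  split
  · have := size_pair_le p 0 (p.newItem ‹ℕ› ‹ℕ›)
    simp only [size, Multiset.map_singleton, Multiset.sum_singleton]
    omega
  · rename_i u v
    have := size_pair_le p 0 (p.newItem u v)
    have := size_pair_le p 0 (p.newItem v u)
    simp only [size, Multiset.insert_eq_cons, Multiset.map_cons, Multiset.map_singleton,
      Multiset.sum_cons, Multiset.sum_singleton]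
    omega
  · simp [size]

/-! ### The course of the computation on the items -/

variable (ω : ℕ × List ℕ → unitInterval)

/-- The coins of the nodes in the epochs. -/
def coins (n : ℕ) (q : ℕ × Fin n) : unitInterval :=
  ω (1 + q.1 * p.period, [(q.2 : ℕ), (q.2 : ℕ)])

/-- The state after `e` epochs. -/
noncomputable def stateAt (e : ℕ) : NState n := run G p (coins p ω n) e

/-- The items `t` rounds after they have been created. -/
noncomputable def itemAt (t : ℕ) : Arc G → Item :=
  epochItem p (stateAt G p ω (t / p.period)) (fun u => coins p ω n (t / p.period, u))
    (t % p.period)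

theorem period_pos : 0 < p.period := by unfold Params.period; omega

/-- Round `0` creates the items, whence the shift by one. Epoch `e` begins in round `1 + e *
p.period`, the round whose seeds `coins` reads. -/
theorem itemStep_itemAt (hpn : p.n = n) (hL : n ^ 2 ≤ p.B ^ p.L) (t : ℕ) :
    itemStep p (p.phase (t % p.period)) (fun k => ω (1 + t, k)) (itemAt G p ω t) =
      itemAt G p ω (t + 1) := by
  have hP := period_pos p
  have hdm := Nat.div_add_mod t p.period
  have hlt := Nat.mod_lt t hP
  unfold itemAt
  rw [itemStep_epochItem p _ _ _ hpn hL hlt]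
  · rcases Nat.lt_or_ge (t % p.period + 1) p.period with h | h
    · have h1 : (t + 1) / p.period = t / p.period := by
        rw [← hdm, add_assoc, Nat.mul_add_div hP, Nat.div_eq_of_lt h, Nat.mul_add_div hP,
          Nat.div_eq_of_lt hlt]
      have h2 : (t + 1) % p.period = t % p.period + 1 := by
        conv_lhs => rw [← hdm, add_assoc, Nat.mul_add_mod, Nat.mod_eq_of_lt h]
      rw [h1, h2]
    · have h0 : t + 1 = p.period * (t / p.period + 1) := by
        rw [mul_add]; omega
      have h1 : (t + 1) / p.period = t / p.period + 1 := by
        rw [h0, Nat.mul_div_cancel_left _ hP]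
      have h2 : (t + 1) % p.period = 0 := by rw [h0, Nat.mul_mod_right]
      have h3 : t % p.period + 1 = p.period := by omega
      rw [h1, h2, h3, epochItem_period, epochItem_zero]
      rfl
  · intro h0 u
    have : t = t / p.period * p.period := by rw [mul_comm]; omega
    simp only [coins]
    rw [← this]

/-- The live pairs `t` rounds after the items have been created. -/
noncomputable def liveAt (t : ℕ) : Multiset KV :=
  (Finset.univ : Finset (Arc G)).val.map fun a => p.pair (t % p.period) (itemAt G p ω t a)

theorem liveAt_zero : liveAt G p ω 0 =
    (Finset.univ : Finset (Arc G)).val.map fun a => p.pair 0 (p.newItem a.1.1 a.1.2) := by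
  unfold liveAt itemAt
  simp only [Nat.zero_mod, Nat.zero_div, epochItem_zero]
  rfl

theorem create_graphInput :
    ((graphInput G).bind fun q => p.create q.1) = liveAt G p ω 0 := by
  have h : liveAt G p ω 0 = ((Finset.univ : Finset (Arc G)).val.map Subtype.val).map
      fun a => p.pair 0 (p.newItem a.1 a.2) := by
    rw [liveAt_zero, Multiset.map_map]; rfl
  rw [h, arcs_eq, graphInput_eq, Multiset.add_bind, Multiset.bind_map, Multiset.bind_map,
    Multiset.map_add, Multiset.map_add, Multiset.map_map, Multiset.map_map]
  congr 1
  · rw [← Multiset.bind_singleton]; rfl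
  · rw [← Multiset.bind_singleton, ← Multiset.bind_singleton, ← Multiset.bind_add]
    rfl

open Classical in
theorem group_liveAt (t : ℕ) (k : List ℕ) :
    (group (liveAt G p ω t) k).map Prod.snd =
      (Finset.univ.filter fun b => p.key (p.phase (t % p.period)) (itemAt G p ω t b) = k).val.map
        fun b => (itemAt G p ω t b).enc := by
  unfold liveAt
  rw [group_map, Multiset.map_map]
  rfl

theorem dec_group_liveAt (t : ℕ) (a : Arc G) :
    ((group (liveAt G p ω t) (p.pair (t % p.period) (itemAt G p ω t a)).1).map Prod.snd).map
        Item.dec =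
      (meets p (p.phase (t % p.period)) (itemAt G p ω t) a).val.map (itemAt G p ω t) := by
  classical
  rw [group_liveAt, Multiset.map_map]
  simp only [Function.comp_def, Item.dec_enc, meets]
  rfl

theorem round_create (r : ℕ) (hr : r = 0) (s : Config) :
    p.algorithm.round ω r s = ⟨s.live.bind fun q => p.create q.1, s.out⟩ := by
  subst hr
  rw [Algorithm.round_eq _ _ _ _ (fun k _ _ => p.create k) (fun _ _ _ => 0)]
  · simp
  · intro k vals
    simp [Params.algorithm, Params.reduce]

/-- One round on the items. -/
theorem round_liveAt (t : ℕ) (out : Multiset KV) :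
    p.algorithm.round ω (1 + t) ⟨liveAt G p ω t, out⟩ =
      ⟨(Finset.univ : Finset (Arc G)).val.bind fun a =>
          p.live (t % p.period)
            (p.coin ((meets p (p.phase (t % p.period)) (itemAt G p ω t) a).val.map
              (itemAt G p ω t)) (ω (1 + t, p.key (p.phase (t % p.period)) (itemAt G p ω t a))))
            ((meets p (p.phase (t % p.period)) (itemAt G p ω t) a).val.map (itemAt G p ω t))
            (itemAt G p ω t a),
        out + (Finset.univ : Finset (Arc G)).val.bind fun a =>
          p.out (t % p.period) (itemAt G p ω t a)⟩ := by
  rw [Algorithm.round_eq _ _ _ _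
    (fun k vals l => p.live (t % p.period) (p.coin (vals.map Item.dec) (ω (1 + t, k)))
      (vals.map Item.dec) (Item.dec l))
    (fun k vals l => p.out (t % p.period) (Item.dec l))]
  · have hb : ∀ f : KV → Multiset KV, (liveAt G p ω t).bind f =
        (Finset.univ : Finset (Arc G)).val.bind fun a =>
          f (p.pair (t % p.period) (itemAt G p ω t a)) := fun f => Multiset.bind_map _ _ _
    simp only [hb, dec_group_liveAt]
    rfl
  · intro k vals
    simp [Params.algorithm, Params.reduce]

theorem itemAt_glob (e : ℕ) (a : Arc G) :
    itemAt G p ω (e * p.period) a = restItem (stateAt G p ω e) a := by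
  unfold itemAt
  rw [Nat.mul_div_cancel _ (period_pos p), Nat.mul_mod_left, epochItem_zero]

theorem not_stop_of_le {t : ℕ} (ht : ∀ e, (stateAt G p ω e).glob.act = 0 → t + 1 ≤ e * p.period)
    (a : Arc G) : ¬ (t % p.period = 0 ∧ (itemAt G p ω t a).glob.act = 0) := by
  rintro ⟨h1, h2⟩
  have h3 : t = t / p.period * p.period := by
    have := Nat.div_add_mod t p.period
    rw [mul_comm]; omega
  rw [h3, itemAt_glob] at h2
  have := ht _ h2
  omega

/-- Until the algorithm stops, the live pairs are the items. -/
theorem config_eq (hpn : p.n = n) (hL : n ^ 2 ≤ p.B ^ p.L) (t : ℕ)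
    (ht : ∀ e, (stateAt G p ω e).glob.act = 0 → t ≤ e * p.period) :
    p.algorithm.config ω (graphInput G) (1 + t) = ⟨liveAt G p ω t, 0⟩ := by
  induction t with
  | zero =>
    change p.algorithm.round ω 0 ⟨graphInput G, 0⟩ = _
    rw [round_create p ω 0 rfl]
    simp only [create_graphInput G p ω]
  | succ t ih =>
    change p.algorithm.round ω (1 + t) (p.algorithm.config ω (graphInput G) (1 + t)) = _
    rw [ih fun e he => (Nat.le_succ t).trans (ht e he), round_liveAt]
    have h1 := not_stop_of_le G p ω ht
    congr 1
    · rw [liveAt, ← itemStep_itemAt G p ω hpn hL, ← Multiset.bind_singleton]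
      refine Multiset.bind_congr fun a _ => ?_
      rw [Params.live, if_neg (h1 a)]
      simp only [itemStep, Nat.mod_add_mod]
    · rw [zero_add]
      have : ∀ a : Arc G, p.out (t % p.period) (itemAt G p ω t a) = 0 := by
        intro a
        rw [Params.out, if_neg]
        exact fun h => h1 a ⟨h.1, h.2.1⟩
      simp [this]

/-- The clustering that the states `own` stand for. -/
def centers (own : Fin n → ℕ) (u : Fin n) : Fin n :=
  if own u = 0 then u else ⟨(own u - 1) % n, Nat.mod_lt _ u.pos⟩

/-- When the algorithm stops, it outputs the clustering. -/
theorem config_stop (hpn : p.n = n) (hL : n ^ 2 ≤ p.B ^ p.L) (e : ℕ)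
    (he : (stateAt G p ω e).glob.act = 0)
    (hmin : ∀ e', (stateAt G p ω e').glob.act = 0 → e ≤ e') :
    p.algorithm.config ω (graphInput G) (e * p.period + 2) =
      ⟨0, clusteringOutput (centers (stateAt G p ω e).own)⟩ := by
  -- One round creates the items, `e` epochs follow, and in one more round the items see that the
  -- action is `0`, write the output and vanish.
  have h2 : e * p.period + 2 = (1 + e * p.period) + 1 := by omega
  rw [h2]
  change p.algorithm.round ω (1 + e * p.period)
    (p.algorithm.config ω (graphInput G) (1 + e * p.period)) = _
  rw [config_eq G p ω hpn hL _ fun e' he' => Nat.mul_le_mul_right _ (hmin e' he'), round_liveAt]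
  simp only [Nat.mul_mod_left, itemAt_glob]
  congr 1
  · have : ∀ a : Arc G, (restItem (stateAt G p ω e) a).glob.act = 0 := fun a => he
    simp [Params.live, this]
  · rw [zero_add]
    have hout : ∀ a : Arc G, p.out 0 (restItem (stateAt G p ω e) a) =
        (fun q : Fin n × Fin n => if q.1 = q.2 then
          {([q.1.val], [(centers (stateAt G p ω e).own q.1).val])} else (0 : Multiset KV)) a.1 := by
      intro a
      have hact : (restItem (stateAt G p ω e) a).glob.act = 0 := he
      simp only [Params.out, hact, true_and]
      simp only [restItem, Fin.ext_iff, centers, hpn]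
      split_ifs <;> rfl
    rw [Multiset.bind_congr fun a _ => hout a, ← Multiset.bind_map _ (fun q : Fin n × Fin n =>
        if q.1 = q.2 then {([q.1.val], [(centers (stateAt G p ω e).own q.1).val])}
        else (0 : Multiset KV)) Subtype.val, arcs_eq, Multiset.add_bind, Multiset.add_bind,
      Multiset.bind_map, Multiset.bind_map]
    -- Only the items `(u, u)` write output, so each node is reported once.
    have hz : ∀ q ∈ (upArcs G).val, ¬ q.1 = q.2 := fun q hq h => by
      have := ((mem_upArcs G).1 hq).1
      rw [h] at this
      exact lt_irrefl _ this
    have hz1 : ((upArcs G).val.bind fun q : Fin n × Fin n => if q.1 = q.2 then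
          {([q.1.val], [(centers (stateAt G p ω e).own q.1).val])} else (0 : Multiset KV)) = 0 := by
      rw [Multiset.bind_congr (g := fun _ => 0) fun q hq => if_neg (hz q hq), Multiset.bind_zero]
    have hz2 : ((upArcs G).val.bind fun q : Fin n × Fin n => if q.swap.1 = q.swap.2 then
          {([q.swap.1.val], [(centers (stateAt G p ω e).own q.swap.1).val])}
          else (0 : Multiset KV)) = 0 := by
      rw [Multiset.bind_congr (g := fun _ => 0) fun q hq => if_neg fun h => hz q hq h.symm,
        Multiset.bind_zero]
    rw [hz1, hz2, add_zero, add_zero, clusteringOutput, ← Multiset.bind_singleton]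
    simp

end config

end ClusterMR

/-! ### Memory and termination of the MR algorithm -/

namespace ClusterMR

open MapReduce

/-- The parameters suit graphs with `n` nodes. -/
structure Params.Suits (p : Params) (n : ℕ) : Prop where
  n_eq : p.n = n
  two_le : 2 ≤ n
  tau_pos : 0 < p.τ
  pow_height : n ^ 2 ≤ p.B ^ p.L
  height_le : p.L ≤ n ^ 2
  two_le_arity : 2 ≤ p.B

section memory

variable {n : ℕ} (G : SimpleGraph (Fin n)) (p : Params) (ω : ℕ × List ℕ → unitInterval)

theorem small_stateAt {p : Params} (hp : p.Suits n) (e : ℕ) : (stateAt G p ω e).Small :=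
  small_run p hp.n_eq hp.two_le hp.tau_pos _ e

/-- The exponent is far from tight; it is `200` because a single constant serves for the words and
for both memories. -/
theorem four_mul_sq_lt (hn : 2 ≤ n) : 4 * n ^ 2 < n ^ 200 := by
  calc 4 * n ^ 2 ≤ n ^ 2 * n ^ 2 := Nat.mul_le_mul_right _ (by nlinarith)
    _ = n ^ 4 := by ring
    _ < n ^ 200 := Nat.pow_lt_pow_right hn (by norm_num)

theorem wordsBelow_liveAt {p : Params} (hp : p.Suits n) (t : ℕ) :
    WordsBelow (n ^ 200) (liveAt G p ω t) := by
  intro q hq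
  obtain ⟨a, -, rfl⟩ := Multiset.mem_map.1 hq
  have hfew := (small_stateAt G ω hp (t / p.period)).fewBits_epochItem p hp.n_eq hp.two_le
    hp.tau_pos hp.height_le (fun u => coins p ω n (t / p.period, u)) (t % p.period) a
  have hlt := four_mul_sq_lt hp.two_le
  refine ⟨fun w hw => lt_of_le_of_lt ?_ hlt, fun w hw => lt_of_le_of_lt (hfew w hw) hlt⟩
  exact key_le p _ hp.n_eq (epochItem_u p _ _ _ a) (epochItem_v p _ _ _ a) hfew w hw

theorem wordsBelow_clusteringOutput (f : Fin n → Fin n) :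
    WordsBelow (n ^ 200) (clusteringOutput f) := by
  intro q hq
  obtain ⟨v, -, rfl⟩ := Multiset.mem_map.1 hq
  have h4 : n ≤ n ^ 200 := Nat.le_self_pow (by norm_num) n
  have h1 := v.is_lt
  have h2 := (f v).is_lt
  simp only [List.mem_singleton]
  refine ⟨?_, ?_⟩ <;> rintro w rfl <;> omega

theorem wordsBelow_graphInput : WordsBelow (n ^ 200) (graphInput G) := by
  intro q hq
  obtain ⟨h1, h2, -⟩ := graphInput_words G hq
  have h4 : n ≤ n ^ 200 := Nat.le_self_pow (by norm_num) n
  exact ⟨fun w hw => (h1 w hw).trans_le h4, fun w hw => by simp [h2] at hw⟩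

theorem wordsBelow_zero (B : ℕ) : WordsBelow B 0 := fun q hq => by simp at hq

theorem size_zero : size 0 = 0 := rfl

theorem size_liveAt_le (t : ℕ) : size (liveAt G p ω t) ≤ Fintype.card (Arc G) * 15 := by
  refine (size_le_of_forall (b := 15) fun q hq => ?_).trans (le_of_eq ?_)
  · obtain ⟨a, -, rfl⟩ := Multiset.mem_map.1 hq
    exact size_pair_le p _ _
  · rw [liveAt, Multiset.card_map]; rfl

theorem size_graphInput_le : size (graphInput G) ≤ (n + G.edgeSet.ncard) * 3 := by
  refine (size_le_of_forall (b := 3) fun q hq => ?_).trans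
    (Nat.mul_le_mul_right _ (card_graphInput_le G))
  obtain ⟨-, h2, h3⟩ := graphInput_words G hq
  rw [h2]
  simp only [List.length_nil]
  omega

theorem size_reduce_le (r : ℕ) (hr : r ≠ 0) (k : List ℕ) (vals : Multiset (List ℕ)) (coin : Prop) :
    size (p.reduce r k vals coin).1 ≤ Multiset.card vals * 15 ∧
      size (p.reduce r k vals coin).2 ≤ Multiset.card vals * 3 := by
  unfold Params.reduce
  rw [if_neg hr]
  exact ⟨size_bind_le fun l _ => size_live_le p _ _ _ _, size_bind_le fun l _ => size_out_le p _ _⟩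

theorem local_memory_liveAt {p : Params} (hp : p.Suits n) (t : ℕ) {k : List ℕ}
    (hk : k ∈ keys (liveAt G p ω t)) :
    size (group (liveAt G p ω t) k) +
        size (p.algorithm.reducerResult ω (1 + t) (liveAt G p ω t) k).1 +
        size (p.algorithm.reducerResult ω (1 + t) (liveAt G p ω t) k).2 ≤ 64 * p.B := by
  obtain ⟨q, hq, rfl⟩ := mem_keys.1 hk
  obtain ⟨a, -, rfl⟩ := Multiset.mem_map.1 hq
  set k := (p.pair (t % p.period) (itemAt G p ω t a)).1 with hkdef
  have hcard : Multiset.card ((group (liveAt G p ω t) k).map Prod.snd) ≤ p.B := by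
    have h := congrArg Multiset.card (dec_group_liveAt G p ω t a)
    rw [Multiset.card_map, Multiset.card_map (itemAt G p ω t)] at h
    rw [← hkdef] at h
    rw [h]
    exact card_meets_le p hp.n_eq hp.two_le_arity _ _ _ a
  have h1 : size (group (liveAt G p ω t) k) ≤ p.B * 15 := by
    rw [Multiset.card_map] at hcard
    refine (size_le_of_forall (b := 15) fun q hq => ?_).trans (Nat.mul_le_mul_right _ hcard)
    obtain ⟨b, -, rfl⟩ := Multiset.mem_map.1 (Multiset.mem_filter.1 hq).1
    exact size_pair_le p _ _
  have h2 := size_reduce_le p (1 + t) (by omega) k ((group (liveAt G p ω t) k).map Prod.snd)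
    (p.coin (((group (liveAt G p ω t) k).map Prod.snd).map Item.dec) (ω (1 + t, k)))
  have h3 : size (p.algorithm.reducerResult ω (1 + t) (liveAt G p ω t) k).1 ≤ p.B * 15 :=
    h2.1.trans (Nat.mul_le_mul_right _ hcard)
  have h4 : size (p.algorithm.reducerResult ω (1 + t) (liveAt G p ω t) k).2 ≤ p.B * 3 :=
    h2.2.trans (Nat.mul_le_mul_right _ hcard)
  omega

theorem local_memory_graphInput (k : List ℕ) :
    size (group (graphInput G) k) +
        size (p.algorithm.reducerResult ω 0 (graphInput G) k).1 +
        size (p.algorithm.reducerResult ω 0 (graphInput G) k).2 ≤ 64 := by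
  have hcard := card_group_graphInput_le G k
  have h1 : size (group (graphInput G) k) ≤ 1 * 3 := by
    refine (size_le_of_forall (b := 3) fun q hq => ?_).trans (Nat.mul_le_mul_right _ hcard)
    obtain ⟨-, h2, h3⟩ := graphInput_words G (Multiset.mem_filter.1 hq).1
    rw [h2]
    simp only [List.length_nil]
    omega
  have hcard' : Multiset.card ((group (graphInput G) k).map Prod.snd) ≤ 1 := by
    rwa [Multiset.card_map]
  have h2 : size (p.algorithm.reducerResult ω 0 (graphInput G) k).1 ≤ 1 * 30 :=
    (size_bind_le fun l _ => size_create_le p k).trans (Nat.mul_le_mul_right _ hcard')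
  have h3 : size (p.algorithm.reducerResult ω 0 (graphInput G) k).2 ≤ 1 * 0 :=
    (size_bind_le fun l _ => le_of_eq size_zero).trans (Nat.mul_le_mul_right _ hcard')
  omega

theorem global_memory_liveAt (t : ℕ) :
    size (liveAt G p ω t) + size (p.algorithm.round ω (1 + t) ⟨liveAt G p ω t, 0⟩).live +
      size (p.algorithm.round ω (1 + t) ⟨liveAt G p ω t, 0⟩).out ≤ Fintype.card (Arc G) * 33 := by
  have h1 := size_liveAt_le G p ω t
  rw [round_liveAt]
  have h2 : ∀ f : Arc G → Multiset KV, ∀ b, (∀ a, size (f a) ≤ b) →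
      size ((Finset.univ : Finset (Arc G)).val.bind f) ≤ Fintype.card (Arc G) * b :=
    fun f b h => size_bind_le fun a _ => h a
  have h3 := h2 _ 15 fun a => size_live_le p (t % p.period)
    (p.coin ((meets p (p.phase (t % p.period)) (itemAt G p ω t) a).val.map
      (itemAt G p ω t)) (ω (1 + t, p.key (p.phase (t % p.period)) (itemAt G p ω t a))))
    ((meets p (p.phase (t % p.period)) (itemAt G p ω t) a).val.map (itemAt G p ω t))
    (itemAt G p ω t a)
  have h4 := h2 _ 3 fun a => size_out_le p (t % p.period) (itemAt G p ω t a)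
  simp only [zero_add]
  omega

-- There are three regimes: the input, the items and, after stopping, the output alone. In the
-- second, a round handles at most `33` words per item (received, sent and output), and there are at
-- most `n + 2 * m ≤ 3 * m + 1` items; since `m ≥ 1`, this is below `200 * m`.
open Classical in
theorem fitsMemory {p : Params} (hp : p.Suits n) {MG ML : ℕ} (hML : 64 * p.B ≤ ML)
    (hMG : 200 * G.edgeSet.ncard ≤ MG) (hn : n ≤ G.edgeSet.ncard + 1) :
    p.algorithm.FitsMemory (n ^ 200) MG ML ω (graphInput G) := by
  have hcard := card_arc_le G
  have hB := hp.two_le_arity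
  have := hp.two_le
  have hlive : ∀ t, (∀ e, (stateAt G p ω e).glob.act = 0 → t ≤ e * p.period) →
      WordsBelow (n ^ 200) (p.algorithm.config ω (graphInput G) (1 + t)).live ∧
      WordsBelow (n ^ 200) (p.algorithm.config ω (graphInput G) (1 + t)).out ∧
      (∀ k ∈ keys (p.algorithm.config ω (graphInput G) (1 + t)).live,
        size (group (p.algorithm.config ω (graphInput G) (1 + t)).live k) +
          size (p.algorithm.reducerResult ω (1 + t)
            (p.algorithm.config ω (graphInput G) (1 + t)).live k).1 +
          size (p.algorithm.reducerResult ω (1 + t)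
            (p.algorithm.config ω (graphInput G) (1 + t)).live k).2 ≤ ML) ∧
      size (p.algorithm.config ω (graphInput G) (1 + t)).live +
        size (p.algorithm.config ω (graphInput G) (1 + t + 1)).live +
        size (p.algorithm.config ω (graphInput G) (1 + t + 1)).out ≤ MG := by
    intro t ht
    have hc := config_eq G p ω hp.n_eq hp.pow_height t ht
    have hc' : p.algorithm.config ω (graphInput G) (1 + t + 1) =
        p.algorithm.round ω (1 + t) ⟨liveAt G p ω t, 0⟩ := by rw [← hc]; rfl
    rw [hc', hc]
    refine ⟨wordsBelow_liveAt G ω hp t, wordsBelow_zero _, fun k hk => ?_, ?_⟩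
    · exact (local_memory_liveAt G ω hp t hk).trans hML
    · have := global_memory_liveAt G p ω t
      dsimp only
      omega
  intro t
  rcases Nat.eq_zero_or_pos t with rfl | htpos
  · have hc : p.algorithm.config ω (graphInput G) 0 = ⟨graphInput G, 0⟩ := rfl
    have hc' := config_eq G p ω hp.n_eq hp.pow_height 0 fun e _ => Nat.zero_le _
    rw [show (0 : ℕ) + 1 = 1 + 0 from rfl, hc', hc]
    refine ⟨wordsBelow_graphInput G, wordsBelow_zero _, fun k _ => ?_, ?_⟩
    · have := local_memory_graphInput G p ω k
      dsimp only
      omega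
    · have h1 := size_graphInput_le G
      have h2 := size_liveAt_le G p ω 0
      change size (graphInput G) + size (liveAt G p ω 0) + 0 ≤ MG
      omega
  · obtain ⟨s, rfl⟩ : ∃ s, t = 1 + s := ⟨t - 1, by omega⟩
    by_cases hs : ∀ e, (stateAt G p ω e).glob.act = 0 → s ≤ e * p.period
    · exact hlive s hs
    · push Not at hs
      have hex : ∃ e, (stateAt G p ω e).glob.act = 0 := ⟨hs.choose, hs.choose_spec.1⟩
      obtain ⟨e', he', hlt⟩ := hs
      have hfin := config_stop G p ω hp.n_eq hp.pow_height (Nat.find hex) (Nat.find_spec hex)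
        fun e'' h => Nat.find_min' hex h
      have hle : Nat.find hex * p.period + 2 ≤ 1 + s := by
        have := Nat.mul_le_mul_right p.period (Nat.find_min' hex he')
        omega
      have hc := Algorithm.config_of_live_eq_zero (by rw [hfin]) hle
      have hc' := Algorithm.config_of_live_eq_zero (by rw [hfin])
        (hle.trans (Nat.le_succ (1 + s)))
      rw [hfin] at hc hc'
      rw [hc', hc]
      refine ⟨wordsBelow_zero _, wordsBelow_clusteringOutput _, fun k hk => ?_, ?_⟩
      · simp [keys] at hk
      · have : size (clusteringOutput (centers (stateAt G p ω (Nat.find hex)).own)) ≤ n * 3 := by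
          refine (size_le_of_forall (b := 3) fun q hq => ?_).trans (le_of_eq ?_)
          · obtain ⟨v, -, rfl⟩ := Multiset.mem_map.1 hq
            simp
          · simp [clusteringOutput]
        simp only [size_zero]
        omega

theorem live_ne_zero (hn : 0 < n) (t : ℕ) : liveAt G p ω t ≠ 0 := by
  intro h
  have h1 := congrArg Multiset.card h
  rw [liveAt, Multiset.card_map, Multiset.card_zero, Finset.card_val, Finset.card_eq_zero] at h1
  have : nodeArc (G := G) ⟨0, hn⟩ ∈ (Finset.univ : Finset (Arc G)) := Finset.mem_univ _
  rw [h1] at this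
  simp at this

theorem live_config_ne_zero {p : Params} (hp : p.Suits n) {t : ℕ}
    (ht : ∀ e, (stateAt G p ω e).glob.act = 0 → t < e * p.period + 2) :
    (p.algorithm.config ω (graphInput G) t).live ≠ 0 := by
  have hn : 0 < n := lt_of_lt_of_le two_pos hp.two_le
  rcases Nat.eq_zero_or_pos t with rfl | htpos
  · change graphInput G ≠ 0
    rw [graphInput_eq]
    intro h
    have := congrArg Multiset.card h
    simp at this
    omega
  · obtain ⟨s, rfl⟩ : ∃ s, t = 1 + s := ⟨t - 1, by omega⟩
    rw [config_eq G p ω hp.n_eq hp.pow_height s fun e he => by have := ht e he; omega]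
    exact live_ne_zero G p ω hn s

/-- The algorithm halts as soon as the control state says so. -/
theorem haltsAfter_of_stop {p : Params} (hp : p.Suits n) (e : ℕ)
    (he : (stateAt G p ω e).glob.act = 0)
    (hmin : ∀ e', (stateAt G p ω e').glob.act = 0 → e ≤ e') :
    p.algorithm.HaltsAfter ω (graphInput G) (e * p.period + 2) := by
  refine ⟨by rw [config_stop G p ω hp.n_eq hp.pow_height e he hmin], fun t ht => ?_⟩
  refine live_config_ne_zero G ω hp fun e' he' => ?_
  have := Nat.mul_le_mul_right p.period (hmin e' he')
  omega

theorem not_haltsAfter {p : Params} (hp : p.Suits n)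
    (h : ∀ e, (stateAt G p ω e).glob.act ≠ 0) (T : ℕ) :
    ¬ p.algorithm.HaltsAfter ω (graphInput G) T := fun hT =>
  live_config_ne_zero G ω hp (fun e he => absurd he (h e)) hT.1

end memory

end ClusterMR

/-! ### What the node states stand for -/

namespace ClusterMR

open GraphClustering

section clustering

variable {n : ℕ} {G : SimpleGraph (Fin n)} {p : Params}

/-- The partial clustering that the states `own` stand for. -/
def part (own : Fin n → ℕ) : PartialClustering (Fin n) :=
  fun v => if own v = 0 then none else some (centers own v)

theorem part_eq_none {own : Fin n → ℕ} {v : Fin n} : part own v = none ↔ own v = 0 := by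
  unfold part; split_ifs with h <;> simp [h]

theorem part_eq_some {own : Fin n → ℕ} {v z : Fin n} :
    part own v = some z ↔ own v ≠ 0 ∧ centers own v = z := by
  unfold part; split_ifs with h <;> simp [h]

theorem part_getD (own : Fin n → ℕ) (v : Fin n) : (part own v).getD v = centers own v := by
  unfold part centers; split_ifs with h <;> simp

theorem part_of_eq_zero {own : Fin n → ℕ} (h : ∀ v, own v = 0) : part own = noClusters (Fin n) :=
  funext fun v => part_eq_none.2 (h v)

theorem card_uncovered_part (own : Fin n → ℕ) : (uncovered (part own)).card = (stats p own).cnt := by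
  unfold uncovered stats
  simp only [part_eq_none]

/-- The state of a new center. -/
theorem centers_self {own : Fin n → ℕ} {u : Fin n} (h : own u = (u : ℕ) + 1) :
    centers own u = u := by
  unfold centers
  rw [if_neg (by omega)]
  apply Fin.ext
  simp [h, Nat.mod_eq_of_lt u.is_lt]

theorem centers_eq_of_mod {own own' : Fin n → ℕ} {u v : Fin n} (hu : own u ≠ 0) (hv : own' v ≠ 0)
    (h : (own u - 1) % n = (own' v - 1) % n) : centers own u = centers own' v := by
  unfold centers
  rw [if_neg hu, if_neg hv]
  exact Fin.ext h

theorem bump_eq_zero {c : ℕ} : bump n c = 0 ↔ c = 0 := by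
  unfold bump
  split_ifs <;> omega

theorem bump_sub_one_mod (c : ℕ) (hc : c ≠ 0) : (bump n c - 1) % n = (c - 1) % n := by
  unfold bump
  rw [if_neg hc]
  split_ifs
  · rw [show c + n - 1 = c - 1 + n by omega, Nat.add_mod_right]
  · rfl

theorem depth_bump {c : ℕ} (hn : 0 < n) (hc : c ≠ 0) (h : depth n c < n) :
    depth n (bump n c) = depth n c + 1 := by
  unfold bump
  rw [if_neg hc, if_pos h]
  unfold depth
  rw [show c + n - 1 = c - 1 + n by omega, Nat.add_div_right _ hn]

/-! #### The selection of centers -/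

open Classical in
theorem after_of_select {S : NState n} (h : S.glob.act = 1 ∨ S.glob.act = 3)
    (y : Fin n → unitInterval) (u : Fin n) :
    S.after G p y u = if S.start u = 0 then (if (y u : ℝ) ≤ p.thr S.glob then (u : ℕ) + 1 else 0)
      else S.start u := by
  unfold NState.after
  by_cases h0 : S.start u = 0
  · rw [if_pos h0, if_pos h0]
    apply le_antisymm
    · refine Finset.sup_le fun v _ => ?_
      unfold NState.prop
      rw [if_pos h]
      by_cases hv : u = v ∧ S.start u = 0 ∧ (y u : ℝ) ≤ p.thr S.glob
      · rw [if_pos hv, if_pos hv.2.2]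
      · rw [if_neg hv]; exact Nat.zero_le _
    · refine le_trans (le_of_eq ?_) (Finset.le_sup (b := u) (by simp))
      simp [NState.prop, h, h0]
  · rw [if_neg h0, if_neg h0]

theorem part_after_of_select {S : NState n} (h : S.glob.act = 1 ∨ S.glob.act = 3)
    (y : Fin n → unitInterval) :
    part (S.after G p y) = selectCenters (part S.start) y (p.thr S.glob) := by
  classical
  funext u
  unfold selectCenters
  have hs := after_of_select (G := G) (p := p) h y u
  by_cases h0 : S.start u = 0
  · rw [if_pos h0] at hs
    by_cases hy : (y u : ℝ) ≤ p.thr S.glob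
    · rw [if_pos hy] at hs
      rw [if_pos ⟨part_eq_none.2 h0, hy⟩]
      exact part_eq_some.2 ⟨by omega, centers_self hs⟩
    · rw [if_neg hy] at hs
      rw [if_neg fun h => hy h.2, part_eq_none.2 hs, part_eq_none.2 h0]
  · rw [if_neg h0] at hs
    rw [if_neg fun h => h0 (part_eq_none.1 h.1)]
    unfold part
    rw [hs, if_neg h0, if_neg h0]
    exact congrArg some (centers_eq_of_mod (hs ▸ h0) h0 (by rw [hs]))

/-! #### The growing steps -/

theorem start_of_ne {S : NState n} (h : S.glob.act ≠ 3) : S.start = S.own := by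
  funext u
  simp [NState.start, base, h]

/-- In a growing step, covered nodes keep their state, and uncovered nodes with covered neighbors
get theirs from one of these. -/
theorem after_of_grow {S : NState n} (h1 : S.glob.act ≠ 1) (h3 : S.glob.act ≠ 3)
    (y : Fin n → unitInterval) (u : Fin n) :
    (S.own u ≠ 0 → S.after G p y u = S.own u) ∧
      (S.own u = 0 →
        (∃ v, G.Adj u v ∧ S.own v ≠ 0 ∧ S.after G p y u = bump p.n (S.own v)) ∨
        ((∀ v, G.Adj u v → S.own v = 0) ∧ S.after G p y u = 0)) := by
  classical
  have hst : S.start u = S.own u := by rw [start_of_ne h3]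
  have hprop : S.prop p y u = fun v => bump p.n (S.own v) := by
    funext v
    simp [NState.prop, h1, h3]
  unfold NState.after
  rw [hst, hprop]
  refine ⟨fun h => if_neg h, fun h => ?_⟩
  rw [if_pos h]
  by_cases hv : ∀ v, G.Adj u v → S.own v = 0
  · refine Or.inr ⟨hv, Nat.le_zero.1 (Finset.sup_le fun v hv' => ?_)⟩
    rcases (Finset.mem_filter.1 hv').2 with rfl | h'
    · simp [bump, h]
    · simp [bump, hv v h']
  · left
    push Not at hv
    obtain ⟨v₀, hv₀, hv₀'⟩ := hv
    -- The largest proposal settles the arbitrary choice. It is positive because `v₀` proposes a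
    -- nonzero state, so it comes from a covered node, which cannot be `u` itself.
    obtain ⟨v, hv, hsup⟩ := Finset.exists_mem_eq_sup
      (Finset.univ.filter fun v => u = v ∨ G.Adj u v) ⟨u, by simp⟩ fun v => bump p.n (S.own v)
    have hpos : bump p.n (S.own v₀) ≤
        (Finset.univ.filter fun v => u = v ∨ G.Adj u v).sup fun v => bump p.n (S.own v) :=
      Finset.le_sup (f := fun v => bump p.n (S.own v))
        (Finset.mem_filter.2 ⟨Finset.mem_univ _, Or.inr hv₀⟩)
    have hne : bump p.n (S.own v₀) ≠ 0 := fun h => hv₀' (bump_eq_zero.1 h)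
    have hv0 : S.own v ≠ 0 := fun h0 => by
      rw [hsup, bump_eq_zero.2 h0] at hpos
      omega
    refine ⟨v, ?_, hv0, hsup⟩
    rcases (Finset.mem_filter.1 hv).2 with rfl | h'
    · exact absurd h hv0
    · exact h'

theorem growStep_of_grow (hpn : p.n = n) {S : NState n} (h1 : S.glob.act ≠ 1)
    (h3 : S.glob.act ≠ 3) (y : Fin n → unitInterval) :
    GrowStep G (part S.own) (part (S.after G p y)) := by
  intro v
  obtain ⟨hc, hu⟩ := after_of_grow (G := G) (p := p) h1 h3 y v
  constructor
  · intro z hz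
    obtain ⟨h0, hz⟩ := part_eq_some.1 hz
    have hs := hc h0
    refine part_eq_some.2 ⟨hs ▸ h0, ?_⟩
    rw [← hz]
    exact centers_eq_of_mod (hs ▸ h0) h0 (by rw [hs])
  · intro h
    rcases hu (part_eq_none.1 h) with ⟨w, hw, hw0, hs⟩ | ⟨hw, hs⟩
    · have hs0 : S.after G p y v ≠ 0 := by
        rw [hs]; exact fun h => hw0 (bump_eq_zero.1 h)
      refine Or.inl ⟨w, centers S.own w, hw.symm, part_eq_some.2 ⟨hw0, rfl⟩,
        part_eq_some.2 ⟨hs0, centers_eq_of_mod hs0 hw0 ?_⟩⟩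
      rw [hs, hpn]
      exact bump_sub_one_mod _ hw0
    · exact Or.inr ⟨fun u hu => part_eq_none.2 (hw u hu.symm), part_eq_none.2 hs⟩

theorem after_ne_zero_of_grow {S : NState n} (h1 : S.glob.act ≠ 1) (h3 : S.glob.act ≠ 3)
    (y : Fin n → unitInterval) {u : Fin n} (hu : S.own u ≠ 0) : S.after G p y u ≠ 0 := by
  rw [(after_of_grow h1 h3 y u).1 hu]; exact hu

theorem after_ne_zero_of_select {S : NState n} (h1 : S.glob.act = 1)
    (y : Fin n → unitInterval) {u : Fin n} (hu : S.own u ≠ 0) : S.after G p y u ≠ 0 := by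
  have h3 : S.glob.act ≠ 3 := by omega
  rw [after_of_select (Or.inl h1), start_of_ne h3, if_neg hu]; exact hu

theorem stats_cnt_le_of_imp {own own' : Fin n → ℕ} (h : ∀ u, own u ≠ 0 → own' u ≠ 0) :
    (stats p own').cnt ≤ (stats p own).cnt := by
  change (Finset.univ.filter fun u => own' u = 0).card ≤ (Finset.univ.filter fun u => own u = 0).card
  refine Finset.card_le_card fun u hu => ?_
  simp only [Finset.mem_filter, Finset.mem_univ, true_and] at hu ⊢
  by_contra h0
  exact h u h0 hu

theorem stats_cnt_lt_of_imp {own own' : Fin n → ℕ} (h : ∀ u, own u ≠ 0 → own' u ≠ 0)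
    {v : Fin n} (hv : own v = 0) (hv' : own' v ≠ 0) :
    (stats p own').cnt < (stats p own).cnt := by
  change (Finset.univ.filter fun u => own' u = 0).card < (Finset.univ.filter fun u => own u = 0).card
  refine Finset.card_lt_card ⟨fun u hu => ?_, fun hsub => ?_⟩
  · simp only [Finset.mem_filter, Finset.mem_univ, true_and] at hu ⊢
    by_contra h0
    exact h u h0 hu
  · have := hsub (Finset.mem_filter.2 ⟨Finset.mem_univ v, hv⟩)
    exact hv' (Finset.mem_filter.1 this).2

/-- If some but not all nodes are covered, then growing covers another one. -/
theorem stats_cnt_lt_of_grow (hG : G.Connected) {S : NState n} (h1 : S.glob.act ≠ 1)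
    (h3 : S.glob.act ≠ 3) (y : Fin n → unitInterval) {u v : Fin n} (hu : S.own u ≠ 0)
    (hv : S.own v = 0) : (stats p (S.after G p y)).cnt < (stats p S.own).cnt := by
  obtain ⟨w⟩ := hG.preconnected u v
  obtain ⟨d, -, hd1, hd2⟩ := w.exists_boundary_dart {x | S.own x ≠ 0} hu fun h => h hv
  have hd2' : S.own d.snd = 0 := not_not.1 hd2
  refine stats_cnt_lt_of_imp (fun x hx => after_ne_zero_of_grow h1 h3 y hx) hd2' ?_
  rcases (after_of_grow (G := G) (p := p) h1 h3 y d.snd).2 hd2' with ⟨x, -, hx0, hs⟩ | ⟨hx, -⟩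
  · rw [hs]; exact fun h => hx0 (bump_eq_zero.1 h)
  · exact absurd (hx d.fst d.adj.symm) hd1

/-! #### Depths and distances -/

/-- The depths are the distances to the centers, and the balls around the centers that reach out to
a node of the cluster are covered. -/
def ExactDepths (G : SimpleGraph (Fin n)) (own : Fin n → ℕ) : Prop :=
  ∀ v, own v ≠ 0 → depth n (own v) = G.dist (centers own v) v ∧
    ∀ w, G.dist (centers own v) w ≤ G.dist (centers own v) v → own w ≠ 0

theorem dist_lt_of_connected (hG : G.Connected) (u v : Fin n) : G.dist u v < n := by
  obtain ⟨w, hw, hl⟩ := hG.exists_path_of_dist u v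
  have := hw.length_lt
  rw [Fintype.card_fin] at this
  omega

theorem exists_adj_of_dist_eq_succ (hG : G.Connected) {z x : Fin n} {d : ℕ}
    (h : G.dist z x = d + 1) : ∃ y, G.Adj x y ∧ G.dist z y ≤ d := by
  obtain ⟨w, hw⟩ := hG.exists_walk_length_eq_dist x z
  rw [G.dist_comm, h] at hw
  cases w with
  | nil => simp at hw
  | cons hadj w' =>
    refine ⟨_, hadj, ?_⟩
    rw [SimpleGraph.Walk.length_cons] at hw
    rw [G.dist_comm]
    exact (SimpleGraph.dist_le w').trans (by omega)

theorem exactDepths_zero {own : Fin n → ℕ} (h : ∀ v, own v = 0) : ExactDepths G own :=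
  fun v hv => absurd (h v) hv

/-- A new center has depth `0`, and its ball of radius `0` consists of itself. Covering more nodes
does not harm the older balls. -/
theorem ExactDepths.select (hG : G.Connected) {S : NState n} (h1 : S.glob.act = 1)
    (h : ExactDepths G S.own) (y : Fin n → unitInterval) : ExactDepths G (S.after G p y) := by
  have h3 : S.glob.act ≠ 3 := by omega
  intro v hv
  have hs := after_of_select (G := G) (p := p) (Or.inl h1) y v
  rw [start_of_ne h3] at hs
  by_cases h0 : S.own v = 0
  · rw [if_pos h0] at hs
    split_ifs at hs with hy
    · have hc : centers (S.after G p y) v = v := centers_self hs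
      rw [hc, hs]
      refine ⟨?_, fun w hw => ?_⟩
      · simp [depth, Nat.div_eq_of_lt v.is_lt]
      · rw [SimpleGraph.dist_self, Nat.le_zero, hG.dist_eq_zero_iff] at hw
        rwa [← hw]
    · exact absurd hs hv
  · rw [if_neg h0] at hs
    have hc : centers (S.after G p y) v = centers S.own v :=
      centers_eq_of_mod hv h0 (by rw [hs])
    rw [hc, hs]
    exact ⟨(h v h0).1, fun w hw => after_ne_zero_of_select h1 y ((h v h0).2 w hw)⟩

/-- Let `v` join the cluster of its neighbor `w` with center `z`. The ball around `z` through `w`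
was covered and `v` was not, so `v` is farther from `z` than `w`, hence farther by exactly one.
Every node of the ball through `v` lies in the old ball or next to it, so it is covered after the
step. -/
theorem ExactDepths.grow (hG : G.Connected) (hpn : p.n = n) {S : NState n} (h1 : S.glob.act ≠ 1)
    (h3 : S.glob.act ≠ 3) (h : ExactDepths G S.own) (y : Fin n → unitInterval) :
    ExactDepths G (S.after G p y) := by
  intro v hv
  have hstep := fun x => after_of_grow (G := G) (p := p) h1 h3 y x
  by_cases h0 : S.own v = 0
  · rcases (hstep v).2 h0 with ⟨w, hw, hw0, hs⟩ | ⟨-, hs⟩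
    · obtain ⟨hd, hball⟩ := h w hw0
      have hc : centers (S.after G p y) v = centers S.own w := by
        refine centers_eq_of_mod hv hw0 ?_
        rw [hs, hpn]
        exact bump_sub_one_mod _ hw0
      set z := centers S.own w with hz
      have hlt := dist_lt_of_connected hG z w
      have hfar : ¬ G.dist z v ≤ G.dist z w := fun hle => hball v hle h0
      have hnear : G.dist z v ≤ G.dist z w + 1 :=
        (hG.dist_triangle (v := w)).trans
          (Nat.add_le_add_left (SimpleGraph.dist_eq_one_iff_adj.2 hw.symm).le _)
      rw [hc, hs, hpn, depth_bump v.pos hw0 (by omega)]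
      refine ⟨by omega, fun x hx => ?_⟩
      by_cases hx' : G.dist z x ≤ G.dist z w
      · exact after_ne_zero_of_grow h1 h3 y (hball x hx')
      · obtain ⟨t, ht, htd⟩ := exists_adj_of_dist_eq_succ hG
          (show G.dist z x = G.dist z w + 1 by omega)
        by_cases hx0 : S.own x = 0
        · rcases (hstep x).2 hx0 with ⟨t', -, ht', hs'⟩ | ⟨hn, -⟩
          · rw [hs']; exact fun h => ht' (bump_eq_zero.1 h)
          · exact absurd (hn t ht) (hball t htd)
        · exact after_ne_zero_of_grow h1 h3 y hx0
    · exact absurd hs hv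
  · have hs := (hstep v).1 h0
    have hc : centers (S.after G p y) v = centers S.own v :=
      centers_eq_of_mod hv h0 (by rw [hs])
    rw [hc, hs]
    exact ⟨(h v h0).1, fun w hw => after_ne_zero_of_grow h1 h3 y ((h v h0).2 w hw)⟩

theorem ExactDepths.stats_top (hpn : p.n = n) {own : Fin n → ℕ} (h : ExactDepths G own) :
    (stats p own).top = maxRadius G (centers own) := by
  change (Finset.univ.sup fun v => depth p.n (own v)) =
    Finset.univ.sup fun v => G.dist (centers own v) v
  refine Finset.sup_congr rfl fun v _ => ?_
  rw [hpn]
  by_cases h0 : own v = 0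
  -- An uncovered node counts as its own center, and `depth n 0 = 0` by truncated subtraction.
  · simp [h0, centers, depth]
  · exact (h v h0).1

end clustering

end ClusterMR

/-! ### The computation on the level of nodes follows the clustering algorithms -/

namespace ClusterMR

open GraphClustering

section trace

variable {n : ℕ} {G : SimpleGraph (Fin n)} {p : Params} (y : ℕ × Fin n → unitInterval)

theorem run_succ_own (e : ℕ) :
    (run G p y (e + 1)).own = (run G p y e).after G p fun v => y (e, v) := rfl

theorem run_succ_glob (e : ℕ) :
    (run G p y (e + 1)).glob = p.next (run G p y e).glob (stats p (run G p y (e + 1)).own) := rfl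

theorem halfCovered_def (c₀ c : PartialClustering (Fin n)) : HalfCovered c₀ c ↔
    ((uncovered c₀).card : ℝ) / 2 ≤ ((uncovered c₀ \ uncovered c).card : ℝ) := by
  unfold HalfCovered
  congr!

/-- By `h` the nodes still uncovered are among the old ones, so at least half are newly covered if
and only if at most half remain. This is the integer test that the control state makes. -/
theorem halfCovered_iff {c₀ : PartialClustering (Fin n)} {own : Fin n → ℕ}
    (h : ∀ v, own v = 0 → c₀ v = none) :
    HalfCovered c₀ (part own) ↔ 2 * (stats p own).cnt ≤ (uncovered c₀).card := by
  have hsub : uncovered (part own) ⊆ uncovered c₀ := by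
    intro v hv
    simp only [uncovered, Finset.mem_filter, Finset.mem_univ, true_and, part_eq_none] at hv ⊢
    exact h v hv
  have hle := Finset.card_le_card hsub
  rw [halfCovered_def, Finset.card_sdiff_of_subset hsub, Nat.cast_sub hle, ← card_uncovered_part (p := p),
    div_le_iff₀ two_pos]
  constructor
  · intro h'
    have : (2 * ((uncovered (part own)).card : ℝ)) ≤ (uncovered c₀).card := by linarith
    exact_mod_cast this
  · intro h'
    have : (2 * ((uncovered (part own)).card : ℝ)) ≤ (uncovered c₀).card := by exact_mod_cast h'
    linarith

theorem next_of_not_half {U i : ℕ} {a : Agg} (h : ¬ 2 * a.cnt ≤ U) :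
    p.next ⟨2, U, 0, i, 0⟩ a = ⟨2, U, 0, i, 0⟩ := by
  simp [Params.next, h]

theorem exists_own_eq_zero {own : Fin n → ℕ} (h : (stats p own).cnt ≠ 0) : ∃ v, own v = 0 := by
  by_contra hne
  push Not at hne
  refine h ?_
  change (Finset.univ.filter fun v => own v = 0).card = 0
  exact (Finset.card_eq_zero.2 (Finset.filter_eq_empty_iff.2 fun v _ => hne v))

/-- Growing until half of the nodes are covered. -/
theorem growUntil_of_run (hpn : p.n = n) (hG : G.Connected) (c₀ : PartialClustering (Fin n))
    (i k e : ℕ) (hk : (stats p (run G p y e).own).cnt = k)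
    (hgl : (run G p y e).glob =
      p.next ⟨2, (uncovered c₀).card, 0, i, 0⟩ (stats p (run G p y e).own))
    (hc₀ : ∀ v, (run G p y e).own v = 0 → c₀ v = none) (hd : ExactDepths G (run G p y e).own)
    (hcov : ∃ u, (run G p y e).own u ≠ 0) :
    ∃ s, GrowUntil G (HalfCovered c₀) s (part (run G p y e).own) (part (run G p y (e + s)).own) ∧
      (run G p y (e + s)).glob =
        p.next ⟨2, (uncovered c₀).card, 0, i, 0⟩ (stats p (run G p y (e + s)).own) ∧
      2 * (stats p (run G p y (e + s)).own).cnt ≤ (uncovered c₀).card ∧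
      ExactDepths G (run G p y (e + s)).own ∧ (∃ u, (run G p y (e + s)).own u ≠ 0) ∧
      (stats p (run G p y (e + s)).own).cnt + s ≤ (stats p (run G p y e).own).cnt ∧
      ∀ e', e ≤ e' → e' < e + s → (run G p y e').glob.act ≠ 0 := by
  -- The number of uncovered nodes drops in each growing step, by connectivity and `hcov`.
  -- Describing the control state as a successor of a growing state fits the epoch after a selection
  -- as well, because `Params.next` treats actions `1` and `2` alike.
  induction k using Nat.strong_induction_on generalizing e with
  | _ k ih =>
    by_cases hhalf : 2 * (stats p (run G p y e).own).cnt ≤ (uncovered c₀).card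
    · exact ⟨0, .done ((halfCovered_iff hc₀).2 hhalf), hgl, hhalf, hd, hcov, le_rfl,
        fun e' h1 h2 => by omega⟩
    · rw [next_of_not_half hhalf] at hgl
      have h1 : (run G p y e).glob.act ≠ 1 := by rw [hgl]; simp
      have h3 : (run G p y e).glob.act ≠ 3 := by rw [hgl]; simp
      obtain ⟨u, hu⟩ := hcov
      obtain ⟨v, hv⟩ := exists_own_eq_zero (p := p) (own := (run G p y e).own) (by omega)
      have hlt := stats_cnt_lt_of_grow (p := p) hG h1 h3 (fun v => y (e, v)) hu hv
      rw [← run_succ_own] at hlt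
      have hmono : ∀ x, (run G p y e).own x ≠ 0 → (run G p y (e + 1)).own x ≠ 0 := fun x hx =>
        after_ne_zero_of_grow h1 h3 _ hx
      obtain ⟨s, hs1, hs2, hs3, hs4, hs5, hs6, hs7⟩ := ih _ (hk ▸ hlt) (e + 1) rfl
        (by rw [run_succ_glob, hgl])
        (fun x hx => hc₀ x (by by_contra h0; exact hmono x h0 hx))
        (hd.grow hG hpn h1 h3 _) ⟨u, hmono u hu⟩
      have he : e + 1 + s = e + (s + 1) := by omega
      rw [he] at hs1 hs2 hs3 hs4 hs5 hs6 hs7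
      refine ⟨s + 1, .step (fun h => hhalf ((halfCovered_iff hc₀).1 h))
        (growStep_of_grow hpn h1 h3 _) hs1, hs2, hs3, hs4, hs5, by omega, fun e' h1 h2 => ?_⟩
      rcases Nat.eq_or_lt_of_le h1 with rfl | h
      · rw [hgl]; simp
      · exact hs7 e' h h2

/-- The while loop of `CLUSTER`. -/
theorem clusterLoop_of_run (hp : p.Suits n) (hG : G.Connected) (x : ℕ × Fin n → unitInterval)
    (hx : ∀ e < 2 * n, (run G p y e).glob.act = 1 →
      ∀ v, x ((run G p y e).glob.iter, v) = y (e, v))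
    (k e i : ℕ) (hk : (stats p (run G p y e).own).cnt = k)
    (hgl : (run G p y e).glob = ⟨1, k, 0, i, 0⟩)
    (hbig : ¬ (k : ℝ) < 8 * p.τ * Real.logb 2 p.n)
    (hd : ExactDepths G (run G p y e).own) (hcov : ∃ u, (run G p y (e + 1)).own u ≠ 0)
    (hle : e + 2 * k ≤ 2 * n) :
    ∃ E R, ClusterLoop G p.τ x i (part (run G p y e).own) R (part (run G p y E).own) ∧
      E ≤ e + 2 * R ∧ E ≤ 2 * n ∧ ExactDepths G (run G p y E).own ∧
      (∃ U i', (run G p y E).glob = p.next ⟨2, U, 0, i', 0⟩ (stats p (run G p y E).own) ∧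
        2 * (stats p (run G p y E).own).cnt ≤ U) ∧
      ((stats p (run G p y E).own).cnt : ℝ) < 8 * p.τ * Real.logb 2 p.n ∧
      ∀ e', e ≤ e' → e' < E → (run G p y e').glob.act ≠ 0 := by
  have hpn := hp.n_eq
  induction k using Nat.strong_induction_on generalizing e i with
  | _ k ih =>
    have hthr := threshold_pos p (hpn ▸ hp.two_le) hp.tau_pos
    have hkpos : 1 ≤ k := by
      by_contra h0
      have : k = 0 := by omega
      rw [this] at hbig
      exact hbig (by exact_mod_cast hthr)
    have h1 : (run G p y e).glob.act = 1 := by rw [hgl]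
    have h3 : (run G p y e).glob.act ≠ 3 := by rw [hgl]; simp
    have hunc : (uncovered (part (run G p y e).own)).card = k := by
      rw [card_uncovered_part (p := p), hk]
    have hsel : selectCenters (part (run G p y e).own) (fun v => x (i, v))
        (4 * p.τ * Real.logb 2 (Fintype.card (Fin n)) / (uncovered (part (run G p y e).own)).card) =
        part (run G p y (e + 1)).own := by
      rw [run_succ_own, part_after_of_select (Or.inl h1), start_of_ne h3, hunc]
      have hx' : (fun v => x (i, v)) = fun v => y (e, v) := by
        funext v
        have := hx e (by omega) h1 v
        rwa [hgl] at this
      rw [hx', Params.thr, if_pos h1, hgl, Fintype.card_fin, hpn]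
    have hmono : ∀ x, (run G p y e).own x ≠ 0 → (run G p y (e + 1)).own x ≠ 0 := fun x hx =>
      after_ne_zero_of_select h1 _ hx
    have hmono' := stats_cnt_le_of_imp (p := p) hmono
    have hgl1 : (run G p y (e + 1)).glob =
        p.next ⟨2, (uncovered (part (run G p y e).own)).card, 0, i, 0⟩
          (stats p (run G p y (e + 1)).own) := by
      rw [run_succ_glob, hgl, hunc]
      rfl
    obtain ⟨s, hs1, hs2, hs3, hs4, hs5, hs6, hs7⟩ := growUntil_of_run y hpn hG
      (part (run G p y e).own) i _ (e + 1) rfl hgl1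
      (fun v hv => part_eq_none.2 (by by_contra h0; exact hmono v h0 hv))
      (hd.select hG h1 _) hcov
    rw [hunc] at hs2 hs3
    rw [← hsel] at hs1
    have hbig' : 8 * p.τ * Real.logb 2 (Fintype.card (Fin n)) ≤
        ((uncovered (part (run G p y e).own)).card : ℝ) := by
      rw [hunc, Fintype.card_fin, ← hpn]
      exact not_lt.1 hbig
    have hact : ∀ e', e ≤ e' → e' < e + 1 + s → (run G p y e').glob.act ≠ 0 := by
      intro e' h h'
      rcases Nat.eq_or_lt_of_le h with rfl | h
      · rw [h1]; simp
      · exact hs7 e' h h'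
    by_cases hend : ((stats p (run G p y (e + 1 + s)).own).cnt : ℝ) < 8 * p.τ * Real.logb 2 p.n
    · refine ⟨e + 1 + s, max 1 s + 0, .iterate hbig' hs1 (.finish ?_), by omega, by omega, hs4,
        ⟨k, i, hs2, hs3⟩, hend, hact⟩
      rw [card_uncovered_part (p := p), Fintype.card_fin]
      simpa only [hpn] using hend
    · have hgl2 : (run G p y (e + 1 + s)).glob =
          ⟨1, (stats p (run G p y (e + 1 + s)).own).cnt, 0, i + 1, 0⟩ := by
        rw [hs2]
        simp [Params.next, hs3, hend]
      have h1' : (run G p y (e + 1 + s)).glob.act = 1 := by rw [hgl2]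
      obtain ⟨u, hu⟩ := hs5
      -- With `k'` nodes left, the iteration took `1 + s` epochs, where `s ≤ k - k'` and `k' < k`.
      -- Hence `1 + s ≤ 2 * (k - k')`, which keeps within the budget `e + 2 * k ≤ 2 * n`; and `1 + s
      -- ≤ 2 * max 1 s` gives the bound by `R`.
      obtain ⟨E, R, hE1, hE2, hE3, hE4, hE5, hE6, hE7⟩ := ih _ (by omega) (e + 1 + s) (i + 1) rfl
        hgl2 hend hs4 ⟨u, after_ne_zero_of_select h1' _ hu⟩ (by omega)
      refine ⟨E, max 1 s + R, .iterate hbig' hs1 hE1, by omega, hE3, hE4, hE5, hE6,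
        fun e' h h' => ?_⟩
      rcases Nat.lt_or_ge e' (e + 1 + s) with hlt | hge
      · exact hact e' h hlt
      · exact hE7 e' hge h'

/-- If no node becomes a center in the first iteration, nothing will ever be covered. -/
theorem run_of_no_center (hpn : p.n = n) (hbig : ¬ (n : ℝ) < 8 * p.τ * Real.logb 2 p.n)
    (hno : ∀ u, ¬ (y (0, u) : ℝ) ≤ p.thr p.first) (hn : 0 < n) (e : ℕ) :
    (∀ u, (run G p y e).own u = 0) ∧
      (run G p y e).glob = ⟨if e = 0 then 1 else 2, n, 0, 1, 0⟩ := by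
  have hfirst : p.first = ⟨1, n, 0, 1, 0⟩ := by
    rw [Params.first, hpn, if_neg (by rwa [hpn] at hbig)]
  have hgl0 : (run G p y 0).glob = ⟨1, n, 0, 1, 0⟩ := hfirst
  induction e with
  | zero => exact ⟨fun u => rfl, hgl0⟩
  | succ e ih =>
    obtain ⟨h0, hgl⟩ := ih
    have hzero : ∀ u, (run G p y (e + 1)).own u = 0 := by
      intro u
      rw [run_succ_own]
      by_cases he : e = 0
      · subst he
        rw [after_of_select (Or.inl (by rw [hgl0])), start_of_ne (by rw [hgl0]; simp),
          if_pos (h0 u), if_neg]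
        rw [hgl0, ← hfirst]
        exact hno u
      · rw [if_neg he] at hgl
        rcases (after_of_grow (G := G) (p := p) (S := run G p y e) (by rw [hgl]; simp)
          (by rw [hgl]; simp) (fun v => y (e, v)) u).2 (h0 u) with ⟨v, -, hv, -⟩ | ⟨-, h⟩
        · exact absurd (h0 v) hv
        · exact h
    refine ⟨hzero, ?_⟩
    have hcnt : (stats p (run G p y (e + 1)).own).cnt = n := by
      simp [stats, hzero]
    have hhalf : ¬ 2 * n ≤ n := by omega
    rw [run_succ_glob, hgl]
    unfold Params.next
    rw [hcnt]
    by_cases he : e = 0 <;> simp [hhalf, he]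

/-- Without clusters a growing step changes nothing, and the goal is not reached since `n > 0`. So
the growth could never end. -/
theorem not_growUntil_noClusters (hn : 0 < n) {s : ℕ} {c c' : PartialClustering (Fin n)}
    (h : GrowUntil G (HalfCovered (noClusters (Fin n))) s c c') : c ≠ noClusters (Fin n) := by
  induction h with
  | @done c hdone =>
    rintro rfl
    have hcard : (uncovered (noClusters (Fin n))).card = n := by
      simp [uncovered, noClusters]
    rw [halfCovered_def, Finset.sdiff_self, hcard, Finset.card_empty, Nat.cast_zero] at hdone
    have : (0 : ℝ) < n := by exact_mod_cast hn
    linarith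
  | @step s c c₁ c' _ hgrow _ ih =>
    rintro rfl
    refine ih (funext fun v => ?_)
    rcases (hgrow v).2 rfl with ⟨u, z, -, hz, -⟩ | ⟨-, h⟩
    · simp [noClusters] at hz
    · exact h

/-- If no node becomes a center in the first iteration, `CLUSTER` does not terminate. -/
theorem not_clusterRun (hn : 0 < n) {τ : ℕ} {x : ℕ × Fin n → unitInterval}
    (hbig : ¬ (n : ℝ) < 8 * τ * Real.logb 2 n)
    (hno : ∀ u, ¬ (x (1, u) : ℝ) ≤ 4 * τ * Real.logb 2 n / n) (f : Fin n → Fin n) (R : ℕ) :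
    ¬ ClusterRun G τ x f R := by
  rintro ⟨c, hc, -⟩
  have hcard : (uncovered (noClusters (Fin n))).card = n := by
    simp [uncovered, noClusters]
  cases hc with
  | finish h =>
    rw [hcard, Fintype.card_fin] at h
    exact hbig h
  | iterate h hgrow _ =>
    refine not_growUntil_noClusters hn hgrow (funext fun v => ?_)
    unfold selectCenters
    rw [hcard, Fintype.card_fin, if_neg fun h => hno v h.2]

/-! #### The for loop of `CLUSTER2` -/

theorem growFor_of_run (hpn : p.n = n) (U r i s e : ℕ)
    (hgl : (run G p y e).glob = ⟨4, U, r, i, s + 1⟩) :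
    GrowFor G (s + 1) (part (run G p y e).own) (part (run G p y (e + (s + 1))).own) ∧
      (run G p y (e + (s + 1))).glob =
        (if i = Nat.clog 2 n then ⟨0, U, r, i, 0⟩ else ⟨3, U, r, i + 1, 0⟩) ∧
      ∀ e', e ≤ e' → e' < e + (s + 1) → (run G p y e').glob.act ≠ 0 := by
  induction s generalizing e with
  | zero =>
    have hstep := growStep_of_grow (G := G) (p := p) hpn (S := run G p y e) (by rw [hgl]; simp)
      (by rw [hgl]; simp) fun v => y (e, v)
    refine ⟨.step hstep (.zero _), ?_, fun e' h1 h2 => ?_⟩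
    · rw [zero_add, run_succ_glob, hgl]
      simp [Params.next, hpn]
    · have : e' = e := by omega
      rw [this, hgl]; simp
  | succ s ih =>
    have hstep := growStep_of_grow (G := G) (p := p) hpn (S := run G p y e) (by rw [hgl]; simp)
      (by rw [hgl]; simp) fun v => y (e, v)
    have hgl' : (run G p y (e + 1)).glob = ⟨4, U, r, i, s + 1⟩ := by
      rw [run_succ_glob, hgl]
      simp [Params.next]
    obtain ⟨h1, h2, h3⟩ := ih (e + 1) hgl'
    have he : e + 1 + (s + 1) = e + (s + 1 + 1) := by omega
    rw [he] at h1 h2 h3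
    refine ⟨.step hstep h1, h2, fun e' h4 h5 => ?_⟩
    rcases Nat.eq_or_lt_of_le h4 with rfl | h
    · rw [hgl]; simp
    · exact h3 e' h h5

/-- One epoch selects and `2 * r` epochs grow. The condition `0 < r` matters: after a selection the
control state always has at least one growing step done. -/
theorem cluster2Loop_step_of_run (hpn : p.n = n) (x : ℕ × Fin n → unitInterval) (U r i e : ℕ)
    (hr : 0 < r) (hgl : (run G p y e).glob = ⟨3, U, r, i + 1, 0⟩)
    (hx : ∀ v, x (i + 1, v) = y (e, v))
    (hloop : Cluster2Loop G r x i (part (run G p y e).start)) :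
    Cluster2Loop G r x (i + 1) (part (run G p y (e + (2 * r + 1))).own) ∧
      (run G p y (e + (2 * r + 1))).glob =
        (if i + 1 = Nat.clog 2 n then ⟨0, U, r, i + 1, 0⟩ else ⟨3, U, r, i + 1 + 1, 0⟩) ∧
      ∀ e', e ≤ e' → e' < e + (2 * r + 1) → (run G p y e').glob.act ≠ 0 := by
  have h3 : (run G p y e).glob.act = 3 := by rw [hgl]
  have hsel : selectCenters (part (run G p y e).start) (fun v => x (i + 1, v))
      (2 ^ (i + 1) / (Fintype.card (Fin n) : ℝ)) = part (run G p y (e + 1)).own := by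
    rw [run_succ_own, part_after_of_select (Or.inr h3)]
    have hx' : (fun v => x (i + 1, v)) = fun v => y (e, v) := funext hx
    rw [hx', Params.thr, if_neg (by omega), hgl, Fintype.card_fin, hpn]
  have hgl' : (run G p y (e + 1)).glob = ⟨4, U, r, i + 1, (2 * r - 1) + 1⟩ := by
    rw [run_succ_glob, hgl, Nat.sub_add_cancel (by omega)]
    simp [Params.next]
  obtain ⟨g1, g2, g3⟩ := growFor_of_run y hpn U r (i + 1) (2 * r - 1) (e + 1) hgl'
  rw [Nat.sub_add_cancel (by omega)] at g1 g2 g3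
  have he : e + 1 + 2 * r = e + (2 * r + 1) := by omega
  rw [he] at g1 g2 g3
  rw [← hsel] at g1
  refine ⟨.iterate hloop g1, g2, fun e' h4 h5 => ?_⟩
  rcases Nat.eq_or_lt_of_le h4 with rfl | h
  · rw [hgl]; simp
  · exact g3 e' h h5

theorem cluster2Loop_of_run (hpn : p.n = n) (x : ℕ × Fin n → unitInterval) (U r E : ℕ)
    (hr : 0 < r) (hgl : (run G p y E).glob = ⟨3, U, r, 1, 0⟩) (hK : 1 ≤ Nat.clog 2 n)
    (hx : ∀ e < E + Nat.clog 2 n * (2 * r + 1), (run G p y e).glob.act = 3 →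
      ∀ v, x ((run G p y e).glob.iter, v) = y (e, v)) :
    Cluster2Loop G r x (Nat.clog 2 n)
        (part (run G p y (E + Nat.clog 2 n * (2 * r + 1))).own) ∧
      (run G p y (E + Nat.clog 2 n * (2 * r + 1))).glob.act = 0 ∧
      ∀ e', E ≤ e' → e' < E + Nat.clog 2 n * (2 * r + 1) → (run G p y e').glob.act ≠ 0 := by
  -- The invariant at the beginning of an iteration concerns `start`, not `own`: in the first
  -- iteration the states of `CLUSTER` are still stored, but `base` discards them.
  have key : ∀ j < Nat.clog 2 n, (run G p y (E + j * (2 * r + 1))).glob = ⟨3, U, r, j + 1, 0⟩ ∧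
      Cluster2Loop G r x j (part (run G p y (E + j * (2 * r + 1))).start) ∧
      ∀ e', E ≤ e' → e' < E + j * (2 * r + 1) → (run G p y e').glob.act ≠ 0 := by
    intro j
    induction j with
    | zero =>
      intro _
      rw [zero_mul, add_zero]
      refine ⟨hgl, ?_, fun e' h1 h2 => by omega⟩
      rw [part_of_eq_zero]
      · exact .init
      · intro v
        simp [NState.start, base, hgl]
    | succ j ih =>
      intro hj
      obtain ⟨h1, h2, h3⟩ := ih (by omega)
      have hlt : E + j * (2 * r + 1) < E + Nat.clog 2 n * (2 * r + 1) :=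
        Nat.add_lt_add_left (Nat.mul_lt_mul_of_pos_right (by omega) (by omega)) _
      have hx' := hx _ hlt (by rw [h1])
      rw [h1] at hx'
      obtain ⟨g1, g2, g3⟩ := cluster2Loop_step_of_run y hpn x U r j _ hr h1 hx' h2
      have he : E + j * (2 * r + 1) + (2 * r + 1) = E + (j + 1) * (2 * r + 1) := by ring
      rw [he] at g1 g2 g3
      rw [if_neg (by omega)] at g2
      refine ⟨g2, ?_, fun e' h4 h5 => ?_⟩
      · have : (run G p y (E + (j + 1) * (2 * r + 1))).start =
            (run G p y (E + (j + 1) * (2 * r + 1))).own := by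
          funext v
          simp [NState.start, base, g2]
        rw [this]
        exact g1
      · rcases Nat.lt_or_ge e' (E + j * (2 * r + 1)) with h | h
        · exact h3 e' h4 h
        · exact g3 e' h h5
  obtain ⟨j, hj⟩ : ∃ j, Nat.clog 2 n = j + 1 := ⟨Nat.clog 2 n - 1, by omega⟩
  obtain ⟨h1, h2, h3⟩ := key j (by omega)
  have hlt : E + j * (2 * r + 1) < E + Nat.clog 2 n * (2 * r + 1) :=
    Nat.add_lt_add_left (Nat.mul_lt_mul_of_pos_right (by omega) (by omega)) _
  have hx' := hx _ hlt (by rw [h1])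
  rw [h1] at hx'
  obtain ⟨g1, g2, g3⟩ := cluster2Loop_step_of_run y hpn x U r j _ hr h1 hx' h2
  have he : E + j * (2 * r + 1) + (2 * r + 1) = E + Nat.clog 2 n * (2 * r + 1) := by rw [hj]; ring
  rw [he] at g1 g2 g3
  rw [if_pos hj.symm] at g2
  refine ⟨hj ▸ g1, by rw [g2], fun e' h4 h5 => ?_⟩
  rcases Nat.lt_or_ge e' (E + j * (2 * r + 1)) with h | h
  · exact h3 e' h4 h
  · exact g3 e' h h5

theorem growFor_covered {s : ℕ} {c c' : PartialClustering (Fin n)} (h : GrowFor G s c c')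
    (hc : ∀ v, c v ≠ none) (v : Fin n) : c' v ≠ none := by
  induction h with
  | zero => exact hc v
  | step hgrow _ ih =>
    refine ih fun u => ?_
    obtain ⟨z, hz⟩ := Option.ne_none_iff_exists'.1 (hc u)
    rw [(hgrow u).1 z hz]
    simp

/-- In the last iteration of the for loop, all the nodes that are not covered become centers. -/
theorem cluster2Loop_covered (hn : 2 ≤ n) {r : ℕ} {x : ℕ × Fin n → unitInterval}
    {c : PartialClustering (Fin n)} (h : Cluster2Loop G r x (Nat.clog 2 n) c) (v : Fin n) :
    c v ≠ none := by
  obtain ⟨j, hj⟩ : ∃ j, Nat.clog 2 n = j + 1 :=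
    ⟨Nat.clog 2 n - 1, by have := clog_two_pos hn; omega⟩
  have hpow : n ≤ 2 ^ (j + 1) := hj ▸ Nat.le_pow_clog one_lt_two n
  rw [hj] at h
  cases h with
  | iterate _ hgrow =>
    refine growFor_covered hgrow (fun u => ?_) v
    have hp : (1 : ℝ) ≤ 2 ^ (j + 1) / (Fintype.card (Fin n) : ℝ) := by
      rw [Fintype.card_fin, le_div_iff₀ (by positivity), one_mul]
      exact_mod_cast hpow
    unfold selectCenters
    split_ifs with h
    · simp
    · exact fun h0 => h ⟨h0, (x (j + 1, u)).2.2.trans hp⟩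

end trace

end ClusterMR

/-! ### Labelled coins -/

namespace ClusterMR

open MapReduce GraphClustering

section labels

variable {n : ℕ} (G : SimpleGraph (Fin n)) (p : Params)

/-- The algorithm (`false` for `CLUSTER`, `true` for the for loop of `CLUSTER2`) and the iteration
in which the nodes toss coins next, if they do. -/
def Glob.label (gl : Glob) : Option (Bool × ℕ) :=
  if gl.act = 1 then some (false, gl.iter)
  else if gl.act = 3 then some (true, gl.iter)
  else none

/-- A measure of progress. -/
def Glob.rank (gl : Glob) (n : ℕ) : ℕ :=
  if gl.act = 1 then 2 * gl.iter
  else if gl.act = 2 then 2 * gl.iter + 1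
  -- The offset exceeds all the ranks within `CLUSTER`, where `iter ≤ n + 1`.
  else if gl.act = 3 then 2 * n + 4 + 2 * gl.iter
  else if gl.act = 4 then 2 * n + 5 + 2 * gl.iter
  else 6 * n + 20

/-- Every iteration selects once and then only grows. The strict increase after a toss is what
prevents a label from recurring. -/
theorem Glob.Small.rank_next {gl : Glob} (h : gl.Small n) (a : Agg) :
    gl.rank n ≤ (p.next gl a).rank n ∧
      (gl.act = 1 ∨ gl.act = 3 → gl.rank n < (p.next gl a).rank n) := by
  obtain ⟨act, unc, rad, iter, left⟩ := gl
  obtain ⟨h1, -, -, h4, -, -, -⟩ := h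
  simp only at h1 h4
  unfold Params.next
  simp only
  split_ifs with c1 c2 c3 c4 c5 c6 c7 c8
  · simp only [Glob.rank]; rcases c1 with rfl | rfl <;> simp <;> omega
  · simp only [Glob.rank]; rcases c1 with rfl | rfl <;> simp <;> omega
  · simp only [Glob.rank]; rcases c1 with rfl | rfl <;> simp
  · simp only [Glob.rank]; rcases c1 with rfl | rfl <;> simp
  · subst c5; simp [Glob.rank]
  · subst c6; simp [Glob.rank]; omega
  · subst c6; simp [Glob.rank]; omega
  · subst c6; simp [Glob.rank]
  · simp only [Glob.rank]; constructor
    · exact le_rfl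
    · omega

theorem rank_run_le {p : Params} (hp : p.Suits n) (y : ℕ × Fin n → unitInterval) {e e' : ℕ}
    (h : e ≤ e') : (run G p y e).glob.rank n ≤ (run G p y e').glob.rank n := by
  induction e', h using Nat.le_induction with
  | base => exact le_rfl
  | succ e' _ ih =>
    exact ih.trans ((small_run p hp.n_eq hp.two_le hp.tau_pos y e').glob.rank_next p _).1

/-- No iteration takes place twice. -/
theorem label_unique {p : Params} (hp : p.Suits n) (y : ℕ × Fin n → unitInterval) (e e' : ℕ)
    (l : Bool × ℕ) (h : e < e') (hl : (run G p y e).glob.label = some l) :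
    (run G p y e').glob.label ≠ some l := by
  intro hl'
  have hact : (run G p y e).glob.act = 1 ∨ (run G p y e).glob.act = 3 := by
    unfold Glob.label at hl
    split_ifs at hl with h1 h3
    exacts [Or.inl h1, Or.inr h3]
  have h1 := ((small_run (G := G) p hp.n_eq hp.two_le hp.tau_pos y e).glob.rank_next p
    (stats p (run G p y (e + 1)).own)).2 hact
  rw [← run_succ_glob] at h1
  have h2 := rank_run_le G hp y (Nat.succ_le_of_lt h)
  -- The label determines the rank, which has strictly increased in between.
  have hrank : ∀ gl : Glob, gl.label = some l →
      gl.rank n = if l.1 then 2 * n + 4 + 2 * l.2 else 2 * l.2 := by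
    intro gl hgl
    unfold Glob.label at hgl
    unfold Glob.rank
    split_ifs at hgl with c1 c3
    · rw [← Option.some.inj hgl, if_pos c1]; rfl
    · rw [← Option.some.inj hgl, if_neg c1, if_neg (by omega), if_pos c3]; rfl
  rw [hrank _ hl] at h1
  rw [Nat.succ_eq_add_one, hrank _ hl'] at h2
  omega

theorem run_congr (e : ℕ) (y y' : ℕ × Fin n → unitInterval)
    (h : ∀ e' < e, ∀ v, y (e', v) = y' (e', v)) : run G p y e = run G p y' e := by
  induction e with
  | zero => rfl
  | succ e ih =>
    have h1 : (fun v => y (e, v)) = fun v => y' (e, v) := funext fun v => h e (by omega) v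
    rw [run, run, ih fun e' he' => h e' (by omega), h1]

/-! ### Measurability of the labels -/

instance : Countable (NState n) := by
  have : Function.Injective fun S : NState n =>
      (S.own, S.glob.act, S.glob.unc, S.glob.rad, S.glob.iter, S.glob.left) := by
    intro S S' h
    simp only [Prod.mk.injEq] at h
    obtain ⟨h1, h2, h3, h4, h5, h6⟩ := h
    exact NState.ext h1 (Glob.ext h2 h3 h4 h5 h6)
  exact this.countable

theorem step_congr (S : NState n) (y y' : Fin n → unitInterval)
    (h : ∀ u, (y u : ℝ) ≤ p.thr S.glob ↔ (y' u : ℝ) ≤ p.thr S.glob) :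
    S.step G p y = S.step G p y' := by
  have hprop : ∀ u, S.prop p y u = S.prop p y' u := by
    intro u
    funext v
    simp only [NState.prop, h]
  have hfin : S.after G p y = S.after G p y' := by
    funext u
    simp only [NState.after, hprop]
  simp only [NState.step, hfin]

theorem measurableSet_run_eq (e : ℕ) (S : NState n) :
    MeasurableSet {y : ℕ × Fin n → unitInterval | run G p y e = S} := by
  classical
  induction e generalizing S with
  | zero => exact MeasurableSet.const (run G p (fun _ => 0) 0 = S)
  | succ e ih =>
    have hset : {y : ℕ × Fin n → unitInterval | run G p y (e + 1) = S} =
        ⋃ S', {y | run G p y e = S'} ∩ {y | (NState.step G p S' fun v => y (e, v)) = S} := by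
      ext y
      simp [run]
    rw [hset]
    refine MeasurableSet.iUnion fun S' => (ih S').inter ?_
    let D : (ℕ × Fin n → unitInterval) → Fin n → Bool :=
      fun y u => decide ((y (e, u) : ℝ) ≤ p.thr S'.glob)
    have hD : Measurable D := by
      refine measurable_pi_lambda _ fun u => ?_
      refine measurable_to_bool ?_
      have : (fun y : ℕ × Fin n → unitInterval => D y u) ⁻¹' {true} =
          {y | (y (e, u) : ℝ) ≤ p.thr S'.glob} := by
        ext y; simp [D]
      rw [this]
      exact measurableSet_le (measurable_subtype_coe.comp (measurable_pi_apply _))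
        measurable_const
    -- A step depends on its coins only through finitely many comparisons with the threshold, so the
    -- event is the preimage of a set of Boolean vectors.
    have hsat : {y : ℕ × Fin n → unitInterval | (NState.step G p S' fun v => y (e, v)) = S} =
        D ⁻¹' (D '' {y | (NState.step G p S' fun v => y (e, v)) = S}) := by
      refine Set.Subset.antisymm (Set.subset_preimage_image _ _) ?_
      rintro y ⟨y', hy', hDy⟩
      refine Eq.trans (step_congr G p S' _ _ fun u => ?_) hy'
      have := congrFun hDy u
      simp only [D, decide_eq_decide] at this
      exact this.symm
    rw [hsat]
    exact hD (Set.toFinite _).measurableSet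

theorem measurableSet_label_eq (e : ℕ) (l : Option (Bool × ℕ)) :
    MeasurableSet {y : ℕ × Fin n → unitInterval | (run G p y e).glob.label = l} := by
  have hset : {y : ℕ × Fin n → unitInterval | (run G p y e).glob.label = l} =
      ⋃ S ∈ {S : NState n | S.glob.label = l}, {y | run G p y e = S} := by
    ext y
    simp
  rw [hset]
  exact MeasurableSet.biUnion (Set.to_countable _) fun S _ => measurableSet_run_eq G p e S

/-- The seeds from which the coins are read off: those of the nodes at the beginning of the epochs
and spare ones. -/
def seedIndex : (ℕ × Fin n) ⊕ ((Bool × ℕ) × Fin n) → ℕ × List ℕ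
  | .inl q => (1 + q.1 * p.period, [(q.2 : ℕ), (q.2 : ℕ)])
  -- Round `0`, in which no reducer uses its seed, supplies infinitely many spare coins.
  | .inr q => (0, [if q.1.1 then 1 else 0, q.1.2, (q.2 : ℕ)])

theorem seedIndex_injective : Function.Injective (seedIndex (n := n) p) := by
  have hP := period_pos p
  rintro (⟨e, u⟩ | ⟨⟨b, i⟩, u⟩) (⟨e', u'⟩ | ⟨⟨b', i'⟩, u'⟩) h
  · simp only [seedIndex, Prod.mk.injEq, List.cons.injEq, and_true, and_self] at h
    have h1 : e * p.period = e' * p.period := by omega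
    rw [Nat.eq_of_mul_eq_mul_right hP h1, Fin.ext h.2]
  · simp [seedIndex] at h
  · simp [seedIndex] at h
  · simp only [seedIndex, Prod.mk.injEq, List.cons.injEq, and_true, true_and] at h
    have hb : b = b' := by
      cases b <;> cases b' <;> simp_all
    rw [hb, h.2.1, Fin.ext h.2.2]

/-- The coins of the clustering algorithm. -/
noncomputable def readCoins (N : ℕ) (ω : ℕ × List ℕ → unitInterval) (q : Bool × ℕ × Fin n) :
    unitInterval :=
  extractCoins (fun e y => (run G p y e).glob.label) N (fun k => ω (seedIndex p k))
    (Sum.inr ((q.1, q.2.1), q.2.2))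

theorem measurePreserving_readCoins (N : ℕ) :
    MeasurePreserving (readCoins G p N) (uniformLaw (ℕ × List ℕ)) (uniformLaw _) := by
  have h1 := measurePreserving_reindex (seedIndex (n := n) p) (seedIndex_injective p)
  have h2 := measurePreserving_extractCoins (lab := fun e y => (run G p y e).glob.label)
    (fun e y y' h => by simp only [run_congr G p e y y' h])
    (fun e l => measurableSet_label_eq G p e l) N
  have h3 := measurePreserving_reindex
    (fun q : Bool × ℕ × Fin n => (Sum.inr ((q.1, q.2.1), q.2.2) : (ℕ × Fin n) ⊕ _))
    (by
      rintro ⟨b, i, u⟩ ⟨b', i', u'⟩ h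
      simp only [Sum.inr.injEq, Prod.mk.injEq] at h
      obtain ⟨⟨rfl, rfl⟩, rfl⟩ := h
      rfl)
  exact h3.comp (h2.comp h1)

/-- Up to time `N`, the coins `x` that belong to the labels are the coins `y` that are used. -/
def Matches (N : ℕ) (y : ℕ × Fin n → unitInterval) (x : Bool × ℕ × Fin n → unitInterval) : Prop :=
  ∀ e < N, ∀ l, (run G p y e).glob.label = some l → ∀ v, x (l.1, l.2, v) = y (e, v)

/-- Matching up to a finite time suffices: terminating computations are over by `horizon n`, and
those that do not terminate toss coins in epoch `0` only. -/
theorem matches_readCoins {p : Params} (hp : p.Suits n) (N : ℕ)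
    (ω : ℕ × List ℕ → unitInterval) : Matches G p N (coins p ω n) (readCoins G p N ω) := by
  intro e he l hl v
  exact extractCoins_of_label (lab := fun e y => (run G p y e).glob.label)
    (fun e y y' h => by simp only [run_congr G p e y y' h])
    (fun y e e' l h h' => label_unique G hp y e e' l h h') l v N
    (fun k => ω (seedIndex p k)) e he hl

theorem Matches.cluster {G : SimpleGraph (Fin n)} {p : Params} {N : ℕ}
    {y : ℕ × Fin n → unitInterval} {x : Bool × ℕ × Fin n → unitInterval} (h : Matches G p N y x)
    {e : ℕ} (he : e < N) (hact : (run G p y e).glob.act = 1) (v : Fin n) :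
    x (false, (run G p y e).glob.iter, v) = y (e, v) :=
  h e he (false, (run G p y e).glob.iter) (by simp [Glob.label, hact]) v

theorem Matches.loop {G : SimpleGraph (Fin n)} {p : Params} {N : ℕ}
    {y : ℕ × Fin n → unitInterval} {x : Bool × ℕ × Fin n → unitInterval} (h : Matches G p N y x)
    {e : ℕ} (he : e < N) (hact : (run G p y e).glob.act = 3) (v : Fin n) :
    x (true, (run G p y e).glob.iter, v) = y (e, v) :=
  h e he (true, (run G p y e).glob.iter) (by simp [Glob.label, hact]) v

end labels

end ClusterMR

/-! ### Correctness of the algorithm -/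

namespace ClusterMR

open MapReduce GraphClustering

section correctness

variable {n : ℕ} {G : SimpleGraph (Fin n)} {p : Params}

theorem next_of_end {U i : ℕ} {a : Agg} (hhalf : 2 * a.cnt ≤ U)
    (hend : (a.cnt : ℝ) < 8 * p.τ * Real.logb 2 p.n) :
    p.next ⟨2, U, 0, i, 0⟩ a =
      if p.two = true ∧ a.top ≠ 0 then ⟨3, U, a.top, 1, 0⟩ else ⟨0, U, 0, i, 0⟩ := by
  simp [Params.next, hhalf, hend]

/-- Either the computation follows a terminating execution of `CLUSTER`, or neither the
computation nor `CLUSTER` terminates. -/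
theorem cluster_of_run (hp : p.Suits n) (hG : G.Connected) {N : ℕ} (hN : 2 * n ≤ N)
    {y : ℕ × Fin n → unitInterval} {x : Bool × ℕ × Fin n → unitInterval}
    (hM : Matches G p N y x) :
    (∃ E R, ClusterLoop G p.τ (fun q => x (false, q)) 1 (noClusters (Fin n)) R
        (part (run G p y E).own) ∧
      E ≤ 2 * R ∧ E ≤ 2 * n ∧ ExactDepths G (run G p y E).own ∧
      (∃ U i, (run G p y E).glob =
        if p.two = true ∧ (stats p (run G p y E).own).top ≠ 0 then
          ⟨3, U, (stats p (run G p y E).own).top, 1, 0⟩ else ⟨0, U, 0, i, 0⟩) ∧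
      ∀ e < E, (run G p y e).glob.act ≠ 0) ∨
    ((∀ e, (run G p y e).glob.act ≠ 0) ∧
      ∀ f R, ¬ ClusterRun G p.τ (fun q => x (false, q)) f R) := by
  have hpn := hp.n_eq
  have hn : 0 < n := lt_of_lt_of_le two_pos hp.two_le
  have hown : ∀ v, (run G p y 0).own v = 0 := fun v => rfl
  have hcard : (uncovered (noClusters (Fin n))).card = n := by
    simp [uncovered, noClusters]
  have hcnt : (stats p (run G p y 0).own).cnt = n := by
    rw [← card_uncovered_part (p := p), part_of_eq_zero hown, hcard]
  by_cases hbig : (n : ℝ) < 8 * p.τ * Real.logb 2 p.n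
  · left
    have htop : (stats p (run G p y 0).own).top = 0 := by
      refine Nat.eq_zero_of_le_zero ?_
      change (Finset.univ.sup fun v => depth p.n ((run G p y 0).own v)) ≤ 0
      refine Finset.sup_le fun v _ => ?_
      rw [hown]
      simp [depth]
    refine ⟨0, 0, ?_, le_rfl, Nat.zero_le _, exactDepths_zero hown, ⟨p.n, 1, ?_⟩,
      fun e he => absurd he (Nat.not_lt_zero e)⟩
    · rw [part_of_eq_zero hown]
      refine .finish ?_
      rw [hcard, Fintype.card_fin]
      simpa only [hpn] using hbig
    · rw [htop, if_neg (by simp)]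
      change p.first = _
      rw [Params.first, if_pos (by rwa [hpn] at hbig ⊢)]
  · have hgl : (run G p y 0).glob = ⟨1, n, 0, 1, 0⟩ := by
      change p.first = _
      rw [Params.first, hpn, if_neg (by rwa [hpn] at hbig)]
    have h1 : (run G p y 0).glob.act = 1 := by rw [hgl]
    -- Termination is decided here: once some node is covered, connectivity makes every later
    -- growing phase end, even if its own selection finds no center.
    by_cases hsel : ∃ u, (y (0, u) : ℝ) ≤ p.thr p.first
    · left
      obtain ⟨u, hu⟩ := hsel
      have hcov : (run G p y (0 + 1)).own u ≠ 0 := by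
        rw [run_succ_own, after_of_select (Or.inl h1), start_of_ne (by omega), if_pos (hown u),
          if_pos (show (y (0, u) : ℝ) ≤ p.thr (run G p y 0).glob from hu)]
        omega
      obtain ⟨E, R, hE1, hE2, hE3, hE4, ⟨U, i, hE5, hE6⟩, hE7, hE8⟩ :=
        clusterLoop_of_run y hp hG (fun q => x (false, q))
          (fun e he hact v => hM.cluster (by omega) hact v) n 0 1 hcnt hgl hbig
          (exactDepths_zero hown) ⟨u, hcov⟩ (by omega)
      rw [part_of_eq_zero hown] at hE1
      exact ⟨E, R, hE1, by omega, hE3, hE4, ⟨U, i, by rw [hE5, next_of_end hE6 hE7]⟩,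
        fun e he => hE8 e (Nat.zero_le e) he⟩
    · right
      push Not at hsel
      refine ⟨fun e => ?_, not_clusterRun hn (by rwa [hpn] at hbig) fun u => ?_⟩
      · rw [(run_of_no_center y hpn hbig (fun u => not_le.2 (hsel u)) hn e).2]
        simp only
        split_ifs <;> omega
      · have h := hM.cluster (e := 0) (by omega) h1 u
        rw [hgl] at h
        rw [h, not_le]
        have h' := hsel u
        change p.first = _ at hgl
        rwa [hgl, Params.thr, if_pos rfl, hpn] at h'

theorem maxRadius_le (hG : G.Connected) (f : Fin n → Fin n) : maxRadius G f ≤ n :=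
  Finset.sup_le fun v _ => (dist_lt_of_connected hG (f v) v).le

theorem eq_of_maxRadius_eq_zero (hG : G.Connected) {f : Fin n → Fin n} (h : maxRadius G f = 0)
    (v : Fin n) : f v = v := by
  have hle : G.dist (f v) v ≤ maxRadius G f :=
    Finset.le_sup (f := fun v => G.dist (f v) v) (Finset.mem_univ v)
  rw [h] at hle
  exact hG.dist_eq_zero_iff.1 (Nat.eq_zero_of_le_zero hle)

/-- If the radius is `0`, all the clusters of `CLUSTER2` are singletons. -/
theorem exists_cluster2Loop_zero (x : ℕ × Fin n → unitInterval) (i : ℕ) :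
    ∃ c, Cluster2Loop G 0 x i c ∧ ∀ v, c v = none ∨ c v = some v := by
  induction i with
  | zero => exact ⟨_, .init, fun v => Or.inl rfl⟩
  | succ i ih =>
    obtain ⟨c, hc, hself⟩ := ih
    refine ⟨_, .iterate hc (.zero _), fun v => ?_⟩
    unfold selectCenters
    split_ifs
    exacts [Or.inr rfl, hself v]

/-- The number of epochs up to which the coins have to be matched. -/
def horizon (n : ℕ) : ℕ := 2 * n + n * (2 * n + 1)

theorem clusterRun_of_run (hp : p.Suits n) (hG : G.Connected) (htwo : p.two = false)
    {y : ℕ × Fin n → unitInterval} {x : Bool × ℕ × Fin n → unitInterval}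
    (hM : Matches G p (horizon n) y x) :
    (∃ E R, ClusterRun G p.τ (fun q => x (false, q)) (centers (run G p y E).own) R ∧
      E ≤ 2 * R ∧ (run G p y E).glob.act = 0 ∧ ∀ e < E, (run G p y e).glob.act ≠ 0) ∨
    ((∀ e, (run G p y e).glob.act ≠ 0) ∧
      ∀ f R, ¬ ClusterRun G p.τ (fun q => x (false, q)) f R) := by
  refine (cluster_of_run hp hG (Nat.le_add_right _ _) hM).imp_left ?_
  rintro ⟨E, R, h1, h2, -, -, ⟨U, i, h3⟩, h4⟩
  exact ⟨E, R, ⟨_, h1, fun v => (part_getD _ v).symm⟩, h2, by rw [h3]; simp [htwo], h4⟩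

theorem cluster2Run_of_run (hp : p.Suits n) (hG : G.Connected) (htwo : p.two = true)
    {y : ℕ × Fin n → unitInterval} {x : Bool × ℕ × Fin n → unitInterval}
    (hM : Matches G p (horizon n) y x) :
    (∃ E R, Cluster2Run G p.τ x (centers (run G p y E).own) R ∧
      E ≤ 2 * R ∧ (run G p y E).glob.act = 0 ∧ ∀ e < E, (run G p y e).glob.act ≠ 0) ∨
    ((∀ e, (run G p y e).glob.act ≠ 0) ∧ ∀ f R, ¬ Cluster2Run G p.τ x f R) := by
  have hpn := hp.n_eq
  refine (cluster_of_run hp hG (Nat.le_add_right _ _) hM).imp ?_ ?_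
  · rintro ⟨E, R, h1, h2, h3, h4, ⟨U, i, h5⟩, h6⟩
    have hrun : ClusterRun G p.τ (fun q => x (false, q)) (centers (run G p y E).own) R :=
      ⟨_, h1, fun v => (part_getD _ v).symm⟩
    rw [h4.stats_top hpn] at h5
    have hradius := maxRadius_le hG (centers (run G p y E).own)
    -- With radius `0` the computation has stopped after `CLUSTER`, whose clusters are singletons.
    -- The for loop of `CLUSTER2` performs no growing steps and returns singletons too, all nodes
    -- being covered after its last iteration.
    by_cases htop : maxRadius G (centers (run G p y E).own) = 0
    · obtain ⟨c, hc, hself⟩ :=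
        exists_cluster2Loop_zero (G := G) (fun q => x (true, q)) (Nat.clog 2 n)
      refine ⟨E, R, ⟨_, R, c, hrun, by rwa [htop, Fintype.card_fin], fun v => ?_, by simp [htop]⟩,
        h2, by rw [h5]; simp [htop], h6⟩
      rw [eq_of_maxRadius_eq_zero hG htop]
      exact (hself v).resolve_left (cluster2Loop_covered hp.two_le hc v)
    · set r := maxRadius G (centers (run G p y E).own)
      rw [if_pos ⟨htwo, htop⟩] at h5
      have hK := clog_two_pos hp.two_le
      -- The horizon allows `2 * n` epochs for `CLUSTER`, and `n` iterations of at most `2 * n + 1`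
      -- epochs for the for loop.
      have hE : E + Nat.clog 2 n * (2 * r + 1) ≤ horizon n :=
        Nat.add_le_add h3 (Nat.mul_le_mul (clog_two_le n) (by omega))
      obtain ⟨g1, g2, g3⟩ := cluster2Loop_of_run y hpn (fun q => x (true, q)) U r E
        (Nat.pos_of_ne_zero htop) h5 hK fun e he hact v => hM.loop (by omega) hact v
      refine ⟨_, R + Nat.clog 2 n * (2 * r), ⟨_, R, _, hrun, by rwa [Fintype.card_fin],
        fun v => ?_, by rw [Fintype.card_fin]⟩, ?_, g2, fun e he => ?_⟩
      · exact part_eq_some.2 ⟨fun h0 => cluster2Loop_covered hp.two_le g1 v (part_eq_none.2 h0),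
          rfl⟩
      · have : Nat.clog 2 n * (2 * r + 1) ≤ 2 * (Nat.clog 2 n * (2 * r)) := by
          rw [mul_left_comm]
          exact Nat.mul_le_mul_left _ (by omega)
        omega
      · rcases Nat.lt_or_ge e E with h | h
        exacts [h6 e h, g3 e h he]
  · rintro ⟨h1, h2⟩
    refine ⟨h1, ?_⟩
    rintro f R ⟨g, R₁, c, h, -⟩
    exact h2 g R₁ h

/-- An algorithm that the computation follows is implemented. -/
theorem implements_of_run (hp : p.Suits n) {MG ML : ℕ} (hML : 64 * p.B ≤ ML)
    (hMG : 200 * G.edgeSet.ncard ≤ MG) (hn : n ≤ G.edgeSet.ncard + 1) {ι : Type}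
    {emb : ι → Bool × ℕ × Fin n} (hemb : Function.Injective emb)
    {Run : (ι → unitInterval) → (Fin n → Fin n) → ℕ → Prop}
    (hRun : ∀ y x, Matches G p (horizon n) y x →
      (∃ E R, Run (fun i => x (emb i)) (centers (run G p y E).own) R ∧
        E ≤ 2 * R ∧ (run G p y E).glob.act = 0 ∧ ∀ e < E, (run G p y e).glob.act ≠ 0) ∨
      ((∀ e, (run G p y e).glob.act ≠ 0) ∧ ∀ f R, ¬ Run (fun i => x (emb i)) f R)) :
    p.algorithm.Implements (n ^ 200) MG ML G Run
      fun R => (8 * p.L + 12) * max 1 (R : ℝ) := by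
  refine ⟨fun ω i => readCoins G p (horizon n) ω (emb i),
    (measurePreserving_reindex emb hemb).comp (measurePreserving_readCoins G p (horizon n)),
    fun ω => ⟨fitsMemory G ω hp hML hMG hn, ?_⟩⟩
  rcases hRun _ _ (matches_readCoins G hp (horizon n) ω) with ⟨E, R, h1, h2, h3, h4⟩ | ⟨h1, h2⟩
  · have hmin : ∀ e, (stateAt G p ω e).glob.act = 0 → E ≤ e := fun e he => by
      by_contra hlt
      exact h4 e (not_le.1 hlt) he
    have hhalt := haltsAfter_of_stop G ω hp E h3 hmin
    refine ⟨iff_of_true ⟨_, hhalt⟩ ⟨_, _, h1⟩, fun T hT => ?_⟩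
    obtain rfl := hT.unique hhalt
    refine ⟨_, R, h1, ?_, ?_⟩
    · rw [config_stop G p ω hp.n_eq hp.pow_height E h3 hmin]
      rfl
    -- There are `E * (4 * L + 5) + 2` rounds with `E ≤ 2 * max 1 R`, and the last summand is at
    -- most `2 * max 1 R`; this gives the factor `8 * L + 12`.
    · have hE : (E : ℝ) ≤ 2 * max 1 (R : ℝ) := by
        have : (E : ℝ) ≤ 2 * R := by exact_mod_cast h2
        linarith [le_max_right (1 : ℝ) (R : ℝ)]
      have hone := le_max_left (1 : ℝ) (R : ℝ)
      have hP : (0 : ℝ) ≤ 4 * p.L + 5 := by positivity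
      rw [Params.period]
      push_cast
      nlinarith
  · refine ⟨iff_of_false ?_ ?_, fun T hT => absurd hT (not_haltsAfter G ω hp h1 T)⟩
    · rintro ⟨T, hT⟩
      exact not_haltsAfter G ω hp h1 T hT
    · rintro ⟨f, R, h⟩
      exact h2 f R h

end correctness

end ClusterMR

/-! ### The number of rounds -/

namespace ClusterMR

open MapReduce GraphClustering

section rounds

variable {n m τ MG ML : ℕ} {G : SimpleGraph (Fin n)}

/-- The height of the tries for a given local memory. -/
def trieHeight (n ML : ℕ) : ℕ := Nat.clog (ML / 64) (n ^ 2)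

theorem suits_params (hn : 2 ≤ n) (hτ : 0 < τ) (hML : 200 ≤ ML) (two : Bool) :
    (⟨n, τ, ML / 64, trieHeight n ML, two⟩ : Params).Suits n := by
  have hB : 1 < ML / 64 := by omega
  exact ⟨rfl, hn, hτ, Nat.le_pow_clog hB _,
    Nat.clog_le_of_le_pow (Nat.lt_pow_self hB).le, hB⟩

/-- Passing from `ML` to the arity costs only a constant factor in the logarithm: with `B = ML / 64
≥ 3`, one has `ML ≤ 64 * B + 64 ≤ 3 ^ 5 * B ≤ B ^ 6`. -/
theorem log_le_log_arity (hML : 200 ≤ ML) :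
    Real.log ML ≤ 6 * Real.log ((ML / 64 : ℕ) : ℝ) := by
  have hB : 3 ≤ ML / 64 := by omega
  have hle : ML ≤ 64 * (ML / 64) + 64 := by omega
  have hpow : ML ≤ (ML / 64) ^ 6 := by
    have h5 : 3 ^ 5 ≤ (ML / 64) ^ 5 := Nat.pow_le_pow_left hB 5
    have h6 : 3 ^ 5 * (ML / 64) ≤ (ML / 64) ^ 5 * (ML / 64) := Nat.mul_le_mul_right _ h5
    rw [pow_succ _ 5]
    omega
  have hcast : (ML : ℝ) ≤ ((ML / 64 : ℕ) : ℝ) ^ 6 := by exact_mod_cast hpow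
  have hpos : (0 : ℝ) < ML := by exact_mod_cast (by omega : 0 < ML)
  calc Real.log ML ≤ Real.log (((ML / 64 : ℕ) : ℝ) ^ 6) := Real.log_le_log hpos hcast
    _ = 6 * Real.log ((ML / 64 : ℕ) : ℝ) := by rw [Real.log_pow]; norm_num

/-- Minimality of the height `L` gives `B ^ (L - 1) < n ^ 2`. As `n ≤ 2 * m`, both `log 2` and `log
m` are at most `lam * log ML`, so `2 * log n ≤ 4 * lam * log ML ≤ 24 * lam * log B`. The last level
adds `1 ≤ lam`. -/
theorem trieHeight_le (hn : 2 ≤ n) (hm : n ≤ m + 1) (hML : 200 ≤ ML) :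
    (trieHeight n ML : ℝ) ≤ 25 * max 1 (Real.logb ML m) := by
  set lam := max 1 (Real.logb ML m)
  set B := ML / 64 with hBdef
  have hB : 1 < B := by omega
  have hlogB : 0 < Real.log (B : ℝ) := Real.log_pos (by exact_mod_cast hB)
  have hlogML : 0 < Real.log (ML : ℝ) := Real.log_pos (by exact_mod_cast (by omega : 1 < ML))
  have hlam : 1 ≤ lam := le_max_left _ _
  have hlogm : Real.log m ≤ lam * Real.log ML := by
    have h : Real.logb ML m ≤ lam := le_max_right _ _
    rwa [Real.logb, div_le_iff₀ hlogML] at h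
  have hlogn : Real.log n ≤ Real.log 2 + Real.log m := by
    have hmpos : (0 : ℝ) < m := by exact_mod_cast (by omega : 0 < m)
    rw [← Real.log_mul two_ne_zero hmpos.ne']
    refine Real.log_le_log (by exact_mod_cast (by omega : 0 < n)) ?_
    exact_mod_cast (by omega : n ≤ 2 * m)
  have hlog2 : Real.log 2 ≤ Real.log ML :=
    Real.log_le_log two_pos (by exact_mod_cast (by omega : 2 ≤ ML))
  have hML6 := log_le_log_arity hML
  have hpow : B ^ (trieHeight n ML - 1) < n ^ 2 :=
    Nat.pow_pred_clog_lt_self hB (Nat.one_lt_pow two_ne_zero (by omega))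
  have hlogpow : ((trieHeight n ML - 1 : ℕ) : ℝ) * Real.log B ≤ 2 * Real.log n := by
    have hcast : ((B : ℝ)) ^ (trieHeight n ML - 1) ≤ (n : ℝ) ^ 2 := by exact_mod_cast hpow.le
    have hBpos : (0 : ℝ) < B := by exact_mod_cast (by omega : 0 < B)
    have := Real.log_le_log (pow_pos hBpos _) hcast
    rw [Real.log_pow, Real.log_pow] at this
    exact_mod_cast this
  have h24 : ((trieHeight n ML - 1 : ℕ) : ℝ) ≤ 24 * lam := by
    refine le_of_mul_le_mul_right (hlogpow.trans ?_) hlogB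
    have h1 : Real.log ML ≤ lam * Real.log ML := le_mul_of_one_le_left hlogML.le hlam
    have h2 : lam * Real.log ML ≤ lam * (6 * Real.log B) :=
      mul_le_mul_of_nonneg_left hML6 (by linarith)
    linarith
  have hsub : (trieHeight n ML : ℝ) ≤ ((trieHeight n ML - 1 : ℕ) : ℝ) + 1 := by
    exact_mod_cast (by omega : trieHeight n ML ≤ trieHeight n ML - 1 + 1)
  linarith

theorem ncard_edgeSet_le (G : SimpleGraph (Fin n)) : G.edgeSet.ncard ≤ n ^ 2 := by
  classical
  rw [Set.ncard_eq_toFinset_card']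
  have h := G.card_edgeFinset_le_card_choose_two
  rw [Fintype.card_fin] at h
  exact h.trans (Nat.choose_le_pow n 2)

/-- Taking logarithms, `ε * log n ≤ log ML - log a ≤ (1 + |log a|) * log ML`, where the last step
uses `log ML ≥ 1`; and `log m ≤ 2 * log n`. -/
theorem logb_le_of_rpow_le {a ε : ℝ} (ha : 0 < a) (hε : 0 < ε) (hn : 2 ≤ n) (hm : 0 < m)
    (hmn : m ≤ n ^ 2) (hML : 200 ≤ ML) (h : a * (n : ℝ) ^ ε ≤ ML) :
    Real.logb ML m ≤ 2 * ((1 + |Real.log a|) / ε) := by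
  have hnpos : (0 : ℝ) < n := by exact_mod_cast (by omega : 0 < n)
  have hone : 1 ≤ Real.log (ML : ℝ) := by
    rw [Real.le_log_iff_exp_le (by exact_mod_cast (by omega : 0 < ML))]
    have h3 : (200 : ℝ) ≤ ML := by exact_mod_cast hML
    linarith [Real.exp_one_lt_d9]
  have hlog : Real.log a + ε * Real.log n ≤ Real.log ML := by
    have := Real.log_le_log (by positivity) h
    rwa [Real.log_mul ha.ne' (Real.rpow_pos_of_pos hnpos ε).ne', Real.log_rpow hnpos] at this
  have hlogm : Real.log m ≤ 2 * Real.log n := by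
    have := Real.log_le_log (by exact_mod_cast hm)
      (by exact_mod_cast hmn : (m : ℝ) ≤ (n : ℝ) ^ 2)
    rw [Real.log_pow] at this
    exact_mod_cast this
  have habs : -Real.log a ≤ |Real.log a| := neg_le_abs _
  have hlogn : Real.log n ≤ (1 + |Real.log a|) / ε * Real.log ML := by
    rw [div_mul_eq_mul_div, le_div_iff₀ hε]
    have : |Real.log a| ≤ |Real.log a| * Real.log ML := le_mul_of_one_le_right (abs_nonneg _) hone
    linarith
  rw [Real.logb, div_le_iff₀ (by linarith)]
  linarith

/-- An algorithm that the computation follows can be implemented. -/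
theorem implementableInMR_of_run {ι : ℕ → Type} (emb : ∀ n, ι n → Bool × ℕ × Fin n)
    (hemb : ∀ n, Function.Injective (emb n)) (two : Bool)
    (Run : ∀ {n : ℕ}, SimpleGraph (Fin n) → ℕ → (ι n → unitInterval) → (Fin n → Fin n) → ℕ → Prop)
    (hRun : ∀ (n : ℕ) (G : SimpleGraph (Fin n)) (p : Params) (y : ℕ × Fin n → unitInterval)
      (x : Bool × ℕ × Fin n → unitInterval), p.Suits n → G.Connected → p.two = two →
      Matches G p (horizon n) y x →
      (∃ E R, Run G p.τ (fun i => x (emb n i)) (centers (run G p y E).own) R ∧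
        E ≤ 2 * R ∧ (run G p y E).glob.act = 0 ∧ ∀ e < E, (run G p y e).glob.act ≠ 0) ∨
      ((∀ e, (run G p y e).glob.act ≠ 0) ∧ ∀ f R, ¬ Run G p.τ (fun i => x (emb n i)) f R)) :
    ImplementableInMR ι Run := by
  let param : ℕ → ℕ → ℕ → Params := fun n τ ML => ⟨n, τ, ML / 64, trieHeight n ML, two⟩
  have key : ∀ (n m τ MG ML : ℕ) (G : SimpleGraph (Fin n)), Admissible 200 m τ MG ML G →
      (param n τ ML).algorithm.Implements (n ^ 200) MG ML G (Run G τ)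
        fun R => 212 * max 1 (R : ℝ) * max 1 (Real.logb ML m) := by
    rintro n m τ MG ML G ⟨hn, hτ, hML, hMG, hG, rfl⟩
    have hp := suits_params hn hτ hML two
    have hm : n ≤ G.edgeSet.ncard + 1 := by
      have := hG.card_vert_le_card_edgeSet_add_one
      rwa [Nat.card_fin, Nat.card_coe_set_eq] at this
    refine (implements_of_run (G := G) hp (Nat.mul_div_le ML 64) hMG hm (hemb n)
      fun y x hM => hRun n G _ y x hp hG rfl hM).mono fun R => ?_
    -- The constant is `212 = 8 * 25 + 12`, the summand `12` being absorbed because the maximum is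
    -- at least `1`.
    have h1 := trieHeight_le hn hm hML
    have h2 := le_max_left 1 (Real.logb ML (G.edgeSet.ncard : ℝ))
    have h3 := le_max_left 1 (R : ℝ)
    change (8 * (trieHeight n ML : ℝ) + 12) * max 1 (R : ℝ) ≤ _
    rw [mul_right_comm]
    exact mul_le_mul_of_nonneg_right (by linarith) (by linarith)
  refine ⟨200, fun n m τ MG ML => (param n τ ML).algorithm, by norm_num, ⟨212, key⟩, ?_⟩
  intro a ε ha hε
  refine ⟨212 * max 1 (2 * ((1 + |Real.log a|) / ε)), fun n m τ MG ML G hadm h => ?_⟩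
  refine (key n m τ MG ML G hadm).mono fun R => ?_
  obtain ⟨hn, hτ, hML, hMG, hG, rfl⟩ := hadm
  have hm : n ≤ G.edgeSet.ncard + 1 := by
    have := hG.card_vert_le_card_edgeSet_add_one
    rwa [Nat.card_fin, Nat.card_coe_set_eq] at this
  have hlogb := logb_le_of_rpow_le ha hε hn (by omega : 0 < G.edgeSet.ncard) (ncard_edgeSet_le G)
    hML h
  rw [mul_right_comm]
  have h3 := le_max_left 1 (R : ℝ)
  exact mul_le_mul_of_nonneg_right
    (mul_le_mul_of_nonneg_left (max_le_max le_rfl hlogb) (by norm_num)) (by linarith)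

end rounds

end ClusterMR

theorem mainTheorem8 :
    MapReduce.ImplementableInMR (fun n => ℕ × Fin n)
      (fun G τ x f R => GraphClustering.ClusterRun G τ x f R) ∧
    MapReduce.ImplementableInMR (fun n => Bool × ℕ × Fin n)
      (fun G τ x f R => GraphClustering.Cluster2Run G τ x f R) :=
  ⟨ClusterMR.implementableInMR_of_run (fun _ q => (false, q)) (fun _ _ _ h => (Prod.ext_iff.1 h).2)
      false _ fun _ _ _ _ _ hp hG htwo hM => ClusterMR.clusterRun_of_run hp hG htwo hM,
    ClusterMR.implementableInMR_of_run (fun _ q => q) (fun _ _ _ h => h) true _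
      fun _ _ _ _ _ hp hG htwo hM => ClusterMR.cluster2Run_of_run hp hG htwo hM⟩
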